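/- Let $k$ be an algebraically closed field of characteristic $p>0$, let $W=W(k)$ be its ring of infinite Witt vectors, let $G,H$ be finite groups, and let $A$ (resp. $B$) be a block of $WG$ (resp. $WH$); put $kA=k\otimes_WA$, $kB=k\otimes_WB$. Let $\hat{\mathcal C}$ be the category of complete local commutative Noetherian $W$-algebras $R$ with residue field $k$, with continuous $W$-algebra homomorphisms inducing the identity on $k$. For a finitely generated $kG$-module $V$, a lift of $V$ over $R$ is a pair $(U,\phi)$ of an $RG$-module $U$ that is finitely generated and free over $R$ and an isomorphism $\phi:k\otimes_RU\to V$ of $kG$-modules; an isomorphism of lifts $(U,\phi)\to(U',\phi')$ is an $RG$-isomorphism $\alpha$ with $\phi=\phi'\circ(k\otimes\alpha)$. An object $R$ of $\hat{\mathcal C}$ is a versal deformation ring of $V$, written $R(G,V)$, if there is a lift $U$ of $V$ over $R$ such that every lift of $V$ over every $R'$ in $\hat{\mathcal C}$ is isomorphic to $R'\otimes_{R,f}U$ for some morphism $f:R\to R'$ in $\hat{\mathcal C}$, and such that for $R'=k[\epsilon]$ $(\epsilon^2=0)$ the morphism $f$ is unique. For a commutative ring $S$ and $S$-algebras $\Lambda,\Gamma$,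 a finitely generated $\Gamma$-$\Lambda$-bimodule $M$ and a finitely generated $\Lambda$-$\Gamma$-bimodule $N$ (with $S$ acting centrally) induce a stable equivalence of Morita type between $\Lambda$ and $\Gamma$ if $M$ and $N$ are projective both as left and as right modules, $N\otimes_\Gamma M\cong \Lambda\oplus P$ as $\Lambda$-$\Lambda$-bimodules and $M\otimes_\Lambda N\cong \Gamma\oplus Q$ as $\Gamma$-$\Gamma$-bimodules, where $P$ and $Q$ are projective bimodules. Let $V$ be a finitely generated $kA$-module. (1) Suppose that a $B$-$A$-bimodule $M$ and an $A$-$B$-bimodule $N$ induce a stable equivalence of Morita type between the $W$-algebras $A$ and $B$, and let $V'=(k\otimes_WM)\otimes_{kA}V$. Then $V$ has a versal deformation ring if and only if $V'$ has one, and any versal deformation rings $R(G,V)$ and $R(H,V')$ are isomorphic in $\hat{\mathcal C}$. (2) Suppose that a $kB$-$kA$-bimodule $M_k$ and a $kA$-$kB$-bimodule $N_k$ induce a stable equivalence of Morita type between the $k$-algebras $kA$ and $kB$, and let $V'=M_k\otimes_{kA}V$. Then for any versal deformation rings, $R(G,V)/pR(G,V)\cong R(H,V')/pR(H,V')$ as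 $W$-algebras. -/

import Mathlib

open scoped TensorProduct
open MulOpposite (op)

universe u v

/-! ### Blocks of group rings -/

/-- A block of the group ring `S[G]`, given by its block idempotent: a primitive idempotent of the
centre of `S[G]`. -/
structure GroupBlock (S : Type*) (G : Type*) [CommRing S] [Group G] where
  /-- the block idempotent -/
  e : MonoidAlgebra S G
  idem : IsIdempotentElem e
  central : IsMulCentral e
  ne_zero : e ≠ 0
  primitive : ∀ f : MonoidAlgebra S G, IsIdempotentElem f → IsMulCentral f → f * e = f →
    f = 0 ∨ f = e

namespace GroupBlock

variable {S : Type*} {G : Type*} [CommRing S] [Group G] (b : GroupBlock S G)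

/-- The block algebra `e S[G] = e S[G] e`, a ring with identity `e`. -/
abbrev Alg : Type _ := b.idem.Corner

/-- The projection `S[G] → e S[G]`, `x ↦ e x e = e x`, as a ring homomorphism. -/
noncomputable def projRingHom : MonoidAlgebra S G →+* b.Alg where
  toFun x := ⟨b.e * x * b.e, x, rfl⟩
  map_one' := Subtype.ext (by
    change b.e * 1 * b.e = b.e
    rw [mul_one, b.idem.eq])
  map_mul' x y := Subtype.ext (by
    change b.e * (x * y) * b.e = (b.e * x * b.e) * (b.e * y * b.e)
    have h1 : b.e * x = x * b.e := (b.central.comm x).eq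
    have h2 : b.e * y = y * b.e := (b.central.comm y).eq
    simp only [h1, h2, mul_assoc, b.idem.eq]
    simp only [← mul_assoc, h1])
  map_zero' := Subtype.ext (by
    change b.e * 0 * b.e = 0
    simp)
  map_add' x y := Subtype.ext (by
    change b.e * (x + y) * b.e = b.e * x * b.e + b.e * y * b.e
    rw [mul_add, add_mul])

/-- The block algebra is an `S`-algebra through `s ↦ s e`. -/
noncomputable instance : Algebra S b.Alg :=
  (b.projRingHom.comp (algebraMap S (MonoidAlgebra S G))).toAlgebra' (by
    rintro s ⟨x, hx⟩
    refine Subtype.ext ?_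
    change (b.e * algebraMap S _ s * b.e) * x = x * (b.e * algebraMap S _ s * b.e)
    obtain ⟨h1, h2⟩ := (Subsemigroup.mem_corner_iff b.idem).mp hx
    rw [← Algebra.commutes s b.e, mul_assoc, mul_assoc, ← mul_assoc b.e b.e x, b.idem.eq, h1,
      mul_assoc, b.idem.eq, ← mul_assoc, ← Algebra.commutes s x, mul_assoc, h2])

/-- The projection `S[G] → e S[G]` as an `S`-algebra homomorphism. -/
noncomputable def proj : MonoidAlgebra S G →ₐ[S] b.Alg where
  __ := b.projRingHom
  commutes' _ := rfl

end GroupBlock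

/-- For a block `A` of `S[G]` and a commutative `S`-algebra `T`, the `T`-linear action of `G` on a
module over `TA = T ⊗[S] A`, through `T[G] → TA`; on group elements this is `g ↦ 1 ⊗ e g`. -/
noncomputable def GroupBlock.rep {S G : Type*} [CommRing S] [Group G] (b : GroupBlock S G)
    (T : Type*) [CommRing T] [Algebra S T] (V : Type*) [AddCommGroup V] [Module T V]
    [Module (T ⊗[S] b.Alg) V] [IsScalarTower T (T ⊗[S] b.Alg) V] : Representation T G V :=
  ((Algebra.lsmul T T V : (T ⊗[S] b.Alg) →ₐ[T] Module.End T V) :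
      (T ⊗[S] b.Alg) →* Module.End T V).comp
    (((Algebra.TensorProduct.includeRight : b.Alg →ₐ[S] T ⊗[S] b.Alg) :
        b.Alg →* T ⊗[S] b.Alg).comp
      ((b.proj : MonoidAlgebra S G →* b.Alg).comp (MonoidAlgebra.of S G)))

/-! ### Tensor products over noncommutative algebras -/

section TensorOver

/-- The relations `m a ⊗ v = m ⊗ a v`. A right `A`-module is a module over `Aᵐᵒᵖ`. -/
def tensorOverRel (S A M V : Type*) [CommRing S] [Ring A] [AddCommGroup M] [Module S M]
    [Module Aᵐᵒᵖ M] [AddCommGroup V] [Module S V] [Module A V] : Submodule S (M ⊗[S] V) :=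
  Submodule.span S {x | ∃ (m : M) (a : A) (v : V), x = (op a • m) ⊗ₜ[S] v - m ⊗ₜ[S] (a • v)}

/-- `M ⊗_A V` for an `S`-algebra `A`, a right `A`-module `M` and a left `A`-module `V`. -/
def TensorOver (S A M V : Type*) [CommRing S] [Ring A] [AddCommGroup M] [Module S M]
    [Module Aᵐᵒᵖ M] [AddCommGroup V] [Module S V] [Module A V] : Type _ :=
  (M ⊗[S] V) ⧸ tensorOverRel S A M V

variable {S A M V : Type*} [CommRing S] [Ring A] [AddCommGroup M] [Module S M]
    [Module Aᵐᵒᵖ M] [AddCommGroup V] [Module S V] [Module A V]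

instance : AddCommGroup (TensorOver S A M V) :=
  inferInstanceAs (AddCommGroup ((M ⊗[S] V) ⧸ tensorOverRel S A M V))

instance (priority := 2000) TensorOver.baseModule : Module S (TensorOver S A M V) :=
  inferInstanceAs (Module S ((M ⊗[S] V) ⧸ tensorOverRel S A M V))

/-- The class of the pure tensor `m ⊗ v` in `M ⊗_A V`. -/
def TensorOver.mk (S A : Type*) {M V : Type*} [CommRing S] [Ring A] [AddCommGroup M] [Module S M]
    [Module Aᵐᵒᵖ M] [AddCommGroup V] [Module S V] [Module A V] (m : M) (v : V) :
    TensorOver S A M V :=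
  Submodule.Quotient.mk (m ⊗ₜ[S] v)

theorem TensorOver.add_mk (m m' : M) (v : V) :
    TensorOver.mk S A (m + m') v = TensorOver.mk S A m v + TensorOver.mk S A m' v :=
  (congrArg (Submodule.Quotient.mk (p := tensorOverRel S A M V))
    (TensorProduct.add_tmul m m' v)).trans (Submodule.Quotient.mk_add _)

theorem TensorOver.mk_add (m : M) (v v' : V) :
    TensorOver.mk S A m (v + v') = TensorOver.mk S A m v + TensorOver.mk S A m v' :=
  (congrArg (Submodule.Quotient.mk (p := tensorOverRel S A M V))
    (TensorProduct.tmul_add m v v')).trans (Submodule.Quotient.mk_add _)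

/-- Two additive maps out of `M ⊗_A V` agree if they agree on pure tensors. -/
theorem TensorOver.addHom_ext {X : Type*} [AddCommMonoid X] {f g : TensorOver S A M V →+ X}
    (h : ∀ m v, f (TensorOver.mk S A m v) = g (TensorOver.mk S A m v)) : f = g := by
  ext x
  obtain ⟨y, rfl⟩ := Submodule.Quotient.mk_surjective _ x
  induction y using TensorProduct.induction_on with
  | zero => exact (map_zero f).trans (map_zero g).symm
  | tmul m v => exact h m v
  | add y z hy hz =>
    exact (map_add f (Submodule.Quotient.mk y) (Submodule.Quotient.mk z)).trans
      ((congrArg₂ (· + ·) hy hz).trans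
        (map_add g (Submodule.Quotient.mk y) (Submodule.Quotient.mk z)).symm)

/-- The action of endomorphisms of `M` that commute with `A`. -/
noncomputable def TensorOver.mapLeft (f : M →ₗ[S] M)
    (hf : ∀ (a : A) (m : M), f (op a • m) = op a • f m) :
    TensorOver S A M V →ₗ[S] TensorOver S A M V :=
  Submodule.mapQ _ _ (f.rTensor V) (by
    refine Submodule.span_le.mpr ?_
    rintro _ ⟨m, a, v, rfl⟩
    refine Submodule.subset_span ⟨f m, a, v, ?_⟩
    simp [hf])

/-- The action of endomorphisms of `V` that commute with `A`. -/
noncomputable def TensorOver.mapRight (f : V →ₗ[S] V)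
    (hf : ∀ (a : A) (v : V), f (a • v) = a • f v) :
    TensorOver S A M V →ₗ[S] TensorOver S A M V :=
  Submodule.mapQ _ _ (f.lTensor M) (by
    refine Submodule.span_le.mpr ?_
    rintro _ ⟨m, a, v, rfl⟩
    refine Submodule.subset_span ⟨m, a, f v, ?_⟩
    simp [hf])

/-- For a `B`-`A`-bimodule `M`, the left `B`-module structure `b (m ⊗ v) = (b m) ⊗ v`. -/
noncomputable instance TensorOver.leftModule {B : Type*} [Ring B] [Algebra S B] [Module B M]
    [IsScalarTower S B M] [SMulCommClass B Aᵐᵒᵖ M] : Module B (TensorOver S A M V) where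
  smul b x := TensorOver.mapLeft (Algebra.lsmul S S M b) (fun a m => smul_comm b (op a) m) x
  one_smul x := DFunLike.congr_fun (TensorOver.addHom_ext
    (f := (TensorOver.mapLeft (Algebra.lsmul S S M (1 : B))
      (fun a m => smul_comm (1 : B) (op a) m)).toAddMonoidHom) (g := AddMonoidHom.id _)
    (fun m v => congrArg (fun t => TensorOver.mk S A t v) (one_smul B m))) x
  mul_smul b c x := DFunLike.congr_fun (TensorOver.addHom_ext
    (f := (TensorOver.mapLeft (Algebra.lsmul S S M (b * c))
      (fun a m => smul_comm (b * c) (op a) m)).toAddMonoidHom)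
    (g := (TensorOver.mapLeft (Algebra.lsmul S S M b)
      (fun a m => smul_comm b (op a) m)).toAddMonoidHom.comp
      (TensorOver.mapLeft (Algebra.lsmul S S M c)
      (fun a m => smul_comm c (op a) m)).toAddMonoidHom)
    (fun m v => congrArg (fun t => TensorOver.mk S A t v) (mul_smul b c m))) x
  smul_zero b := map_zero _
  smul_add b x y := map_add _ x y
  add_smul b c x := by
    have h : TensorOver.mapLeft (V := V) (Algebra.lsmul S S M (b + c))
        (fun a m => smul_comm (b + c) (op a) m) =
        TensorOver.mapLeft (Algebra.lsmul S S M b) (fun a m => smul_comm b (op a) m) +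
        TensorOver.mapLeft (Algebra.lsmul S S M c) (fun a m => smul_comm c (op a) m) :=
      LinearMap.toAddMonoidHom_injective (TensorOver.addHom_ext fun m v =>
        (congrArg (fun t => TensorOver.mk S A t v) (add_smul b c m)).trans
          (TensorOver.add_mk (b • m) (c • m) v))
    exact LinearMap.congr_fun h x
  zero_smul x := DFunLike.congr_fun (TensorOver.addHom_ext
    (f := (TensorOver.mapLeft (Algebra.lsmul S S M (0 : B))
      (fun a m => smul_comm (0 : B) (op a) m)).toAddMonoidHom) (g := 0)
    (fun m v => (congrArg (fun t => TensorOver.mk S A t v) (zero_smul B m)).trans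
      (congrArg (tensorOverRel S A M V).mkQ (TensorProduct.zero_tmul M v)))) x

/-- For an `A`-`C`-bimodule `V`, the right `C`-module structure `(m ⊗ v) c = m ⊗ (v c)`. -/
noncomputable instance TensorOver.rightModule {C : Type*} [Ring C] [Algebra S C] [Module Cᵐᵒᵖ V]
    [IsScalarTower S Cᵐᵒᵖ V] [SMulCommClass A Cᵐᵒᵖ V] : Module Cᵐᵒᵖ (TensorOver S A M V) where
  smul c x := TensorOver.mapRight (Algebra.lsmul S S V c) (fun a v => (smul_comm a c v).symm) x
  one_smul x := DFunLike.congr_fun (TensorOver.addHom_ext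
    (f := (TensorOver.mapRight (Algebra.lsmul S S V (1 : Cᵐᵒᵖ))
      (fun a v => (smul_comm a (1 : Cᵐᵒᵖ) v).symm)).toAddMonoidHom) (g := AddMonoidHom.id _)
    (fun m v => congrArg (fun t => TensorOver.mk S A m t) (one_smul Cᵐᵒᵖ v))) x
  mul_smul b c x := DFunLike.congr_fun (TensorOver.addHom_ext
    (f := (TensorOver.mapRight (Algebra.lsmul S S V (b * c))
      (fun a v => (smul_comm a (b * c) v).symm)).toAddMonoidHom)
    (g := (TensorOver.mapRight (Algebra.lsmul S S V b)
      (fun a v => (smul_comm a b v).symm)).toAddMonoidHom.comp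
      (TensorOver.mapRight (Algebra.lsmul S S V c)
      (fun a v => (smul_comm a c v).symm)).toAddMonoidHom)
    (fun m v => congrArg (fun t => TensorOver.mk S A m t) (mul_smul b c v))) x
  smul_zero b := map_zero _
  smul_add b x y := map_add _ x y
  add_smul b c x := by
    have h : TensorOver.mapRight (M := M) (Algebra.lsmul S S V (b + c))
        (fun a v => (smul_comm a (b + c) v).symm) =
        TensorOver.mapRight (Algebra.lsmul S S V b) (fun a v => (smul_comm a b v).symm) +
        TensorOver.mapRight (Algebra.lsmul S S V c) (fun a v => (smul_comm a c v).symm) :=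
      LinearMap.toAddMonoidHom_injective (TensorOver.addHom_ext fun m v =>
        (congrArg (fun t => TensorOver.mk S A m t) (add_smul b c v)).trans
          (TensorOver.mk_add m (b • v) (c • v)))
    exact LinearMap.congr_fun h x
  zero_smul x := DFunLike.congr_fun (TensorOver.addHom_ext
    (f := (TensorOver.mapRight (Algebra.lsmul S S V (0 : Cᵐᵒᵖ))
      (fun a v => (smul_comm a (0 : Cᵐᵒᵖ) v).symm)).toAddMonoidHom) (g := 0)
    (fun m v => (congrArg (fun t => TensorOver.mk S A m t) (zero_smul Cᵐᵒᵖ v)).trans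
      (congrArg (tensorOverRel S A M V).mkQ (TensorProduct.tmul_zero V m)))) x

theorem TensorOver.smul_mk {B : Type*} [Ring B] [Algebra S B] [Module B M]
    [IsScalarTower S B M] [SMulCommClass B Aᵐᵒᵖ M] (b : B) (m : M) (v : V) :
    b • TensorOver.mk S A m v = TensorOver.mk S A (b • m) v := rfl

theorem TensorOver.op_smul_mk {C : Type*} [Ring C] [Algebra S C] [Module Cᵐᵒᵖ V]
    [IsScalarTower S Cᵐᵒᵖ V] [SMulCommClass A Cᵐᵒᵖ V] (c : C) (m : M) (v : V) :
    op c • TensorOver.mk S A m v = TensorOver.mk S A m (op c • v) := rfl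

theorem TensorOver.op_smul_tmul (a : A) (m : M) (v : V) :
    TensorOver.mk S A (op a • m) v = TensorOver.mk S A m (a • v) :=
  (Submodule.Quotient.eq _).mpr (Submodule.subset_span ⟨m, a, v, rfl⟩)

instance {B : Type*} [Ring B] [Algebra S B] [Module B M]
    [IsScalarTower S B M] [SMulCommClass B Aᵐᵒᵖ M] : IsScalarTower S B (TensorOver S A M V) where
  smul_assoc s b x := DFunLike.congr_fun (TensorOver.addHom_ext
    (f := (TensorOver.mapLeft (Algebra.lsmul S S M (s • b))
      (fun a m => smul_comm (s • b) (op a) m)).toAddMonoidHom)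
    (g := (s • TensorOver.mapLeft (Algebra.lsmul S S M b)
      (fun a m => smul_comm b (op a) m)).toAddMonoidHom)
    (fun m v => (congrArg (fun t => TensorOver.mk S A t v) (smul_assoc s b m)).trans
      (congrArg (tensorOverRel S A M V).mkQ (TensorProduct.smul_tmul' s (b • m) v).symm))) x

end TensorOver

/-! ### Base change of bimodules -/

section BaseChange

/-- `T ⊗[S] M`, for a (bi)module `M` over `S`-algebras `B`, `A`, regarded as a (bi)module over
`T ⊗[S] B` and `T ⊗[S] A`. -/
def BaseChangeMod (T S M : Type*) [CommRing S] [CommRing T] [Algebra S T] [AddCommGroup M]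
    [Module S M] : Type _ := T ⊗[S] M

variable {T S M : Type*} [CommRing S] [CommRing T] [Algebra S T] [AddCommGroup M] [Module S M]

noncomputable instance : AddCommGroup (BaseChangeMod T S M) :=
  inferInstanceAs (AddCommGroup (T ⊗[S] M))

noncomputable instance : Module T (BaseChangeMod T S M) :=
  inferInstanceAs (Module T (T ⊗[S] M))

/-- The element `t ⊗ m`. -/
def BaseChangeMod.mk (S : Type*) {T M : Type*} [CommRing S] [CommRing T] [Algebra S T]
    [AddCommGroup M] [Module S M] (t : T) (m : M) : BaseChangeMod T S M := t ⊗ₜ[S] m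

theorem BaseChangeMod.induction_on {motive : BaseChangeMod T S M → Prop}
    (z : BaseChangeMod T S M) (zero : motive 0) (mk : ∀ t m, motive (BaseChangeMod.mk S t m))
    (add : ∀ z w, motive z → motive w → motive (z + w)) : motive z :=
  TensorProduct.induction_on (motive := motive) z zero mk add

/-- The left action of `T ⊗[S] B` on `T ⊗[S] M`: `(t ⊗ b) (t' ⊗ m) = t t' ⊗ b m`. -/
noncomputable def BaseChangeMod.leftHom (T S M B : Type*) [CommRing S] [CommRing T] [Algebra S T]
    [AddCommGroup M] [Module S M] [Ring B] [Algebra S B] [Module B M] [IsScalarTower S B M] :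
    (T ⊗[S] B) →ₐ[T] Module.End T (T ⊗[S] M) :=
  Algebra.TensorProduct.lift (Algebra.ofId T (Module.End T (T ⊗[S] M)))
    ((Module.End.baseChangeHom S T M).comp (Algebra.lsmul S S M : B →ₐ[S] Module.End S M))
    (fun t _ => Algebra.commutes t _)

/-- The right action of `T ⊗[S] A` on `T ⊗[S] M`: `(t' ⊗ m) (t ⊗ a) = t t' ⊗ m a`. -/
noncomputable def BaseChangeMod.rightHom (T S M A : Type*) [CommRing S] [CommRing T] [Algebra S T]
    [AddCommGroup M] [Module S M] [Ring A] [Algebra S A] [Module Aᵐᵒᵖ M] [IsScalarTower S Aᵐᵒᵖ M] :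
    (T ⊗[S] A)ᵐᵒᵖ →ₐ[T] Module.End T (T ⊗[S] M) :=
  AlgHom.opComm (Algebra.TensorProduct.lift (Algebra.ofId T (Module.End T (T ⊗[S] M))ᵐᵒᵖ)
    (AlgHom.opComm.symm
      ((Module.End.baseChangeHom S T M).comp (Algebra.lsmul S S M : Aᵐᵒᵖ →ₐ[S] Module.End S M)))
    (fun t _ => Algebra.commutes t _))

variable {A B : Type*} [Ring A] [Algebra S A] [Ring B] [Algebra S B]

noncomputable instance BaseChangeMod.leftModule [Module B M] [IsScalarTower S B M] :
    Module (T ⊗[S] B) (BaseChangeMod T S M) :=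
  Module.compHom (T ⊗[S] M) (BaseChangeMod.leftHom T S M B).toRingHom

noncomputable instance BaseChangeMod.rightModule [Module Aᵐᵒᵖ M] [IsScalarTower S Aᵐᵒᵖ M] :
    Module (T ⊗[S] A)ᵐᵒᵖ (BaseChangeMod T S M) :=
  Module.compHom (T ⊗[S] M) (BaseChangeMod.rightHom T S M A).toRingHom

theorem BaseChangeMod.tmul_smul_mk [Module B M] [IsScalarTower S B M] (t t' : T) (b : B) (m : M) :
    (t ⊗ₜ[S] b) • BaseChangeMod.mk S t' m = BaseChangeMod.mk S (t * t') (b • m) := by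
  change BaseChangeMod.leftHom T S M B (t ⊗ₜ[S] b) (t' ⊗ₜ[S] m) = (t * t') ⊗ₜ[S] (b • m)
  refine (LinearMap.congr_fun (Algebra.TensorProduct.lift_tmul _ _ _ t b) _).trans ?_
  rw [Algebra.ofId_apply]
  change t • (t' ⊗ₜ[S] (b • m)) = _
  rw [TensorProduct.smul_tmul', smul_eq_mul]

theorem BaseChangeMod.op_tmul_smul_mk [Module Aᵐᵒᵖ M] [IsScalarTower S Aᵐᵒᵖ M]
    (t t' : T) (a : A) (m : M) :
    op (t ⊗ₜ[S] a) • BaseChangeMod.mk S t' m = BaseChangeMod.mk S (t * t') (op a • m) := by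
  change BaseChangeMod.rightHom T S M A (op (t ⊗ₜ[S] a)) (t' ⊗ₜ[S] m) = (t * t') ⊗ₜ[S] (op a • m)
  refine (LinearMap.congr_fun
    (congrArg MulOpposite.unop (Algebra.TensorProduct.lift_tmul
      (Algebra.ofId T (Module.End T (T ⊗[S] M))ᵐᵒᵖ) (AlgHom.opComm.symm
        ((Module.End.baseChangeHom S T M).comp (Algebra.lsmul S S M : Aᵐᵒᵖ →ₐ[S] Module.End S M)))
      (fun t _ => Algebra.commutes t _) t a)) _).trans ?_
  change Module.End.baseChangeHom S T M (Algebra.lsmul S S M (op a)) (t • (t' ⊗ₜ[S] m)) = _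
  rw [TensorProduct.smul_tmul', smul_eq_mul]
  rfl

instance [Module B M] [IsScalarTower S B M] :
    IsScalarTower T (T ⊗[S] B) (BaseChangeMod T S M) where
  smul_assoc t x y :=
    LinearMap.congr_fun (map_smul (BaseChangeMod.leftHom T S M B) t x) y

instance [Module Aᵐᵒᵖ M] [IsScalarTower S Aᵐᵒᵖ M] :
    IsScalarTower T (T ⊗[S] A)ᵐᵒᵖ (BaseChangeMod T S M) where
  smul_assoc t x y :=
    LinearMap.congr_fun (map_smul (BaseChangeMod.rightHom T S M A) t x) y

instance [Module B M] [IsScalarTower S B M] [Module Aᵐᵒᵖ M] [IsScalarTower S Aᵐᵒᵖ M]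
    [SMulCommClass B Aᵐᵒᵖ M] :
    SMulCommClass (T ⊗[S] B) (T ⊗[S] A)ᵐᵒᵖ (BaseChangeMod T S M) where
  smul_comm x y z := by
    obtain ⟨y, rfl⟩ := MulOpposite.op_surjective y
    induction z using BaseChangeMod.induction_on with
    | zero => simp only [smul_zero]
    | add z w hz hw => simp only [smul_add, hz, hw]
    | mk t m =>
      change x • op y • BaseChangeMod.mk S t m = op y • x • BaseChangeMod.mk S t m
      induction x using TensorProduct.induction_on with
      | zero => simp only [zero_smul, smul_zero]
      | add x x' hx hx' => simp only [add_smul, smul_add, hx, hx']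
      | tmul s b =>
        induction y using TensorProduct.induction_on with
        | zero => simp only [MulOpposite.op_zero, zero_smul, smul_zero]
        | add y y' hy hy' => simp only [MulOpposite.op_add, add_smul, smul_add, hy, hy']
        | tmul r a =>
          simp only [BaseChangeMod.tmul_smul_mk, BaseChangeMod.op_tmul_smul_mk]
          rw [smul_comm, mul_left_comm]

end BaseChange

/-! ### Stable equivalences of Morita type -/

/-- `X ≅ A ⊕ P` as `A`-`A`-bimodules for some projective `A`-`A`-bimodule `P`, i.e. for some
projective module `P` over the enveloping algebra `A ⊗[S] Aᵐᵒᵖ`. -/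
def IsRegularPlusProjective (S A : Type*) (X : Type v) [CommRing S] [Ring A] [Algebra S A]
    [AddCommGroup X] [Module A X] [Module Aᵐᵒᵖ X] : Prop :=
  ∃ (P : Type v) (_ : AddCommGroup P) (_ : Module (A ⊗[S] Aᵐᵒᵖ) P),
    Module.Projective (A ⊗[S] Aᵐᵒᵖ) P ∧
    ∃ φ : X ≃+ A × P, ∀ (a a' : A) (x : X),
      φ (a • op a' • x) = (a * (φ x).1 * a', (a ⊗ₜ[S] op a') • (φ x).2)

/-- The `B`-`A`-bimodule `M` and the `A`-`B`-bimodule `N` (both finitely generated) induce a stable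
equivalence of Morita type between the `S`-algebras `A` and `B`. -/
structure IsStableEquivOfMoritaType (S A B M N : Type*) [CommRing S] [Ring A] [Algebra S A]
    [Ring B] [Algebra S B]
    [AddCommGroup M] [Module S M] [Module B M] [Module Aᵐᵒᵖ M]
    [IsScalarTower S B M] [IsScalarTower S Aᵐᵒᵖ M] [SMulCommClass B Aᵐᵒᵖ M]
    [AddCommGroup N] [Module S N] [Module A N] [Module Bᵐᵒᵖ N]
    [IsScalarTower S A N] [IsScalarTower S Bᵐᵒᵖ N] [SMulCommClass A Bᵐᵒᵖ N] : Prop where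
  finite_left_M : Module.Finite B M
  finite_right_M : Module.Finite Aᵐᵒᵖ M
  finite_left_N : Module.Finite A N
  finite_right_N : Module.Finite Bᵐᵒᵖ N
  projective_left_M : Module.Projective B M
  projective_right_M : Module.Projective Aᵐᵒᵖ M
  projective_left_N : Module.Projective A N
  projective_right_N : Module.Projective Bᵐᵒᵖ N
  /-- `N ⊗_B M ≅ A ⊕ P` -/
  iso_A : IsRegularPlusProjective S A (TensorOver S B N M)
  /-- `M ⊗_A N ≅ B ⊕ Q` -/
  iso_B : IsRegularPlusProjective S B (TensorOver S A M N)

/-! ### The coefficient category -/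

section Coefficients

variable (p : ℕ) [Fact p.Prime] (k : Type u) [Field k]

/-- The reduction map `W(k) → k` onto the residue field. -/
noncomputable instance wittResidueAlgebra : Algebra (WittVector p k) k :=
  (WittVector.constantCoeff : WittVector p k →+* k).toAlgebra

/-- Complete local commutative Noetherian `W(k)`-algebras with residue field `k`. The identification
of the residue field with `k` is given by the `W(k)`-algebra homomorphism `res : R → k`; it is
surjective because `W(k) → k` is, so that its kernel is the maximal ideal of `R`. -/
structure CoeffRing where
  carrier : Type u
  [commRing : CommRing carrier]
  [algebra : Algebra (WittVector p k) carrier]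
  [isLocalRing : IsLocalRing carrier]
  [isNoetherianRing : IsNoetherianRing carrier]
  [isAdicComplete : IsAdicComplete (IsLocalRing.maximalIdeal carrier) carrier]
  /-- the residue map -/
  res : carrier →ₐ[WittVector p k] k

namespace CoeffRing

variable {p k}

instance : CoeSort (CoeffRing p k) (Type u) := ⟨CoeffRing.carrier⟩

attribute [instance] commRing algebra isLocalRing isNoetherianRing isAdicComplete

theorem res_surjective (R : CoeffRing p k) : Function.Surjective R.res := fun x =>
  ⟨algebraMap (WittVector p k) R (WittVector.teichmuller p x), by
    rw [AlgHom.commutes]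
    exact WittVector.teichmuller_coeff_zero p x⟩

theorem ker_res (R : CoeffRing p k) : RingHom.ker R.res = IsLocalRing.maximalIdeal R :=
  IsLocalRing.eq_maximalIdeal (RingHom.ker_isMaximal_of_surjective R.res R.res_surjective)

/-- `k` is an `R`-algebra through the residue map. -/
noncomputable instance (R : CoeffRing p k) : Algebra R k := R.res.toRingHom.toAlgebra

/-- Morphisms: `W(k)`-algebra homomorphisms that induce the identity on the residue field `k`. They
are local (see `map_maximalIdeal` below), hence continuous for the maximal-adic topologies. -/
structure Hom (R R' : CoeffRing p k) where
  toAlgHom : R →ₐ[WittVector p k] R'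
  res_comp : ∀ x, R'.res (toAlgHom x) = R.res x

theorem Hom.map_maximalIdeal {R R' : CoeffRing p k} (f : Hom R R') :
    (IsLocalRing.maximalIdeal R).map f.toAlgHom ≤ IsLocalRing.maximalIdeal R' := by
  rw [Ideal.map_le_iff_le_comap, ← R.ker_res, ← R'.ker_res]
  intro x hx
  rw [RingHom.mem_ker] at hx
  rw [Ideal.mem_comap, RingHom.mem_ker, f.res_comp, hx]

/-- Isomorphism of coefficient rings. -/
def Iso (R R' : CoeffRing p k) : Prop :=
  ∃ e : R ≃ₐ[WittVector p k] R', ∀ x, R'.res (e x) = R.res x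

variable (p k)

theorem dual_maximalIdeal_sq :
    IsLocalRing.maximalIdeal (DualNumber k) ^ 2 = ⊥ := by
  rw [DualNumber.maximalIdeal_eq_span_singleton_eps, Ideal.span_singleton_pow,
    Ideal.span_singleton_eq_bot, pow_two, DualNumber.eps_mul_eps]

theorem dual_isAdicComplete :
    IsAdicComplete (IsLocalRing.maximalIdeal (DualNumber k)) (DualNumber k) where
  haus' x hx := by
    have h := hx 2
    rw [dual_maximalIdeal_sq, SModEq.zero] at h
    simpa using h
  prec' f hf := by
    refine ⟨f 2, fun n => ?_⟩
    rcases le_total n 2 with h | h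
    · exact hf h
    · have h' := hf h
      rw [dual_maximalIdeal_sq, Submodule.bot_smul, SModEq.bot] at h'
      exact h' ▸ SModEq.rfl

/-- The ring `k[ε]` of dual numbers as a coefficient ring. -/
noncomputable def dual : CoeffRing p k where
  carrier := DualNumber k
  isAdicComplete := dual_isAdicComplete k
  res := TrivSqZeroExt.fstHom (WittVector p k) k k

end CoeffRing

end Coefficients

/-! ### Lifts, deformations and versal deformation rings -/

section Deformations

variable {p : ℕ} [Fact p.Prime] {k : Type u} [Field k] {G V : Type*} [Group G]
  [AddCommGroup V] [Module k V]

/-- A lift of the `k[G]`-module `V` over `R`: an `R[G]`-module `M` that is finitely generated and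
free over `R`, with an isomorphism `φ : k ⊗[R] M ≅ V` of `k[G]`-modules. -/
structure Lift (ρ : Representation k G V) (R : CoeffRing p k) where
  carrier : Type u
  [addCommGroup : AddCommGroup carrier]
  [module : Module R carrier]
  [finite : Module.Finite R carrier]
  [free : Module.Free R carrier]
  /-- the action of `G` -/
  act : Representation R G carrier
  φ : k ⊗[R] carrier ≃ₗ[k] V
  φ_equivariant : ∀ g x, φ ((act g).baseChange k x) = ρ g (φ x)

namespace Lift

variable {ρ : Representation k G V} {R R' : CoeffRing p k}

attribute [instance] addCommGroup module finite free

/-- Isomorphism of lifts: an isomorphism `α : M → M'` of `R[G]`-modules with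
`φ = φ' ∘ (k ⊗ α)`. A deformation is an isomorphism class of lifts. -/
def Iso (L L' : Lift ρ R) : Prop :=
  ∃ α : L.carrier ≃ₗ[R] L'.carrier, (∀ g x, α (L.act g x) = L'.act g (α x)) ∧
    ∀ x : k ⊗[R] L.carrier, L.φ x = L'.φ (α.toLinearMap.baseChange k x)

/-- The lift `(R' ⊗_{R,f} M, φ')` obtained from `(M, φ)` by base change along `f : R → R'`, where
`φ'` is `φ` after the identification `k ⊗[R'] (R' ⊗[R] M) = k ⊗[R] M`. -/
noncomputable def map (f : CoeffRing.Hom R R') (L : Lift ρ R) : Lift ρ R' :=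
  letI : Algebra R R' := f.toAlgHom.toRingHom.toAlgebra
  haveI : IsScalarTower R R' k := IsScalarTower.of_algebraMap_eq fun x => (f.res_comp x).symm
  { carrier := R' ⊗[R] L.carrier
    act := ((Module.End.baseChangeHom R R' L.carrier : Module.End R L.carrier →ₐ[R]
        Module.End R' (R' ⊗[R] L.carrier)) :
        Module.End R L.carrier →* Module.End R' (R' ⊗[R] L.carrier)).comp L.act
    φ := (TensorProduct.AlgebraTensorModule.cancelBaseChange R R' k k L.carrier).trans L.φ
    φ_equivariant := fun g x => by
      rw [LinearEquiv.trans_apply, LinearEquiv.trans_apply, ← L.φ_equivariant]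
      congr 1
      induction x using TensorProduct.induction_on with
      | zero => simp only [map_zero]
      | add x y hx hy => simp only [map_add, hx, hy]
      | tmul c x =>
        induction x using TensorProduct.induction_on with
        | zero => simp only [TensorProduct.tmul_zero, map_zero]
        | add x y hx hy => simp only [TensorProduct.tmul_add, map_add, hx, hy]
        | tmul r x => rfl }

end Lift

/-- The deformation `[U]` of `V` over `R` is versal: every lift of `V` over every `R'` is isomorphic
to the base change of `U` along some morphism `R → R'`, and for `R' = k[ε]` this morphism is
determined by the isomorphism class of the lift. -/
structure IsVersalDeformation (ρ : Representation k G V) (R : CoeffRing p k) (U : Lift ρ R) :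
    Prop where
  exists_hom : ∀ (R' : CoeffRing p k) (L : Lift ρ R'),
    ∃ f : CoeffRing.Hom R R', (U.map f).Iso L
  tangent_unique : ∀ f g : CoeffRing.Hom R (CoeffRing.dual p k), (U.map f).Iso (U.map g) → f = g

/-- `R` is a versal deformation ring of the `k[G]`-module `V`. -/
def IsVersalDeformationRing (ρ : Representation k G V) (R : CoeffRing p k) : Prop :=
  ∃ U : Lift ρ R, IsVersalDeformation ρ R U

end Deformations

-- Tensoring with `M` matches the deformations of V with those of V' = M ⊗_A V, naturally in the
-- coefficient ring. Such a correspondence carries a versal deformation to a versal deformation over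
-- the same ring.
--
-- An isomorphism N ⊗_B M ≅ A ⊕ P with P a projective bimodule gives natural maps ι : X → N ⊗ (M ⊗
-- X) and r back to X with rι = 1. The algebras in play are direct factors of group algebras, or
-- base changes of such, so by the argument of Higman's criterion the identity of P is a trace ∑ g θ
-- g⁻¹ with θ linear for the right action. Hence 1 - ιr is a trace as well (`SplitTrace`,
-- `trace_thetaHom`). Traces are harmless: if θ is merely linear over the residue field, it lifts to
-- an R-linear map because a lift is R-projective, and the trace of that lift is an A-linear lift of
-- the trace of θ (`exists_lift_trace`). Correcting by traces takes the place of the stable category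
-- and of lifting projective modules.
--
-- Three facts give the correspondence. A map M ⊗ X → M ⊗ Y over the identity of M ⊗ V yields r ∘ (N
-- ⊗ β) ∘ ι : X → Y over the identity of V (`exists_map_of_map_coeffMap`). For a lift Y of M ⊗ V,
-- the module N ⊗ Y lifts N ⊗ (M ⊗ V); the projection ιr onto the copy of V is 1 minus a trace, so
-- it lifts to an A-linear endomorphism, then to an idempotent that is a polynomial in it, whose
-- image X lifts V (`exists_summand`). Finally M ⊗ X maps to Y: the evident composite reduces to 1
-- minus a trace, and a lift of that trace is added (`exists_map_of_summand`). Any map of lifts over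
-- the identity is bijective by Nakayama (`IsReduction.bijective`), and a lift of a module in the
-- block is again acted on through the block (`exists_module_of_isReduction`).
--
-- Two versal rings for corresponding problems receive morphisms from each other. The composites
-- preserve the versal deformation, so they act trivially on morphisms to k[ε], hence modulo 𝔪² +
-- (p); they are then surjective by completeness and bijective by Noetherianity
-- (`Hom.bijective_of_comp_dual`). In (2) the bimodules live over k, so the correspondence exists
-- only over rings with p = 0. There R/pR is versal, and k[ε] is such a ring, so the same uniqueness
-- argument applies to R/pR and R'/pR'.

universe w

set_option linter.unusedSectionVars false

/-! ### Finite modules over a complete local ring, and Nakayama's lemma -/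

theorem IsAdicComplete.of_finite {R : Type*} [CommRing R] [IsLocalRing R] [IsNoetherianRing R]
    [IsAdicComplete (IsLocalRing.maximalIdeal R) R] (X : Type*) [AddCommGroup X] [Module R X]
    [Module.Finite R X] : IsAdicComplete (IsLocalRing.maximalIdeal R) X := by
  set m := IsLocalRing.maximalIdeal R
  have : IsPrecomplete m X := by
    obtain ⟨n, π, hπ⟩ := Module.Finite.exists_fin' R X
    -- Completion preserves surjections, so the question reduces to Rⁿ, where it is settled
    -- coordinatewise.
    rw [← AdicCompletion.of_surjective_iff]
    intro x
    obtain ⟨y, rfl⟩ := AdicCompletion.map_surjective m hπ x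
    obtain ⟨z, rfl⟩ : ∃ z, AdicCompletion.of m (Fin n → R) z = y := by
      set e := AdicCompletion.piEquivFin m (R := R) n
      obtain ⟨z, hz⟩ : ∃ z : Fin n → R, ∀ i, AdicCompletion.of m R (z i) = e y i :=
        ⟨fun i => (AdicCompletion.of_surjective m R (e y i)).choose,
          fun i => (AdicCompletion.of_surjective m R (e y i)).choose_spec⟩
      refine ⟨z, e.injective ?_⟩
      ext1 i
      rw [← hz]
      rfl
    exact ⟨π z, (AdicCompletion.map_of m π z).symm⟩
  exact {}

/-- An `R`-linear reduction map modulo the maximal ideal: surjective with kernel `𝔪 X`. -/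
structure IsReduction {R X V : Type*} [CommRing R] [IsLocalRing R] [AddCommGroup X] [Module R X]
    [AddCommGroup V] [Module R V] (q : X →ₗ[R] V) : Prop where
  surjective : Function.Surjective q
  ker_le : ∀ x, q x = 0 → x ∈ (IsLocalRing.maximalIdeal R • ⊤ : Submodule R X)

section Reduction

variable {R : Type*} [CommRing R] [IsLocalRing R]
  {X Y V V' : Type*} [AddCommGroup X] [Module R X] [AddCommGroup Y] [Module R Y]
  [AddCommGroup V] [Module R V] [AddCommGroup V'] [Module R V']

/-- Nakayama's lemma gives surjectivity, and a surjective endomorphism of a finite module over a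
commutative ring is injective. -/
theorem LinearMap.bijective_of_reduction_eq_id [Module.Finite R X] {q : X →ₗ[R] V}
    (hq : IsReduction q) (f : X →ₗ[R] X) (hf : ∀ x, q (f x) = q x) : Function.Bijective f := by
  have hs : Function.Surjective f := by
    rw [← LinearMap.range_eq_top, ← top_le_iff]
    refine Submodule.le_of_le_smul_of_le_jacobson_bot (I := IsLocalRing.maximalIdeal R)
      Module.Finite.fg_top (IsLocalRing.maximalIdeal_le_jacobson _) fun x _ => ?_
    refine Submodule.mem_sup.mpr ⟨f x, ⟨x, rfl⟩, x - f x, hq.ker_le _ ?_, by abel⟩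
    rw [map_sub, hf, sub_self]
  exact ⟨OrzechProperty.injective_of_surjective_endomorphism f hs, hs⟩

theorem IsReduction.exists_lift [Module.Projective R X] {q : X →ₗ[R] V} {q' : Y →ₗ[R] V'}
    (hq' : IsReduction q') (f : V →ₗ[R] V') : ∃ g : X →ₗ[R] Y, ∀ x, q' (g x) = f (q x) := by
  obtain ⟨g, hg⟩ := Module.projective_lifting_property q' (f ∘ₗ q) hq'.surjective
  exact ⟨g, fun x => LinearMap.congr_fun hg x⟩

/-- A map of lifts that is compatible with the reductions is bijective. -/
theorem IsReduction.bijective [Module.Finite R X] [Module.Finite R Y] [Module.Projective R Y]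
    {q : X →ₗ[R] V} {q' : Y →ₗ[R] V} (hq : IsReduction q) (hq' : IsReduction q')
    (f : X →ₗ[R] Y) (hf : ∀ x, q' (f x) = q x) : Function.Bijective f := by
  -- A backward map comes from projectivity of `Y`. Both composites reduce to the identity, so both
  -- are bijective, although `g` need not be the inverse of `f`.
  obtain ⟨g, hg⟩ := hq.exists_lift (q := q') LinearMap.id
  have h1 := LinearMap.bijective_of_reduction_eq_id hq (g ∘ₗ f) fun x => by
    rw [LinearMap.comp_apply, hg, LinearMap.id_apply, hf]
  have h2 := LinearMap.bijective_of_reduction_eq_id hq' (f ∘ₗ g) fun x => by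
    rw [LinearMap.comp_apply, hf, hg, LinearMap.id_apply]
  exact ⟨Function.Injective.of_comp (f := g) h1.1, Function.Surjective.of_comp (g := g) h2.2⟩

end Reduction

/-! ### Lifting idempotent endomorphisms -/

open Polynomial in
-- The lifting has two stages: from C/(I, x² - x) to C/I along a nil ideal, then from C/I to C by
-- Hensel's lemma for X² - X.
theorem exists_isIdempotentElem_of_sq_sub_mem {C : Type*} [CommRing C] (I : Ideal C)
    [IsAdicComplete I C] (x : C) {n : ℕ} (hx : (x ^ 2 - x) ^ n ∈ I) :
    ∃ e : C, IsIdempotentElem e ∧ e - x ∈ Ideal.span {x ^ 2 - x} ⊔ I := by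
  set δ := x ^ 2 - x
  set J := Ideal.span {Ideal.Quotient.mk I δ}
  obtain ⟨e', he', hx'⟩ := exists_isIdempotentElem_eq_of_ker_isNilpotent (Ideal.Quotient.mk J)
    (fun y hy => by
      rw [Ideal.mk_ker, Ideal.mem_span_singleton'] at hy
      obtain ⟨a, rfl⟩ := hy
      refine ⟨n, ?_⟩
      rw [mul_pow, ← map_pow, Ideal.Quotient.eq_zero_iff_mem.mpr hx, mul_zero])
    (Ideal.Quotient.mk J (Ideal.Quotient.mk I x)) ⟨_, rfl⟩ (by
      rw [IsIdempotentElem, ← map_mul, ← map_mul, Ideal.Quotient.mk_eq_mk_iff_sub_mem, ← map_sub,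
        ← pow_two]
      exact Ideal.mem_span_singleton_self _)
  obtain ⟨y, rfl⟩ := Ideal.Quotient.mk_surjective e'
  have hy : y ^ 2 - y ∈ I := by
    rw [IsIdempotentElem, ← map_mul, Ideal.Quotient.mk_eq_mk_iff_sub_mem] at he'
    rwa [pow_two]
  have hyx : y - x ∈ Ideal.span {δ} ⊔ I := by
    rw [Ideal.Quotient.mk_eq_mk_iff_sub_mem, ← map_sub, Ideal.mem_span_singleton'] at hx'
    obtain ⟨a, ha⟩ := hx'
    obtain ⟨a, rfl⟩ := Ideal.Quotient.mk_surjective a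
    rw [← map_mul, eq_comm, Ideal.Quotient.mk_eq_mk_iff_sub_mem] at ha
    rw [← sub_add_cancel (y - x) (a * δ), add_comm]
    exact Submodule.add_mem_sup (Ideal.mem_span_singleton'.mpr ⟨a, rfl⟩) ha
  have hev : ∀ z : C, (X ^ 2 - X : C[X]).eval z = z ^ 2 - z := fun z => by simp
  obtain ⟨e, he, hey⟩ := HenselianRing.is_henselian (I := I) (X ^ 2 - X : C[X])
    (by
      nontriviality C
      exact monic_X_pow_sub (by simp)) y (by rwa [hev]) (by
      -- The derivative 2y - 1 is its own inverse modulo I, since (2y - 1)² = 1 + 4(y² - y).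
      refine IsUnit.of_mul_eq_one (Ideal.Quotient.mk I ((X ^ 2 - X : C[X]).derivative.eval y)) ?_
      rw [← map_mul, ← map_one (Ideal.Quotient.mk I), Ideal.Quotient.mk_eq_mk_iff_sub_mem]
      have : (X ^ 2 - X : C[X]).derivative.eval y * (X ^ 2 - X : C[X]).derivative.eval y - 1
          = 4 * (y ^ 2 - y) := by
        simp; ring
      rw [this]
      exact I.mul_mem_left _ hy)
  refine ⟨e, ?_, ?_⟩
  · have := he.eq_zero
    rw [hev, sub_eq_zero, pow_two] at this
    exact this
  · rw [← sub_add_sub_cancel e y x]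
    exact add_mem (Ideal.mem_sup_right hey) hyx

/-- Translates a congruence in a commutative algebra of endomorphisms into a statement about values;
the submodule 𝔪X is stable under every endomorphism. -/
theorem mem_smul_top_of_mem_sup_map {R C X : Type*} [CommRing R] [CommRing C] [Algebra R C]
    [AddCommGroup X] [Module R X] (m : Ideal R) (ev : C →ₐ[R] Module.End R X) {δ : C}
    (hδ : ∀ z, ev δ z ∈ (m • ⊤ : Submodule R X)) (c : C)
    (hc : c ∈ Ideal.span {δ} ⊔ m.map (algebraMap R C)) (z : X) :
    ev c z ∈ (m • ⊤ : Submodule R X) := by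
  have hsub : ∀ z ∈ (m • ⊤ : Submodule R X), ∀ h : Module.End R X,
      h z ∈ (m • ⊤ : Submodule R X) := fun z hz h =>
    (Submodule.map_smul'' m ⊤ h).trans_le (Submodule.smul_mono le_rfl le_top)
      (Submodule.mem_map_of_mem hz)
  obtain ⟨b, hb, d, hd, rfl⟩ := Submodule.mem_sup.mp hc
  clear hc
  rw [map_add, LinearMap.add_apply]
  refine add_mem ?_ ?_
  · obtain ⟨a, rfl⟩ := Ideal.mem_span_singleton'.mp hb
    rw [map_mul, Module.End.mul_apply]
    exact hsub _ (hδ z) (ev a)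
  · revert z
    refine Submodule.span_induction ?_ ?_ ?_ ?_ hd
    · rintro _ ⟨r, hr, rfl⟩ z
      change ev (algebraMap R C r) z ∈ _
      rw [AlgHom.commutes, Module.algebraMap_end_apply]
      exact Submodule.smul_mem_smul hr trivial
    · intro z; rw [map_zero]; exact zero_mem _
    · intro a b _ _ ha hb z; rw [map_add]; exact add_mem (ha z) (hb z)
    · intro a b _ hb z
      rw [smul_eq_mul, map_mul, Module.End.mul_apply]
      exact hsub _ (hb z) (ev a)

open Polynomial in
/-- An endomorphism that is idempotent modulo the maximal ideal lifts to an idempotent that is a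
polynomial in it. -/
theorem LinearMap.exists_isIdempotentElem_aeval {R : Type*} [CommRing R] [IsLocalRing R]
    [IsNoetherianRing R] [IsAdicComplete (IsLocalRing.maximalIdeal R) R] {X : Type*}
    [AddCommGroup X] [Module R X] [Module.Finite R X] [Module.Projective R X]
    (x : Module.End R X)
    (hx : ∀ z, (x ^ 2 - x) z ∈ (IsLocalRing.maximalIdeal R • ⊤ : Submodule R X)) :
    ∃ e : R[X], IsIdempotentElem (aeval x e) ∧
      ∀ z, (aeval x e - x) z ∈ (IsLocalRing.maximalIdeal R • ⊤ : Submodule R X) := by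
  set m := IsLocalRing.maximalIdeal R
  let K : Ideal R[X] := RingHom.ker (aeval (R := R) x)
  let ev : R[X] ⧸ K →ₐ[R] Module.End R X := Ideal.kerLiftAlg (aeval (R := R) x)
  have hev : Function.Injective ev := Ideal.kerLiftAlg_injective _
  have hmk : ∀ f : R[X], ev (Ideal.Quotient.mk K f) = aeval x f := fun f => rfl
  -- The subalgebra R[x] of End(X) is finite over the Noetherian ring R, hence 𝔪-adically complete.
  -- Working inside it makes the idempotent a polynomial in x.
  have : Module.Finite R (R[X] ⧸ K) := Module.Finite.of_injective ev.toLinearMap hev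
  have := IsAdicComplete.of_finite (R := R) (R[X] ⧸ K)
  have : IsAdicComplete (m.map (algebraMap R (R[X] ⧸ K))) (R[X] ⧸ K) :=
    (IsAdicComplete.map_algebraMap_iff _ _).mpr this
  set ξ : R[X] ⧸ K := Ideal.Quotient.mk K Polynomial.X
  have hξ : ev ξ = x := by rw [hmk, aeval_X]
  have hδ : ev (ξ ^ 2 - ξ) = x ^ 2 - x := by rw [map_sub, map_pow, hξ]
  -- Although x² - x maps X into 𝔪X, it need not lie in 𝔪R[x]. Cayley–Hamilton, with lower
  -- coefficients in 𝔪, shows that some power of it does.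
  obtain ⟨f, hf, -, hcoef, hf0⟩ :=
    LinearMap.exists_monic_and_natDegree_eq_and_coeff_mem_pow_and_aeval_eq_zero R (x ^ 2 - x) m
      (by rintro _ ⟨z, rfl⟩; exact hx z)
  have hpow : (ξ ^ 2 - ξ) ^ f.natDegree ∈ m.map (algebraMap R (R[X] ⧸ K)) := by
    have h0 : aeval (ξ ^ 2 - ξ) f = 0 := hev (by
      rw [← aeval_algHom_apply, hδ, hf0, map_zero])
    rw [hf.as_sum, map_add, map_pow, aeval_X, map_sum] at h0
    rw [eq_neg_of_add_eq_zero_left h0]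
    refine neg_mem (sum_mem fun i hi => ?_)
    rw [map_mul, aeval_C]
    refine Ideal.mul_mem_right _ _ (Ideal.mem_map_of_mem _ ?_)
    refine Ideal.pow_le_self ?_ (hcoef i)
    have := Finset.mem_range.mp hi
    omega
  obtain ⟨e, he, hex⟩ := exists_isIdempotentElem_of_sq_sub_mem _ ξ hpow
  obtain ⟨g, rfl⟩ := Ideal.Quotient.mk_surjective e
  refine ⟨g, by rw [← hmk]; exact he.map ev, fun z => ?_⟩
  have := mem_smul_top_of_mem_sup_map m ev (δ := ξ ^ 2 - ξ) (by rwa [hδ]) _ hex z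
  rwa [map_sub, hmk, hξ] at this

/-! ### Tensor products over `A` with an extra coefficient ring `R` -/

namespace TensorOver

section Base

variable {S A M V Z : Type*} [CommRing S] [Ring A] [AddCommGroup M] [Module S M]
    [Module Aᵐᵒᵖ M] [AddCommGroup V] [Module S V] [Module A V] [AddCommGroup Z] [Module S Z]

theorem induction_on {motive : TensorOver S A M V → Prop} (z : TensorOver S A M V)
    (zero : motive 0) (mk : ∀ m v, motive (TensorOver.mk S A m v))
    (add : ∀ z w, motive z → motive w → motive (z + w)) : motive z := by
  obtain ⟨y, rfl⟩ := Submodule.Quotient.mk_surjective _ z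
  induction y using TensorProduct.induction_on with
  | zero => exact zero
  | tmul m v => exact mk m v
  | add y z hy hz => exact add _ _ hy hz

theorem smul_mk_left (s : S) (m : M) (v : V) : s • mk S A m v = mk S A (s • m) v := rfl

theorem smul_mk_right (s : S) (m : M) (v : V) : s • mk S A m v = mk S A m (s • v) :=
  congrArg (tensorOverRel S A M V).mkQ (TensorProduct.smul_tmul s m v)

/-- The universal property of `M ⊗_A V`. -/
noncomputable def lift (f : M →ₗ[S] V →ₗ[S] Z)
    (hf : ∀ (m : M) (a : A) (v : V), f (op a • m) v = f m (a • v)) :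
    TensorOver S A M V →ₗ[S] Z :=
  Submodule.liftQ _ (TensorProduct.lift f) (by
    refine Submodule.span_le.mpr ?_
    rintro _ ⟨m, a, v, rfl⟩
    simp [hf])

end Base

section Coeff

variable {R S A M V : Type*} [CommRing S] [CommRing R] [Algebra S R] [Ring A]
    [AddCommGroup M] [Module S M] [Module Aᵐᵒᵖ M]
    [AddCommGroup V] [Module S V] [Module A V] [Module R V] [IsScalarTower S R V]
    [SMulCommClass A R V]

/-- The action of a commutative coefficient ring `R` on the second factor. -/
noncomputable instance (priority := 50) coeffModule : Module R (TensorOver S A M V) where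
  smul r := mapRight (Algebra.lsmul S S V r) (fun a v => (smul_comm a r v).symm)
  one_smul x := DFunLike.congr_fun (addHom_ext
    (f := (mapRight (Algebra.lsmul S S V (1 : R))
      (fun a v => (smul_comm a (1 : R) v).symm)).toAddMonoidHom) (g := AddMonoidHom.id _)
    (fun m v => congrArg (fun t => mk S A m t) (one_smul R v))) x
  mul_smul b c x := DFunLike.congr_fun (addHom_ext
    (f := (mapRight (Algebra.lsmul S S V (b * c))
      (fun a v => (smul_comm a (b * c) v).symm)).toAddMonoidHom)
    (g := (mapRight (Algebra.lsmul S S V b)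
      (fun a v => (smul_comm a b v).symm)).toAddMonoidHom.comp
      (mapRight (Algebra.lsmul S S V c)
      (fun a v => (smul_comm a c v).symm)).toAddMonoidHom)
    (fun m v => congrArg (fun t => mk S A m t) (mul_smul b c v))) x
  smul_zero b := map_zero _
  smul_add b x y := map_add _ x y
  add_smul b c x := by
    have h : mapRight (M := M) (Algebra.lsmul S S V (b + c))
        (fun a v => (smul_comm a (b + c) v).symm) =
        mapRight (Algebra.lsmul S S V b) (fun a v => (smul_comm a b v).symm) +
        mapRight (Algebra.lsmul S S V c) (fun a v => (smul_comm a c v).symm) :=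
      LinearMap.toAddMonoidHom_injective (addHom_ext fun m v =>
        (congrArg (fun t => mk S A m t) (add_smul b c v)).trans
          (mk_add m (b • v) (c • v)))
    exact LinearMap.congr_fun h x
  zero_smul x := DFunLike.congr_fun (addHom_ext
    (f := (mapRight (Algebra.lsmul S S V (0 : R))
      (fun a v => (smul_comm a (0 : R) v).symm)).toAddMonoidHom) (g := 0)
    (fun m v => (congrArg (fun t => mk S A m t) (zero_smul R v)).trans
      (congrArg (tensorOverRel S A M V).mkQ (TensorProduct.tmul_zero V m)))) x

theorem coeff_smul_mk (r : R) (m : M) (v : V) :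
    r • mk S A m v = mk S A m (r • v) := rfl

instance : IsScalarTower S R (TensorOver S A M V) where
  smul_assoc s r x := by
    induction x using induction_on with
    | zero => simp only [smul_zero]
    | add x y hx hy => simp only [smul_add, hx, hy]
    | mk m v => rw [coeff_smul_mk, coeff_smul_mk, smul_mk_right, smul_assoc]

instance {B : Type*} [Ring B] [Algebra S B] [Module B M]
    [IsScalarTower S B M] [SMulCommClass B Aᵐᵒᵖ M] :
    SMulCommClass B R (TensorOver S A M V) where
  smul_comm b r x := by
    induction x using induction_on with
    | zero => simp only [smul_zero]
    | add x y hx hy => simp only [smul_add, hx, hy]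
    | mk m v => rfl

variable {Z : Type*} [AddCommGroup Z] [Module S Z] [Module R Z] [IsScalarTower S R Z]

theorem coeff_ext {f g : TensorOver S A M V →ₗ[R] Z}
    (h : ∀ m v, f (mk S A m v) = g (mk S A m v)) : f = g :=
  LinearMap.toAddMonoidHom_injective (addHom_ext h)

/-- The universal property of `M ⊗_A V` for maps that are linear over the coefficients. -/
noncomputable def coeffLift (f : M →ₗ[S] V →ₗ[R] Z)
    (hf : ∀ (m : M) (a : A) (v : V), f (op a • m) v = f m (a • v)) :
    TensorOver S A M V →ₗ[R] Z where
  __ := lift (S := S) (A := A) (M := M) (V := V) (Z := Z)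
    { toFun := fun m => (f m).restrictScalars S
      map_add' := fun m m' => by ext; simp
      map_smul' := fun s m => by ext; simp } hf
  map_smul' r x := by
    change lift _ _ _ = r • lift _ _ _
    induction x using induction_on with
    | zero => simp only [smul_zero, map_zero]
    | add x y hx hy => simp only [smul_add, map_add, hx, hy]
    | mk m v => exact map_smul (f m) r v

theorem coeffLift_mk (f : M →ₗ[S] V →ₗ[R] Z)
    (hf : ∀ (m : M) (a : A) (v : V), f (op a • m) v = f m (a • v)) (m : M) (v : V) :
    coeffLift f hf (mk S A m v) = f m v := rfl

variable (R S A M V) in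
/-- The bilinear map `(m, v) ↦ m ⊗ v`. -/
noncomputable def mkHom : M →ₗ[S] V →ₗ[R] TensorOver S A M V where
  toFun m :=
    { toFun := fun v => mk S A m v
      map_add' := mk_add m
      map_smul' := fun _ _ => rfl }
  map_add' m m' := LinearMap.ext fun v => add_mk m m' v
  map_smul' _ _ := rfl

variable {V' : Type*} [AddCommGroup V'] [Module S V'] [Module A V'] [Module R V']
    [IsScalarTower S R V'] [SMulCommClass A R V']

variable (M) in
/-- Functoriality of `M ⊗_A V` in `V`. -/
noncomputable def coeffMap (f : V →ₗ[R] V') (hf : ∀ (a : A) v, f (a • v) = a • f v) :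
    TensorOver S A M V →ₗ[R] TensorOver S A M V' :=
  coeffLift
    { toFun := fun m => mkHom R S A M V' m ∘ₗ f
      map_add' := fun m m' => by ext; simp
      map_smul' := fun s m => by ext; simp }
    (fun m a v => by
      change mk S A (op a • m) (f v) = mk S A m (f (a • v))
      rw [hf, op_smul_tmul])

theorem coeffMap_mk (f : V →ₗ[R] V') (hf : ∀ (a : A) v, f (a • v) = a • f v) (m : M) (v : V) :
    coeffMap M f hf (mk S A m v) = mk S A m (f v) := rfl

theorem coeffMap_smul {B : Type*} [Ring B] [Algebra S B] [Module B M]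
    [IsScalarTower S B M] [SMulCommClass B Aᵐᵒᵖ M] (f : V →ₗ[R] V')
    (hf : ∀ (a : A) v, f (a • v) = a • f v) (b : B) (x : TensorOver S A M V) :
    coeffMap M f hf (b • x) = b • coeffMap M f hf x := by
  induction x using induction_on with
  | zero => simp only [smul_zero, map_zero]
  | add x y hx hy => simp only [smul_add, map_add, hx, hy]
  | mk m v => rfl

/-- For `M` a finitely generated projective right module, `M ⊗_A V` is a direct summand of a finite
power of `V`. -/
theorem exists_retract (R S A M V : Type*) [CommRing S] [CommRing R] [Algebra S R] [Ring A]
    [Algebra S A] [AddCommGroup M] [Module S M] [Module Aᵐᵒᵖ M] [IsScalarTower S Aᵐᵒᵖ M]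
    [AddCommGroup V] [Module S V] [Module A V] [Module R V] [IsScalarTower S R V]
    [SMulCommClass A R V] [IsScalarTower S A V]
    [Module.Finite Aᵐᵒᵖ M] [Module.Projective Aᵐᵒᵖ M] :
    ∃ (n : ℕ) (i : TensorOver S A M V →ₗ[R] (Fin n → V))
      (π : (Fin n → V) →ₗ[R] TensorOver S A M V), π ∘ₗ i = LinearMap.id := by
  obtain ⟨n, π, hπ⟩ := Module.Finite.exists_fin' Aᵐᵒᵖ M
  -- A splitting of a free cover Aⁿ → M gives m its coordinates in A; letting these act on v sends m
  -- ⊗ v into Vⁿ.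
  obtain ⟨i, hi⟩ := Module.projective_lifting_property π LinearMap.id hπ
  have hi : ∀ m, π (i m) = m := fun m => LinearMap.congr_fun hi m
  refine ⟨n, coeffLift
    { toFun := fun m =>
        { toFun := fun v j => (i m j).unop • v
          map_add' := fun v w => by ext j; simp
          map_smul' := fun r v => by ext j; simp [smul_comm] }
      map_add' := fun m m' => by ext v j; simp [add_smul]
      map_smul' := fun s m => by
        ext v j
        have : i (s • m) = s • i m := by
          rw [← one_smul Aᵐᵒᵖ m, ← smul_assoc, map_smul, one_smul, smul_assoc, one_smul]
        simp [this] } (fun m a v => by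
        ext j
        simp [mul_smul]),
    ∑ j, mkHom R S A M V (π (Pi.single j 1)) ∘ₗ LinearMap.proj j, ?_⟩
  refine coeff_ext fun m v => ?_
  rw [LinearMap.comp_apply, coeffLift_mk, LinearMap.sum_apply, LinearMap.id_apply]
  conv_rhs => rw [← hi m, ← Finset.univ_sum_single (i m), map_sum]
  have : ∀ (g : Fin n → M), mk S A (∑ j, g j) v = ∑ j, mk S A (g j) v := fun g => by
    change mkHom R S A M V (∑ j, g j) v = _
    rw [map_sum, LinearMap.sum_apply]; rfl
  rw [this]
  refine Finset.sum_congr rfl fun j _ => ?_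
  change mk S A (π (Pi.single j 1)) ((i m j).unop • v) = _
  rw [← op_smul_tmul, MulOpposite.op_unop, ← map_smul, ← Pi.single_smul, smul_eq_mul, mul_one]

variable [Algebra S A] [IsScalarTower S Aᵐᵒᵖ M] [IsScalarTower S A V] [Module.Finite Aᵐᵒᵖ M]
  [Module.Projective Aᵐᵒᵖ M]

instance finite_coeff [Module.Finite R V] : Module.Finite R (TensorOver S A M V) := by
  obtain ⟨n, i, π, h⟩ := exists_retract R S A M V
  exact Module.Finite.of_surjective π fun x => ⟨i x, LinearMap.congr_fun h x⟩

instance projective_coeff [Module.Projective R V] :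
    Module.Projective R (TensorOver S A M V) := by
  obtain ⟨n, i, π, h⟩ := exists_retract R S A M V
  have := Module.Projective.of_equiv (DFinsupp.linearEquivFunOnFintype
    (R := R) (M := fun _ : Fin n => V))
  exact Module.Projective.of_split i π h

end Coeff

section Reduction

theorem _root_.LinearMap.exists_descend {R X V Y : Type*} [CommRing R] [AddCommGroup X] [Module R X]
    [AddCommGroup V] [Module R V] [AddCommGroup Y] [Module R Y] {q : X →ₗ[R] V}
    (hq : Function.Surjective q) (f : X →ₗ[R] Y) (hf : ∀ x, q x = 0 → f x = 0) :
    ∃ g : V →ₗ[R] Y, ∀ x, g (q x) = f x := by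
  refine ⟨(Submodule.liftQ (LinearMap.ker q) f hf) ∘ₗ
    (q.quotKerEquivOfSurjective hq).symm.toLinearMap, fun x => ?_⟩
  have : (q.quotKerEquivOfSurjective hq).symm (q x) = Submodule.Quotient.mk x := by
    rw [LinearEquiv.symm_apply_eq]; rfl
  rw [LinearMap.comp_apply, LinearEquiv.coe_coe, this]
  exact Submodule.liftQ_apply (LinearMap.ker q) f x

variable {R S A M V X : Type*} [CommRing S] [CommRing R] [IsLocalRing R] [Algebra S R] [Ring A]
    [AddCommGroup M] [Module S M] [Module Aᵐᵒᵖ M]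
    [AddCommGroup V] [Module S V] [Module A V] [Module R V] [IsScalarTower S R V]
    [SMulCommClass A R V]
    [AddCommGroup X] [Module S X] [Module A X] [Module R X] [IsScalarTower S R X]
    [SMulCommClass A R X]

variable (M) in
-- Right exactness of the tensor product: if q(x) = 0 then x ∈ 𝔪X, so m ⊗ x lies in 𝔪(M ⊗ X). The
-- projection of M ⊗ X modulo 𝔪 therefore factors through M ⊗ V.
theorem isReduction_coeffMap {q : X →ₗ[R] V} (hq : IsReduction q)
    (hA : ∀ (a : A) v, q (a • v) = a • q v) :
    IsReduction (coeffMap (S := S) M q hA) where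
  surjective z := by
    induction z using induction_on with
    | zero => exact ⟨0, map_zero _⟩
    | add x y hx hy =>
      obtain ⟨x, rfl⟩ := hx
      obtain ⟨y, rfl⟩ := hy
      exact ⟨x + y, map_add _ _ _⟩
    | mk m v =>
      obtain ⟨x, rfl⟩ := hq.surjective v
      exact ⟨mk S A m x, rfl⟩
  ker_le z hz := by
    set N : Submodule R (TensorOver S A M X) := IsLocalRing.maximalIdeal R • ⊤
    have hd : ∀ m : M, ∃ g : V →ₗ[R] TensorOver S A M X ⧸ N,
        ∀ x, g (q x) = N.mkQ (mk S A m x) := fun m => by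
      refine LinearMap.exists_descend hq.surjective (N.mkQ ∘ₗ mkHom R S A M X m) fun x hx => ?_
      rw [LinearMap.comp_apply, Submodule.mkQ_apply, Submodule.Quotient.mk_eq_zero]
      have := Submodule.mem_map_of_mem (f := mkHom R S A M X m) (hq.ker_le x hx)
      rw [Submodule.map_smul''] at this
      exact Submodule.smul_mono le_rfl le_top this
    choose g hg using hd
    let F : M →ₗ[S] V →ₗ[R] TensorOver S A M X ⧸ N :=
      { toFun := g
        map_add' := fun m m' => LinearMap.ext fun v => by
          obtain ⟨x, rfl⟩ := hq.surjective v
          rw [LinearMap.add_apply, hg, hg, hg, add_mk, map_add]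
        map_smul' := fun s m => LinearMap.ext fun v => by
          obtain ⟨x, rfl⟩ := hq.surjective v
          rw [RingHom.id_apply, LinearMap.smul_apply, hg, hg, ← smul_mk_left]
          rfl }
    let h : TensorOver S A M V →ₗ[R] TensorOver S A M X ⧸ N := coeffLift F fun m a v => by
      obtain ⟨x, rfl⟩ := hq.surjective v
      change g _ _ = g _ _
      rw [← hA, hg, hg, op_smul_tmul]
    have hh : h ∘ₗ coeffMap M q hA = N.mkQ := coeff_ext fun m x => hg m x
    have := LinearMap.congr_fun hh z
    rw [LinearMap.comp_apply, hz, map_zero] at this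
    exact (Submodule.Quotient.mk_eq_zero N).mp this.symm

end Reduction

section Assoc

variable {R S A B M N X Z : Type*} [CommRing S] [CommRing R] [Algebra S R] [Ring A] [Ring B]
    [Algebra S A] [Algebra S B]
    [AddCommGroup M] [Module S M] [Module B M] [Module Aᵐᵒᵖ M]
    [IsScalarTower S B M] [IsScalarTower S Aᵐᵒᵖ M] [SMulCommClass B Aᵐᵒᵖ M]
    [AddCommGroup N] [Module S N] [Module Bᵐᵒᵖ N]
    [AddCommGroup X] [Module S X] [Module A X] [Module R X] [IsScalarTower S R X]
    [SMulCommClass A R X]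
    [AddCommGroup Z] [Module S Z] [Module R Z] [IsScalarTower S R Z]

variable (R S A B M N X) in
/-- The pairing `(n ⊗ m, x) ↦ n ⊗ (m ⊗ x)`. -/
noncomputable def assocHom :
    TensorOver S B N M →ₗ[S] X →ₗ[R] TensorOver S B N (TensorOver S A M X) :=
  lift
    { toFun := fun n =>
        { toFun := fun m => mkHom R S B N (TensorOver S A M X) n ∘ₗ mkHom R S A M X m
          map_add' := fun m m' => by ext; simp
          map_smul' := fun s m => by ext; simp }
      map_add' := fun n n' => by ext; simp
      map_smul' := fun s n => by ext; simp }
    (fun n b m => LinearMap.ext fun x => op_smul_tmul b n (mk S A m x))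

theorem assocHom_mk (n : N) (m : M) (x : X) :
    assocHom R S A B M N X (mk S B n m) x = mk S B n (mk S A m x) := rfl

theorem assocHom_op_smul (t : TensorOver S B N M) (a : A) (x : X) :
    assocHom R S A B M N X (op a • t) x = assocHom R S A B M N X t (a • x) := by
  induction t using induction_on with
  | zero => simp only [smul_zero, map_zero, LinearMap.zero_apply]
  | add s t hs ht => simp only [smul_add, map_add, LinearMap.add_apply, hs, ht]
  | mk n m =>
    rw [op_smul_mk, assocHom_mk, assocHom_mk, op_smul_tmul]

theorem assocHom_smul {C : Type*} [Ring C] [Algebra S C] [Module C N] [IsScalarTower S C N]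
    [SMulCommClass C Bᵐᵒᵖ N] (c : C) (t : TensorOver S B N M) (x : X) :
    assocHom R S A B M N X (c • t) x = c • assocHom R S A B M N X t x := by
  induction t using induction_on with
  | zero => simp only [smul_zero, map_zero, LinearMap.zero_apply]
  | add s t hs ht => simp only [smul_add, map_add, LinearMap.add_apply, hs, ht]
  | mk n m => rfl

/-- Maps out of `N ⊗_B (M ⊗_A X)` from balanced maps on `(N ⊗_B M) × X`. -/
noncomputable def assocLift (f : TensorOver S B N M →ₗ[S] X →ₗ[R] Z)
    (hf : ∀ t (a : A) x, f (op a • t) x = f t (a • x)) :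
    TensorOver S B N (TensorOver S A M X) →ₗ[R] Z :=
  coeffLift
    { toFun := fun n => coeffLift
        { toFun := fun m => f (mk S B n m)
          map_add' := fun m m' => by rw [mk_add, map_add]
          map_smul' := fun s m => by rw [← smul_mk_right, map_smul]; rfl }
        (fun m a x => hf (mk S B n m) a x)
      map_add' := fun n n' => coeff_ext fun m x => by
        change f _ x = f _ x + f _ x
        rw [add_mk, map_add, LinearMap.add_apply]
      map_smul' := fun s n => coeff_ext fun m x => by
        change f _ x = s • f _ x
        rw [← smul_mk_left, map_smul, LinearMap.smul_apply] }
    (fun n b z => by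
      induction z using induction_on with
      | zero => simp only [smul_zero, map_zero]
      | add x y hx hy => simp only [smul_add, map_add, hx, hy]
      | mk m x =>
        change f (mk S B (op b • n) m) x = f (mk S B n (b • m)) x
        rw [op_smul_tmul])

theorem assocLift_assocHom (f : TensorOver S B N M →ₗ[S] X →ₗ[R] Z)
    (hf : ∀ t (a : A) x, f (op a • t) x = f t (a • x)) (t : TensorOver S B N M) (x : X) :
    assocLift f hf (assocHom R S A B M N X t x) = f t x := by
  induction t using induction_on with
  | zero => simp only [map_zero, LinearMap.zero_apply]
  | add s t hs ht => simp only [map_add, LinearMap.add_apply, hs, ht]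
  | mk n m => rfl

theorem assoc_induction {motive : TensorOver S B N (TensorOver S A M X) → Prop}
    (z : TensorOver S B N (TensorOver S A M X))
    (zero : motive 0) (mk : ∀ t x, motive (assocHom R S A B M N X t x))
    (add : ∀ z w, motive z → motive w → motive (z + w)) : motive z := by
  induction z using induction_on with
  | zero => exact zero
  | add x y hx hy => exact add x y hx hy
  | mk n z =>
    induction z using induction_on with
    | zero =>
      have h : TensorOver.mk S B n (0 : TensorOver S A M X) = 0 :=
        map_zero (mkHom R S B N (TensorOver S A M X) n)
      rwa [h]
    | add x y hx hy =>
      rw [TensorOver.mk_add]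
      exact add _ _ hx hy
    | mk m x => exact mk (TensorOver.mk S B n m) x

end Assoc

end TensorOver

/-! ### Symmetric quotients of group algebras and traces -/

/-- A quotient of a group algebra `S[G]` with a linear form `t` for which the images of `g` and
`g⁻¹` form dual bases. Direct factors of group algebras are of this kind. -/
structure GroupFrobenius (S G A : Type*) [CommRing S] [Group G] [Fintype G] [Ring A]
    [Algebra S A] where
  /-- the map from the group -/
  γ : G →* A
  /-- the symmetrizing form -/
  t : A →ₗ[S] S
  dual : ∀ a, ∑ g, t (γ g⁻¹ * a) • γ g = a

namespace GroupFrobenius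

variable {S G A : Type*} [CommRing S] [Group G] [Fintype G] [Ring A] [Algebra S A]
  (F : GroupFrobenius S G A)

theorem dual_smul {X : Type*} [AddCommGroup X] [Module S X] [Module A X] [IsScalarTower S A X]
    (a : A) (x : X) : ∑ g, F.t (F.γ g⁻¹ * a) • F.γ g • x = a • x := by
  conv_rhs => rw [← F.dual a, Finset.sum_smul]
  exact Finset.sum_congr rfl fun g _ => (smul_assoc _ _ _).symm

/-- The images of the group elements span `A` over `S`, so equivariance together with `S`-linearity
is `A`-linearity. -/
theorem map_smul_of_map_gamma_smul {X Y : Type*} [AddCommGroup X] [Module S X] [Module A X]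
    [IsScalarTower S A X] [AddCommGroup Y] [Module S Y] [Module A Y] [IsScalarTower S A Y]
    (f : X →+ Y) (hS : ∀ (s : S) x, f (s • x) = s • f x)
    (hf : ∀ g x, f (F.γ g • x) = F.γ g • f x) (a : A) (x : X) : f (a • x) = a • f x := by
  rw [← F.dual_smul a x, ← F.dual_smul a (f x), map_sum]
  exact Finset.sum_congr rfl fun g _ => by rw [hS, hf]

section Trace

variable {R X Y Z : Type*} [CommRing R] [Algebra S R]
    [AddCommGroup X] [Module S X] [Module A X] [Module R X] [IsScalarTower S R X]
    [IsScalarTower S A X] [SMulCommClass A R X]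
    [AddCommGroup Y] [Module S Y] [Module A Y] [Module R Y] [IsScalarTower S R Y]
    [IsScalarTower S A Y] [SMulCommClass A R Y]

/-- The trace `∑ g θ g⁻¹` of an `R`-linear map. -/
def trace (θ : X →ₗ[R] Y) : X →ₗ[R] Y where
  toFun x := ∑ g, F.γ g • θ (F.γ g⁻¹ • x)
  map_add' x y := by simp only [smul_add, map_add, Finset.sum_add_distrib]
  map_smul' r x := by
    rw [RingHom.id_apply, Finset.smul_sum]
    refine Finset.sum_congr rfl fun g _ => ?_
    rw [smul_comm, map_smul, smul_comm]

theorem trace_apply (θ : X →ₗ[R] Y) (x : X) :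
    F.trace θ x = ∑ g, F.γ g • θ (F.γ g⁻¹ • x) := rfl

theorem trace_smul (θ : X →ₗ[R] Y) (a : A) (x : X) : F.trace θ (a • x) = a • F.trace θ x := by
  refine F.map_smul_of_map_gamma_smul (F.trace θ).toAddMonoidHom (fun s x => ?_) (fun h x => ?_) a x
  · change F.trace θ (s • x) = s • F.trace θ x
    rw [← algebraMap_smul R s x, map_smul, algebraMap_smul]
  · change F.trace θ (F.γ h • x) = F.γ h • F.trace θ x
    rw [trace_apply, trace_apply, Finset.smul_sum]
    refine Fintype.sum_equiv (Equiv.mulLeft h⁻¹) _ _ fun g => ?_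
    change _ = F.γ h • F.γ (h⁻¹ * g) • θ (F.γ (h⁻¹ * g)⁻¹ • x)
    rw [smul_smul, ← map_mul, smul_smul, ← map_mul, mul_inv_cancel_left, mul_inv_rev, inv_inv]

/-- Traces of linear maps lift along reductions. -/
theorem exists_lift_trace [IsLocalRing R] [Module.Projective R X] {V V' : Type*}
    [AddCommGroup V] [Module S V] [Module A V] [Module R V] [IsScalarTower S R V]
    [IsScalarTower S A V] [SMulCommClass A R V]
    [AddCommGroup V'] [Module S V'] [Module A V'] [Module R V'] [IsScalarTower S R V']
    [IsScalarTower S A V'] [SMulCommClass A R V']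
    {q : X →ₗ[R] V} (hqA : ∀ (a : A) x, q (a • x) = a • q x)
    {q' : Y →ₗ[R] V'} (hq' : IsReduction q') (hqA' : ∀ (a : A) x, q' (a • x) = a • q' x)
    (θ : V →ₗ[R] V') :
    ∃ f : X →ₗ[R] Y, (∀ (a : A) x, f (a • x) = a • f x) ∧ ∀ x, q' (f x) = F.trace θ (q x) := by
  -- Only an R-linear lift of θ is available; taking its trace restores A-linearity and still lifts
  -- the trace of θ.
  obtain ⟨f, hf⟩ := hq'.exists_lift (q := q) θ
  refine ⟨F.trace f, F.trace_smul f, fun x => ?_⟩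
  rw [trace_apply, trace_apply, map_sum]
  refine Finset.sum_congr rfl fun g _ => ?_
  rw [hqA', hf, hqA]

end Trace

/-- Projective modules are relatively projective: the identity is a trace. -/
theorem exists_trace_eq_id (M : Type*) [AddCommGroup M] [Module S M] [Module A M]
    [IsScalarTower S A M] [Module.Projective A M] :
    ∃ θ : M →ₗ[S] M, ∀ m, ∑ g, F.γ g • θ (F.γ g⁻¹ • m) = m := by
  obtain ⟨s, hs⟩ := Module.projective_def'.mp ‹Module.Projective A M›
  -- On the regular module the map a ↦ t(a)·1 has trace ∑ t(g⁻¹a) g = a. The general case follows by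
  -- applying it coordinatewise to a free module of which M is a summand.
  let τ : A →ₗ[S] A := F.t.smulRight 1
  refine ⟨(Finsupp.linearCombination A id).restrictScalars S ∘ₗ Finsupp.mapRange.linearMap τ ∘ₗ
    s.restrictScalars S, fun m => ?_⟩
  have h : ∑ g, F.γ g • Finsupp.mapRange.linearMap τ (s (F.γ g⁻¹ • m)) = s m := by
    ext i
    rw [Finsupp.finsetSum_apply]
    conv_rhs => rw [← F.dual (s m i)]
    refine Finset.sum_congr rfl fun g _ => ?_
    simp [τ]
  conv_rhs => rw [← LinearMap.id_apply (R := A) m, ← hs, LinearMap.comp_apply, ← h, map_sum]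
  exact Finset.sum_congr rfl fun g _ => (map_smul (Finsupp.linearCombination A id) _ _).symm

/-- Higman's criterion for the left action alone: the form is applied only to the left factor of A ⊗
Aᵐᵒᵖ, so θ still commutes with the right action. This is what allows θ to be tensored with a left
module later. -/
theorem exists_bimodule_trace_eq_id (P : Type*) [AddCommGroup P] [Module (A ⊗[S] Aᵐᵒᵖ) P]
    [Module.Projective (A ⊗[S] Aᵐᵒᵖ) P] :
    ∃ θ : P →+ P, (∀ (a : A) p, θ ((1 ⊗ₜ[S] op a : A ⊗[S] Aᵐᵒᵖ) • p) =
        (1 ⊗ₜ[S] op a : A ⊗[S] Aᵐᵒᵖ) • θ p) ∧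
      ∀ p, ∑ g, (F.γ g ⊗ₜ[S] 1 : A ⊗[S] Aᵐᵒᵖ) •
        θ ((F.γ g⁻¹ ⊗ₜ[S] 1 : A ⊗[S] Aᵐᵒᵖ) • p) = p := by
  obtain ⟨s, hs⟩ := Module.projective_def'.mp ‹Module.Projective (A ⊗[S] Aᵐᵒᵖ) P›
  let τ : A ⊗[S] Aᵐᵒᵖ →ₗ[S] A ⊗[S] Aᵐᵒᵖ := (F.t.smulRight (1 : A)).rTensor Aᵐᵒᵖ
  have hτ : ∀ (a : A) z, τ ((1 ⊗ₜ[S] op a : A ⊗[S] Aᵐᵒᵖ) * z) =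
      (1 ⊗ₜ[S] op a : A ⊗[S] Aᵐᵒᵖ) * τ z := fun a z => by
    induction z using TensorProduct.induction_on with
    | zero => simp only [mul_zero, map_zero]
    | add x y hx hy => simp only [mul_add, map_add, hx, hy]
    | tmul b c => simp [τ]
  have hd : ∀ z, ∑ g, (F.γ g ⊗ₜ[S] 1 : A ⊗[S] Aᵐᵒᵖ) *
      τ ((F.γ g⁻¹ ⊗ₜ[S] 1 : A ⊗[S] Aᵐᵒᵖ) * z) = z := fun z => by
    induction z using TensorProduct.induction_on with
    | zero => simp only [mul_zero, map_zero, Finset.sum_const_zero]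
    | add x y hx hy => simp only [mul_add, map_add, Finset.sum_add_distrib, hx, hy]
    | tmul b c =>
      conv_rhs => rw [← F.dual b, TensorProduct.sum_tmul]
      refine Finset.sum_congr rfl fun g _ => ?_
      simp [τ]
  refine ⟨((Finsupp.linearCombination (A ⊗[S] Aᵐᵒᵖ) id).toAddMonoidHom.comp
    (Finsupp.mapRange.addMonoidHom τ.toAddMonoidHom)).comp s.toAddMonoidHom, fun a p => ?_,
    fun p => ?_⟩
  · change Finsupp.linearCombination (A ⊗[S] Aᵐᵒᵖ) id
      (Finsupp.mapRange.addMonoidHom τ.toAddMonoidHom (s _)) = _ •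
      Finsupp.linearCombination (A ⊗[S] Aᵐᵒᵖ) id
      (Finsupp.mapRange.addMonoidHom τ.toAddMonoidHom (s p))
    rw [← map_smul]
    congr 1
    ext i
    rw [map_smul]
    exact hτ a (s p i)
  · have h : ∑ g, (F.γ g ⊗ₜ[S] 1 : A ⊗[S] Aᵐᵒᵖ) • Finsupp.mapRange.addMonoidHom τ.toAddMonoidHom
        (s ((F.γ g⁻¹ ⊗ₜ[S] 1 : A ⊗[S] Aᵐᵒᵖ) • p)) = s p := by
      ext i
      rw [Finsupp.finsetSum_apply]
      conv_rhs => rw [← hd (s p i)]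
      refine Finset.sum_congr rfl fun g _ => ?_
      rw [map_smul]
      rfl
    conv_rhs => rw [← LinearMap.id_apply (R := A ⊗[S] Aᵐᵒᵖ) p, ← hs, LinearMap.comp_apply, ← h,
      map_sum]
    exact Finset.sum_congr rfl fun g _ =>
      (map_smul (Finsupp.linearCombination (A ⊗[S] Aᵐᵒᵖ) id) _ _).symm

/-- A bimodule `T` with bimodule maps `A → T → A` that compose to the identity and such that the
complementary projection is the trace of a map of right modules. -/
structure SplitTrace (T : Type*) [AddCommGroup T] [Module S T] [Module A T] [Module Aᵐᵒᵖ T] where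
  /-- the retraction `T → A` -/
  r : T →ₗ[S] A
  r_smul : ∀ (a : A) x, r (a • x) = a * r x
  r_op_smul : ∀ (a : A) x, r (op a • x) = r x * a
  /-- the image of `1` under `A → T` -/
  one : T
  smul_one : ∀ a : A, a • one = op a • one
  r_one : r one = 1
  /-- the map whose trace is the complementary projection -/
  θ : T →ₗ[S] T
  θ_op_smul : ∀ (a : A) x, θ (op a • x) = op a • θ x
  trace_θ : ∀ x, ∑ g, F.γ g • θ (F.γ g⁻¹ • x) = x - r x • one

/-- In A ⊕ P the projection onto P is the complement of the projection onto A, and it is a trace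
because the identity of P is one. -/
theorem nonempty_splitTrace {T : Type v} [AddCommGroup T] [Module S T] [Module A T]
    [Module Aᵐᵒᵖ T] [IsScalarTower S A T] (h : IsRegularPlusProjective S A T) :
    Nonempty (F.SplitTrace T) := by
  obtain ⟨P, _, _, _, φ, hφ⟩ := h
  obtain ⟨θ, hθ, hθt⟩ := F.exists_bimodule_trace_eq_id P
  have hl : ∀ (a : A) x, φ (a • x) = (a * (φ x).1, (a ⊗ₜ[S] 1 : A ⊗[S] Aᵐᵒᵖ) • (φ x).2) :=
    fun a x => by
      have := hφ a 1 x
      rwa [MulOpposite.op_one, one_smul, mul_one] at this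
  have hr : ∀ (a : A) x, φ (op a • x) = ((φ x).1 * a, (1 ⊗ₜ[S] op a : A ⊗[S] Aᵐᵒᵖ) • (φ x).2) :=
    fun a x => by
      have := hφ 1 a x
      rwa [one_smul, one_mul] at this
  -- The isomorphism φ is given only as additive and bilinear over A, so S acts through s·1. On P
  -- the scalar is moved to the right factor because θ is known to commute only with that factor.
  have hs : ∀ (s : S) x, φ (s • x) = ((s • 1 : A) * (φ x).1,
      (1 ⊗ₜ[S] op (s • 1) : A ⊗[S] Aᵐᵒᵖ) • (φ x).2) := fun s x => by
    rw [← one_smul A x, ← smul_assoc, hl, one_smul, MulOpposite.op_smul, MulOpposite.op_one,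
      TensorProduct.tmul_smul, TensorProduct.smul_tmul']
  have hsymm : ∀ (s : S) p, s • φ.symm (0, p) =
      φ.symm (0, (1 ⊗ₜ[S] op (s • 1) : A ⊗[S] Aᵐᵒᵖ) • p) := fun s p => by
    rw [AddEquiv.eq_symm_apply, hs, AddEquiv.apply_symm_apply, mul_zero]
  exact ⟨{
    r :=
      { toFun := fun x => (φ x).1
        map_add' := fun x y => by rw [map_add]; rfl
        map_smul' := fun s x => by rw [hs]; simp }
    r_smul := fun a x => congrArg Prod.fst (hl a x)
    r_op_smul := fun a x => congrArg Prod.fst (hr a x)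
    one := φ.symm (1, 0)
    smul_one := fun a => φ.injective (by
      rw [hl, hr, AddEquiv.apply_symm_apply, mul_one, one_mul, smul_zero, smul_zero])
    r_one := congrArg Prod.fst (φ.apply_symm_apply _)
    θ :=
      { toFun := fun x => φ.symm (0, θ (φ x).2)
        map_add' := fun x y => by
          rw [← map_add, Prod.mk_add_mk, add_zero, ← map_add, map_add]; rfl
        map_smul' := fun s x => by rw [RingHom.id_apply, hsymm, hs, hθ] }
    θ_op_smul := fun a x => φ.injective (by
      change φ (φ.symm (0, θ (φ (op a • x)).2)) = φ (op a • φ.symm (0, θ (φ x).2))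
      rw [hr, hr, AddEquiv.apply_symm_apply, AddEquiv.apply_symm_apply, hθ, zero_mul])
    trace_θ := fun x => φ.injective (by
      change φ (∑ g, F.γ g • φ.symm (0, θ (φ (F.γ g⁻¹ • x)).2)) = φ (x - (φ x).1 • φ.symm (1, 0))
      rw [map_sum, map_sub, hl, AddEquiv.apply_symm_apply, mul_one, smul_zero]
      simp only [hl, AddEquiv.apply_symm_apply, mul_zero]
      refine Prod.ext ?_ ?_
      · simp [Prod.fst_sum]
      · rw [Prod.snd_sum, Prod.snd_sub, sub_zero]
        exact hθt _) }⟩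

end GroupFrobenius

/-! ### The splitting X → N ⊗ (M ⊗ X) → X and its complementary trace -/

namespace GroupFrobenius

variable {S G A : Type*} [CommRing S] [Group G] [Fintype G] [Ring A] [Algebra S A]
  (F : GroupFrobenius S G A)

theorem induction_on {motive : A → Prop} (a : A) (gamma : ∀ g, motive (F.γ g)) (zero : motive 0)
    (add : ∀ a b, motive a → motive b → motive (a + b))
    (smul : ∀ (s : S) a, motive a → motive (s • a)) : motive a := by
  rw [← F.dual a]
  exact Finset.sum_induction _ motive add zero fun g _ => smul _ _ (gamma g)

section Maps

variable {R B M N X Y : Type*} [CommRing R] [Algebra S R] [Ring B] [Algebra S B]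
    [AddCommGroup M] [Module S M] [Module B M] [Module Aᵐᵒᵖ M]
    [IsScalarTower S B M] [IsScalarTower S Aᵐᵒᵖ M] [SMulCommClass B Aᵐᵒᵖ M]
    [AddCommGroup N] [Module S N] [Module A N] [Module Bᵐᵒᵖ N]
    [IsScalarTower S A N] [IsScalarTower S Bᵐᵒᵖ N] [SMulCommClass A Bᵐᵒᵖ N]
    [AddCommGroup X] [Module S X] [Module A X] [Module R X] [IsScalarTower S R X]
    [IsScalarTower S A X] [SMulCommClass A R X]
    [AddCommGroup Y] [Module S Y] [Module A Y] [Module R Y] [IsScalarTower S R Y]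
    [IsScalarTower S A Y] [SMulCommClass A R Y]

namespace SplitTrace

variable {F} (D : F.SplitTrace (TensorOver S B N M))

variable (R X) in
/-- The inclusion `X → N ⊗ (M ⊗ X)`. -/
noncomputable def incl : X →ₗ[R] TensorOver S B N (TensorOver S A M X) :=
  TensorOver.assocHom R S A B M N X D.one

theorem incl_smul (a : A) (x : X) : D.incl R X (a • x) = a • D.incl R X x := by
  rw [incl, ← TensorOver.assocHom_op_smul, ← D.smul_one, TensorOver.assocHom_smul]

variable (R X) in
/-- The retraction `N ⊗ (M ⊗ X) → X`. -/
noncomputable def retr : TensorOver S B N (TensorOver S A M X) →ₗ[R] X :=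
  TensorOver.assocLift
    { toFun := fun t =>
        { toFun := fun x => D.r t • x
          map_add' := fun x y => smul_add _ x y
          map_smul' := fun r x => smul_comm _ r x }
      map_add' := fun s t => by ext x; simp [add_smul]
      map_smul' := fun s t => by ext x; simp }
    (fun t a x => by
      change D.r (op a • t) • x = D.r t • a • x
      rw [D.r_op_smul, mul_smul])

theorem retr_assocHom (t : TensorOver S B N M) (x : X) :
    D.retr R X (TensorOver.assocHom R S A B M N X t x) = D.r t • x :=
  TensorOver.assocLift_assocHom _ _ t x

theorem retr_smul (a : A) (z : TensorOver S B N (TensorOver S A M X)) :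
    D.retr R X (a • z) = a • D.retr R X z := by
  refine TensorOver.assoc_induction (R := R) (A := A) (X := X)
    (motive := fun z => D.retr R X (a • z) = a • D.retr R X z) z ?_ (fun t x => ?_)
    fun x y hx hy => ?_
  · simp only [smul_zero, map_zero]
  · rw [← TensorOver.assocHom_smul, retr_assocHom, retr_assocHom, D.r_smul, mul_smul]
  · simp only [smul_add, map_add, hx, hy]

theorem retr_incl (x : X) : D.retr R X (D.incl R X x) = x := by
  rw [incl, retr_assocHom, D.r_one, one_smul]

variable (R X) in
/-- The endomorphism of `N ⊗ (M ⊗ X)` induced by `θ`. -/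
noncomputable def thetaHom : TensorOver S B N (TensorOver S A M X) →ₗ[R]
    TensorOver S B N (TensorOver S A M X) :=
  TensorOver.assocLift (TensorOver.assocHom R S A B M N X ∘ₗ D.θ)
    (fun t a x => by
      rw [LinearMap.comp_apply, LinearMap.comp_apply, D.θ_op_smul, TensorOver.assocHom_op_smul])

theorem trace_thetaHom (z : TensorOver S B N (TensorOver S A M X)) :
    F.trace (D.thetaHom R X) z = z - D.incl R X (D.retr R X z) := by
  refine TensorOver.assoc_induction (R := R) (A := A) (X := X)
    (motive := fun z => F.trace (D.thetaHom R X) z = z - D.incl R X (D.retr R X z))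
    z ?_ (fun t x => ?_)
    fun x y hx hy => ?_
  · simp only [map_zero, sub_zero]
  · have h : ∀ t, D.thetaHom R X (TensorOver.assocHom R S A B M N X t x) =
        TensorOver.assocHom R S A B M N X (D.θ t) x :=
      fun t => TensorOver.assocLift_assocHom _ _ t x
    rw [retr_assocHom, incl, ← TensorOver.assocHom_op_smul, ← D.smul_one, trace_apply]
    simp only [← TensorOver.assocHom_smul, h]
    rw [← LinearMap.sub_apply, ← map_sub, ← D.trace_θ, map_sum, LinearMap.sum_apply]
  · rw [map_add, hx, hy, map_add, map_add]; abel

theorem map_incl (f : X →ₗ[R] Y) (hf : ∀ (a : A) x, f (a • x) = a • f x) (x : X) :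
    TensorOver.coeffMap N (TensorOver.coeffMap M f hf) (TensorOver.coeffMap_smul (B := B) f hf)
      (D.incl R X x) = D.incl R Y (f x) := by
  rw [incl, incl]
  induction D.one using TensorOver.induction_on with
  | zero => simp only [map_zero, LinearMap.zero_apply]
  | add s t hs ht => simp only [map_add, LinearMap.add_apply, hs, ht]
  | mk n m => rfl

theorem retr_map (f : X →ₗ[R] Y) (hf : ∀ (a : A) x, f (a • x) = a • f x)
    (z : TensorOver S B N (TensorOver S A M X)) :
    D.retr R Y (TensorOver.coeffMap N (TensorOver.coeffMap M f hf)
      (TensorOver.coeffMap_smul (B := B) f hf) z) = f (D.retr R X z) := by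
  induction z using TensorOver.induction_on with
  | zero => simp only [map_zero]
  | add x y hx hy => simp only [map_add, hx, hy]
  | mk n z =>
    induction z using TensorOver.induction_on with
    | zero =>
      have h : TensorOver.mk S B n (0 : TensorOver S A M X) = 0 :=
        map_zero (TensorOver.mkHom R S B N (TensorOver S A M X) n)
      simp only [h, map_zero]
    | add x y hx hy => rw [TensorOver.mk_add]; simp only [map_add, hx, hy]
    | mk m x =>
      change D.r (TensorOver.mk S B n m) • f x = f (D.r (TensorOver.mk S B n m) • x)
      rw [hf]

end SplitTrace

/-- M ⊗ - turns traces for G into traces for H. Since M is projective over B, its identity is the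
trace of some τ, and Θ(m ⊗ x) = ∑ τ(mg) ⊗ θ(g⁻¹x). Summing over g makes this expression balanced,
and its trace over H collapses to ∑ mg ⊗ θ(g⁻¹x) = ∑ m ⊗ gθ(g⁻¹x). -/
theorem exists_coeffMap_trace_eq_trace {H : Type*} [Group H] [Fintype H]
    (F' : GroupFrobenius S H B) [Module.Projective B M] (θ : X →ₗ[R] Y) :
    ∃ Θ : TensorOver S A M X →ₗ[R] TensorOver S A M Y, ∀ z,
      TensorOver.coeffMap M (F.trace θ) (F.trace_smul θ) z = F'.trace Θ z := by
  obtain ⟨τ, hτ⟩ := F'.exists_trace_eq_id M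
  let f : M →ₗ[S] X →ₗ[R] TensorOver S A M Y := ∑ g,
    { toFun := fun m =>
        { toFun := fun x => TensorOver.mk S A (τ (op (F.γ g) • m)) (θ (F.γ g⁻¹ • x))
          map_add' := fun x y => by rw [smul_add, map_add, TensorOver.mk_add]
          map_smul' := fun r x => by
            rw [RingHom.id_apply, smul_comm, map_smul θ, TensorOver.coeff_smul_mk] }
      map_add' := fun m m' => LinearMap.ext fun x => by
        rw [smul_add, map_add]
        exact TensorOver.add_mk _ _ _
      map_smul' := fun s m => LinearMap.ext fun x => by
        have : op (F.γ g) • s • m = s • op (F.γ g) • m := smul_comm _ _ _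
        rw [this, map_smul]
        rfl }
  have hf : ∀ m x, f m x =
      ∑ g, TensorOver.mk S A (τ (op (F.γ g) • m)) (θ (F.γ g⁻¹ • x)) := fun m x => by
    rw [LinearMap.sum_apply, LinearMap.sum_apply]; rfl
  have hbal : ∀ m (a : A) x, f (op a • m) x = f m (a • x) := fun m a x => by
    induction a using F.induction_on with
    | zero => simp only [MulOpposite.op_zero, zero_smul, map_zero, LinearMap.zero_apply]
    | add a b ha hb =>
      simp only [MulOpposite.op_add, add_smul, map_add, LinearMap.add_apply, ha, hb]
    | smul s a ha =>
      rw [MulOpposite.op_smul, smul_assoc, map_smul, LinearMap.smul_apply, ha, smul_assoc,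
        ← algebraMap_smul R s (a • x), map_smul (f m), algebraMap_smul]
    | gamma h =>
      rw [hf, hf]
      refine Fintype.sum_equiv (Equiv.mulLeft h) _ _ fun g => ?_
      change _ = TensorOver.mk S A (τ (op (F.γ (h * g)) • m)) (θ (F.γ (h * g)⁻¹ • F.γ h • x))
      rw [smul_smul, ← MulOpposite.op_mul, ← map_mul, smul_smul, ← map_mul, mul_inv_rev,
        inv_mul_cancel_right]
  refine ⟨TensorOver.coeffLift f hbal, fun z => ?_⟩
  induction z using TensorOver.induction_on with
  | zero => simp only [map_zero]
  | add x y hx hy => simp only [map_add, hx, hy]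
  | mk m x =>
    have hl : ∀ y, TensorOver.mk S A m y = TensorOver.mkHom R S A M Y m y := fun y => rfl
    have hr : ∀ (m : M) y, TensorOver.mk S A m y =
      (TensorOver.mkHom R S A M Y).flip y m := fun m y => rfl
    rw [TensorOver.coeffMap_mk, trace_apply, trace_apply, hl, map_sum]
    simp only [TensorOver.smul_mk, TensorOver.coeffLift_mk, hf, Finset.smul_sum]
    rw [Finset.sum_comm]
    refine Finset.sum_congr rfl fun g _ => ?_
    rw [← hl, ← TensorOver.op_smul_tmul]
    conv_lhs => rw [← hτ (op (F.γ g) • m), hr, map_sum]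
    refine Finset.sum_congr rfl fun h _ => ?_
    rw [← hr, smul_comm]

end Maps

end GroupFrobenius

/-! ### Transporting maps of lifts and lifts through the equivalence -/

open Polynomial in
theorem LinearMap.aeval_apply_smul {R A X : Type*} [CommRing R] [Ring A] [AddCommGroup X]
    [Module R X] [Module A X] [SMulCommClass A R X] (y : Module.End R X)
    (hy : ∀ (a : A) x, y (a • x) = a • y x) (f : R[X]) (a : A) (x : X) :
    aeval y f (a • x) = a • aeval y f x := by
  induction f using Polynomial.induction_on' with
  | add f g hf hg => simp only [map_add, LinearMap.add_apply, smul_add, hf, hg]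
  | monomial n r =>
    have h : ∀ n : ℕ, (y ^ n) (a • x) = a • (y ^ n) x := fun n => by
      induction n with
      | zero => rfl
      | succ n ih => rw [pow_succ', Module.End.mul_apply, Module.End.mul_apply, ih, hy]
    rw [aeval_monomial, Module.End.mul_apply, Module.End.mul_apply, h,
      Module.algebraMap_end_apply, Module.algebraMap_end_apply, smul_comm a r]

/-- The image of an idempotent endomorphism, as a module over all the rings involved. -/
theorem exists_image_of_isIdempotentElem {S R A : Type*} {X : Type v} [CommRing S] [CommRing R]
    [Ring A] [Algebra S R] [Algebra S A]
    [AddCommGroup X] [Module S X] [Module A X] [Module R X] [IsScalarTower S R X]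
    [IsScalarTower S A X] [SMulCommClass A R X] (E : Module.End R X) (hE : IsIdempotentElem E)
    (hA : ∀ (a : A) x, E (a • x) = a • E x) :
    ∃ (Y : Type v) (_ : AddCommGroup Y) (_ : Module S Y) (_ : Module A Y) (_ : Module R Y)
      (_ : IsScalarTower S R Y) (_ : IsScalarTower S A Y) (_ : SMulCommClass A R Y)
      (j : Y →ₗ[R] X) (π : X →ₗ[R] Y), (∀ (a : A) y, j (a • y) = a • j y) ∧
      (∀ (a : A) x, π (a • x) = a • π x) ∧ (∀ y, π (j y) = y) ∧ ∀ x, j (π x) = E x := by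
  let Y := LinearMap.range E
  have hEE : ∀ x, E (E x) = E x := fun x => LinearMap.congr_fun hE x
  let _ : SMul A Y := ⟨fun a y => ⟨a • y.1, by
    obtain ⟨_, x, rfl⟩ := y
    exact ⟨a • x, hA a x⟩⟩⟩
  let _ : SMul S Y := ⟨fun s y => ⟨s • y.1, by
    rw [← algebraMap_smul R s y.1]
    exact Y.smul_mem _ y.2⟩⟩
  let _ : Module A Y := Function.Injective.module A Y.subtype.toAddMonoidHom
    Subtype.val_injective fun _ _ => rfl
  let _ : Module S Y := Function.Injective.module S Y.subtype.toAddMonoidHom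
    Subtype.val_injective fun _ _ => rfl
  refine ⟨Y, inferInstance, inferInstance, inferInstance, inferInstance,
    ⟨fun s r y => Subtype.ext (smul_assoc s r y.1)⟩,
    ⟨fun s a y => Subtype.ext (smul_assoc s a y.1)⟩,
    ⟨fun a r y => Subtype.ext (smul_comm a r y.1)⟩, Y.subtype, E.rangeRestrict,
    fun _ _ => rfl, fun a x => Subtype.ext (hA a x), ?_, fun _ => rfl⟩
  rintro ⟨_, x, rfl⟩
  exact Subtype.ext (hEE x)

theorem TensorOver.coeff_smul_eq_zero {R S A M V : Type*} [CommRing S] [CommRing R] [Algebra S R]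
    [Ring A] [AddCommGroup M] [Module S M] [Module Aᵐᵒᵖ M] [AddCommGroup V] [Module S V]
    [Module A V] [Module R V] [IsScalarTower S R V] [SMulCommClass A R V] {r : R}
    (hr : ∀ v : V, r • v = 0) (z : TensorOver S A M V) : r • z = 0 := by
  induction z using TensorOver.induction_on with
  | zero => rw [smul_zero]
  | add x y hx hy => rw [smul_add, hx, hy, add_zero]
  | mk m v =>
    rw [TensorOver.coeff_smul_mk, hr]
    exact map_zero (TensorOver.mkHom R S A M V m)

namespace GroupFrobenius.SplitTrace

variable {S G A : Type*} [CommRing S] [Group G] [Fintype G] [Ring A] [Algebra S A]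
  {F : GroupFrobenius S G A}
  {R B M : Type*} {N : Type v} [CommRing R] [IsLocalRing R] [Algebra S R] [Ring B] [Algebra S B]
  [AddCommGroup M] [Module S M] [Module B M] [Module Aᵐᵒᵖ M]
  [IsScalarTower S B M] [IsScalarTower S Aᵐᵒᵖ M] [SMulCommClass B Aᵐᵒᵖ M]
  [AddCommGroup N] [Module S N] [Module A N] [Module Bᵐᵒᵖ N]
  [IsScalarTower S A N] [IsScalarTower S Bᵐᵒᵖ N] [SMulCommClass A Bᵐᵒᵖ N]
  (D : F.SplitTrace (TensorOver S B N M))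
  {V : Type*} [AddCommGroup V] [Module S V] [Module A V] [Module R V] [IsScalarTower S R V]
  [IsScalarTower S A V] [SMulCommClass A R V]

include D in
/-- `M ⊗ -` reflects maps of lifts. -/
theorem exists_map_of_map_coeffMap {X Y : Type*}
    [AddCommGroup X] [Module S X] [Module A X] [Module R X] [IsScalarTower S R X]
    [IsScalarTower S A X] [SMulCommClass A R X]
    [AddCommGroup Y] [Module S Y] [Module A Y] [Module R Y] [IsScalarTower S R Y]
    [IsScalarTower S A Y] [SMulCommClass A R Y]
    {q : X →ₗ[R] V} (hq : ∀ (a : A) x, q (a • x) = a • q x)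
    {q' : Y →ₗ[R] V} (hq' : ∀ (a : A) x, q' (a • x) = a • q' x)
    (β : TensorOver S A M X →ₗ[R] TensorOver S A M Y) (hβ : ∀ (b : B) z, β (b • z) = b • β z)
    (hβq : ∀ z, TensorOver.coeffMap M q' hq' (β z) = TensorOver.coeffMap M q hq z) :
    ∃ α : X →ₗ[R] Y, (∀ (a : A) x, α (a • x) = a • α x) ∧ ∀ x, q' (α x) = q x := by
  -- By naturality of the splitting, the reduction of this composite is r ∘ ι = 1 on V; no
  -- correction is needed here.
  refine ⟨D.retr R Y ∘ₗ TensorOver.coeffMap N β hβ ∘ₗ D.incl R X, fun a x => ?_, fun x => ?_⟩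
  · rw [LinearMap.comp_apply, LinearMap.comp_apply, incl_smul, TensorOver.coeffMap_smul, retr_smul]
    rfl
  · have h : ∀ z : TensorOver S B N (TensorOver S A M X),
        TensorOver.coeffMap N (TensorOver.coeffMap M q' hq')
        (TensorOver.coeffMap_smul (B := B) q' hq') (TensorOver.coeffMap N β hβ z) =
        TensorOver.coeffMap N (TensorOver.coeffMap M q hq)
        (TensorOver.coeffMap_smul (B := B) q hq) z := fun z => by
      induction z using TensorOver.induction_on with
      | zero => simp only [map_zero]
      | add x y hx hy => simp only [map_add, hx, hy]
      | mk n z => rw [TensorOver.coeffMap_mk, TensorOver.coeffMap_mk, TensorOver.coeffMap_mk, hβq]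
    rw [LinearMap.comp_apply, ← D.retr_map q' hq', LinearMap.comp_apply, h, D.map_incl, D.retr_incl]

variable {H : Type*} [Group H] [Fintype H] {F' : GroupFrobenius S H B}
  (D' : F'.SplitTrace (TensorOver S A M N))
  [Module.Finite Aᵐᵒᵖ M] [Module.Projective Aᵐᵒᵖ M] [Module.Projective B M]
  [Module.Finite Bᵐᵒᵖ N] [Module.Projective Bᵐᵒᵖ N]

include D in
/-- Decomposing `N ⊗ Y` for a lift `Y` of `M ⊗ V`. -/
theorem exists_summand [IsNoetherianRing R] [IsAdicComplete (IsLocalRing.maximalIdeal R) R]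
    (hV : ∀ r ∈ IsLocalRing.maximalIdeal R, ∀ v : V, r • v = 0)
    {Y : Type w} [AddCommGroup Y] [Module S Y] [Module B Y] [Module R Y] [IsScalarTower S R Y]
    [IsScalarTower S B Y] [SMulCommClass B R Y] [Module.Finite R Y] [Module.Projective R Y]
    {q : Y →ₗ[R] TensorOver S A M V} (hq : IsReduction q) (hqB : ∀ (b : B) y, q (b • y) = b • q y) :
    ∃ (X : Type (max v w)) (_ : AddCommGroup X) (_ : Module S X) (_ : Module A X) (_ : Module R X)
      (_ : IsScalarTower S R X) (_ : IsScalarTower S A X) (_ : SMulCommClass A R X)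
      (_ : Module.Finite R X) (_ : Module.Projective R X)
      (j : X →ₗ[R] TensorOver S B N Y) (p : X →ₗ[R] V),
      (∀ (a : A) x, j (a • x) = a • j x) ∧ IsReduction p ∧ (∀ (a : A) x, p (a • x) = a • p x) ∧
      ∀ x, TensorOver.coeffMap N q hqB (j x) = D.incl R V (p x) := by
  have hq0 := TensorOver.isReduction_coeffMap (S := S) N hq hqB
  set q0 := TensorOver.coeffMap (S := S) N q hqB
  have hq0A : ∀ (a : A) z, q0 (a • z) = a • q0 z := TensorOver.coeffMap_smul q hqB
  have hker : ∀ z ∈ (IsLocalRing.maximalIdeal R • ⊤ : Submodule R (TensorOver S B N Y)),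
      q0 z = 0 := fun z hz => by
    refine Submodule.smul_induction_on hz (fun r hr w _ => ?_) fun x y hx hy => ?_
    · rw [map_smul]
      exact TensorOver.coeff_smul_eq_zero (TensorOver.coeff_smul_eq_zero (hV r hr)) _
    · rw [map_add, hx, hy, add_zero]
  -- The complement 1 - ιr on N ⊗ (M ⊗ V) is a trace, so it lifts to an A-linear endomorphism of N ⊗
  -- Y. Its complement `y` lifts the projection ιr.
  obtain ⟨x, hxA, hx⟩ := F.exists_lift_trace (X := TensorOver S B N Y) hq0A hq0 hq0A
    (D.thetaHom R V)
  let y : Module.End R (TensorOver S B N Y) := 1 - x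
  have hyA : ∀ (a : A) z, y (a • z) = a • y z := fun a z => by
    change a • z - x (a • z) = a • (z - x z)
    rw [hxA, smul_sub]
  have hy : ∀ z, q0 (y z) = D.incl R V (D.retr R V (q0 z)) := fun z => by
    change q0 (z - x z) = _
    rw [map_sub, hx, D.trace_thetaHom, sub_sub_cancel]
  -- Being a polynomial in `y`, the idempotent inherits A-linearity, so its image is an A-module.
  obtain ⟨e, he, hey⟩ := LinearMap.exists_isIdempotentElem_aeval y fun z => hq0.ker_le _ (by
    rw [pow_two, LinearMap.sub_apply, Module.End.mul_apply, map_sub, hy, hy, D.retr_incl, sub_self])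
  set E := Polynomial.aeval y e
  have hE : ∀ z, q0 (E z) = D.incl R V (D.retr R V (q0 z)) := fun z => by
    have := hker _ (hey z)
    rwa [LinearMap.sub_apply, map_sub, sub_eq_zero, hy] at this
  obtain ⟨X, _, _, _, _, _, _, _, j, π, hjA, hπA, hπj, hjπ⟩ :=
    exists_image_of_isIdempotentElem (S := S) (A := A) E he
      (LinearMap.aeval_apply_smul y hyA e)
  have hj : ∀ z, q0 (j z) = D.incl R V (D.retr R V (q0 (j z))) := fun z => by
    rw [← hE, ← hjπ, hπj]
  refine ⟨X, inferInstance, inferInstance, inferInstance, inferInstance, inferInstance,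
    inferInstance, inferInstance, Module.Finite.of_surjective π fun z => ⟨j z, hπj z⟩,
    Module.Projective.of_split j π (LinearMap.ext hπj), j, D.retr R V ∘ₗ q0 ∘ₗ j, hjA,
    ⟨fun v => ?_, fun z hz => ?_⟩, fun a z => ?_, hj⟩
  · obtain ⟨z, hz⟩ := hq0.surjective (D.incl R V v)
    refine ⟨π z, ?_⟩
    rw [LinearMap.comp_apply, LinearMap.comp_apply, hjπ, hE, hz, D.retr_incl, D.retr_incl]
  · rw [LinearMap.comp_apply, LinearMap.comp_apply] at hz
    have h0 := hj z
    rw [hz, map_zero] at h0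
    have := Submodule.mem_map_of_mem (f := π) (hq0.ker_le _ h0)
    rw [hπj, Submodule.map_smul''] at this
    exact Submodule.smul_mono le_rfl le_top this
  · rw [LinearMap.comp_apply, LinearMap.comp_apply, hjA, hq0A, D.retr_smul]
    rfl

include D' in
/-- A lift `Y` of `M ⊗ V` whose image `N ⊗ Y` contains a lift `X` of `V` is isomorphic
to `M ⊗ X`. -/
theorem exists_map_of_summand {X Y : Type*}
    [AddCommGroup X] [Module S X] [Module A X] [Module R X] [IsScalarTower S R X]
    [IsScalarTower S A X] [SMulCommClass A R X] [Module.Projective R X]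
    [AddCommGroup Y] [Module S Y] [Module B Y] [Module R Y] [IsScalarTower S R Y]
    [IsScalarTower S B Y] [SMulCommClass B R Y]
    {q : Y →ₗ[R] TensorOver S A M V} (hq : IsReduction q) (hqB : ∀ (b : B) y, q (b • y) = b • q y)
    (j : X →ₗ[R] TensorOver S B N Y) (p : X →ₗ[R] V) (hjA : ∀ (a : A) x, j (a • x) = a • j x)
    (hpA : ∀ (a : A) x, p (a • x) = a • p x)
    (hj : ∀ x, TensorOver.coeffMap N q hqB (j x) = D.incl R V (p x)) :
    ∃ f : TensorOver S A M X →ₗ[R] Y, (∀ (b : B) z, f (b • z) = b • f z) ∧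
      ∀ z, q (f z) = TensorOver.coeffMap M p hpA z := by
  obtain ⟨Θ, hΘ⟩ := F.exists_coeffMap_trace_eq_trace (M := M) F' (D.thetaHom R V)
  -- With the splittings ι, r of N ⊗ M and ι', r' of M ⊗ N, the reductions of α and d are r' ∘ (M ⊗
  -- ι) and (M ⊗ r) ∘ ι'.
  let α : TensorOver S A M X →ₗ[R] Y := D'.retr R Y ∘ₗ TensorOver.coeffMap M j hjA
  let d : TensorOver S A M X →ₗ[R] TensorOver S A M X :=
    TensorOver.coeffMap M (D.retr R X) D.retr_smul ∘ₗ D'.incl R (TensorOver S A M X)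
  have hα : ∀ z, q (α z) = D'.retr R _ (TensorOver.coeffMap M (D.incl R V) D.incl_smul
      (TensorOver.coeffMap M p hpA z)) := fun z => by
    rw [LinearMap.comp_apply, ← D'.retr_map q hqB]
    congr 1
    induction z using TensorOver.induction_on with
    | zero => simp only [map_zero]
    | add x y hx hy => simp only [map_add, hx, hy]
    | mk m x => simp only [TensorOver.coeffMap_mk, hj]
  have hd : ∀ z, TensorOver.coeffMap M p hpA (d z) =
      TensorOver.coeffMap M (D.retr R V) D.retr_smul
        (D'.incl R _ (TensorOver.coeffMap M p hpA z)) := fun z => by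
    rw [LinearMap.comp_apply, ← D'.map_incl _ (TensorOver.coeffMap_smul (B := B) p hpA)]
    induction D'.incl R (TensorOver S A M X) z using TensorOver.induction_on with
    | zero => simp only [map_zero]
    | add x y hx hy => simp only [map_add, hx, hy]
    | mk m w => simp only [TensorOver.coeffMap_mk, D.retr_map]
  have htr : ∀ z, TensorOver.coeffMap M (D.incl R V) D.incl_smul
      (TensorOver.coeffMap M (D.retr R V) D.retr_smul z) = z - F'.trace Θ z := fun z => by
    rw [← hΘ]
    induction z using TensorOver.induction_on with
    | zero => simp only [map_zero, sub_zero]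
    | add x y hx hy => simp only [map_add, hx, hy]; abel
    | mk m w =>
      simp only [TensorOver.coeffMap_mk, D.trace_thetaHom]
      rw [eq_sub_iff_add_eq, ← TensorOver.mk_add, add_sub_cancel]
  -- Since (M ⊗ ι)(M ⊗ r) = 1 - tr Θ, the reduction of α ∘ d is r'(1 - tr Θ)ι' = 1 - tr(r'Θι'). The
  -- map w lifts the missing trace, so α ∘ d + w reduces to the identity.
  obtain ⟨w, hwB, hw⟩ := F'.exists_lift_trace (X := TensorOver S A M X)
    (TensorOver.coeffMap_smul (B := B) p hpA) hq hqB
    (D'.retr R (TensorOver S A M V) ∘ₗ Θ ∘ₗ D'.incl R (TensorOver S A M V))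
  refine ⟨α ∘ₗ d + w, fun b z => ?_, fun z => ?_⟩
  · rw [LinearMap.add_apply, LinearMap.add_apply, smul_add, hwB]
    simp only [α, d, LinearMap.comp_apply, D'.incl_smul, TensorOver.coeffMap_smul, D'.retr_smul]
  · rw [LinearMap.add_apply, map_add, hw, LinearMap.comp_apply, hα, hd, htr, map_sub, D'.retr_incl,
      trace_apply, trace_apply, map_sum]
    simp only [LinearMap.comp_apply, D'.incl_smul, D'.retr_smul, sub_add_cancel]

end GroupFrobenius.SplitTrace

/-! ### Coefficient rings, tangent vectors and reduction modulo p -/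

/-- The kernels of the iterates stabilise at some n; an element of ker f has the form fⁿ(y), and
then y ∈ ker fⁿ⁺¹ = ker fⁿ. -/
theorem RingHom.injective_of_surjective_of_isNoetherianRing {R : Type*} [CommRing R]
    [IsNoetherianRing R] (f : R →+* R) (hf : Function.Surjective f) : Function.Injective f := by
  let K : ℕ →o Ideal R := ⟨fun n => RingHom.ker (f ^ n), monotone_nat_of_le_succ fun n x hx => by
    rw [RingHom.mem_ker] at hx ⊢
    rw [pow_succ', RingHom.mul_def, RingHom.comp_apply, hx, map_zero]⟩
  obtain ⟨n, hn⟩ := monotone_stabilizes_iff_noetherian.mpr ‹IsNoetherianRing R› K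
  have hsurj : Function.Surjective (f ^ n) := by
    rw [RingHom.coe_pow]
    exact hf.iterate n
  rw [injective_iff_map_eq_zero]
  intro x hx
  obtain ⟨y, rfl⟩ := hsurj x
  have hy : y ∈ K (n + 1) := by
    change (f ^ (n + 1)) y = 0
    rwa [pow_succ', RingHom.mul_def, RingHom.comp_apply]
  rw [← hn (n + 1) n.le_succ] at hy
  exact hy

section AlgebraOfSurjective

variable (W S C : Type*) [CommRing W] [CommRing S] [CommRing C] [Algebra W S] [Algebra W C]

/-- The algebra structure over a quotient `S` of `W`. -/
@[reducible] noncomputable def algebraOfSurjective (hS : Function.Surjective (algebraMap W S))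
    (hC : RingHom.ker (algebraMap W S) ≤ RingHom.ker (algebraMap W C)) : Algebra S C :=
  ((algebraMap W S).liftOfSurjective hS ⟨algebraMap W C, hC⟩).toAlgebra

theorem isScalarTower_algebraOfSurjective (hS : Function.Surjective (algebraMap W S))
    (hC : RingHom.ker (algebraMap W S) ≤ RingHom.ker (algebraMap W C)) :
    letI := algebraOfSurjective W S C hS hC
    IsScalarTower W S C :=
  letI := algebraOfSurjective W S C hS hC
  IsScalarTower.of_algebraMap_eq fun x =>
    (RingHom.liftOfRightInverse_comp_apply _ _ _ ⟨algebraMap W C, hC⟩ x).symm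

end AlgebraOfSurjective

variable {p : ℕ} [Fact p.Prime] {k : Type u} [Field k]

theorem algebraMap_witt_surjective : Function.Surjective (algebraMap (WittVector p k) k) :=
  fun x => ⟨WittVector.teichmuller p x, WittVector.teichmuller_coeff_zero p x⟩

theorem ker_algebraMap_witt [CharP k p] [PerfectRing k p] :
    RingHom.ker (algebraMap (WittVector p k) k) = Ideal.span {(p : WittVector p k)} :=
  WittVector.ker_constantCoeff

theorem ker_algebraMap_witt_le [CharP k p] [PerfectRing k p] (C : Type*) [CommRing C]
    [Algebra (WittVector p k) C] (hC : (p : C) = 0) :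
    RingHom.ker (algebraMap (WittVector p k) k) ≤ RingHom.ker (algebraMap (WittVector p k) C) := by
  rw [ker_algebraMap_witt, Ideal.span_singleton_le_iff_mem, RingHom.mem_ker, map_natCast, hC]

namespace CoeffRing

variable {R R' R'' : CoeffRing p k}

theorem res_algebraMap (R : CoeffRing p k) (w : WittVector p k) :
    R.res (algebraMap _ R w) = algebraMap _ k w := R.res.commutes w

theorem res_eq_zero_iff (R : CoeffRing p k) (x : R) :
    R.res x = 0 ↔ x ∈ IsLocalRing.maximalIdeal R := by
  rw [← R.ker_res]; rfl

theorem natCast_p_mem [CharP k p] (R : CoeffRing p k) :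
    (p : R) ∈ IsLocalRing.maximalIdeal R := by
  rw [← res_eq_zero_iff, map_natCast, CharP.cast_eq_zero]

namespace Hom

theorem ext {f g : Hom R R'} (h : ∀ x, f.toAlgHom x = g.toAlgHom x) : f = g := by
  cases f; cases g
  congr
  exact AlgHom.ext h

/-- Composition of morphisms. -/
noncomputable def comp (g : Hom R' R'') (f : Hom R R') : Hom R R'' where
  toAlgHom := g.toAlgHom.comp f.toAlgHom
  res_comp x := (g.res_comp _).trans (f.res_comp x)

end Hom

/-- With a, b Witt vectors lifting the residues of x, y, the product (x - a)(y - b) lies in 𝔪². The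
resulting formula makes linear forms that vanish at 1 into derivations. -/
theorem Hom.map_mul_snd [CharP k p] [PerfectRing k p] (R : CoeffRing p k) (J : Ideal R)
    (hJ : IsLocalRing.maximalIdeal R ^ 2 ≤ J) [Algebra k (R ⧸ J)]
    [IsScalarTower (WittVector p k) k (R ⧸ J)] (x y : R) :
    Ideal.Quotient.mk J (x * y) = R.res x • Ideal.Quotient.mk J y + R.res y • Ideal.Quotient.mk J x
      - (R.res x * R.res y) • 1 := by
  obtain ⟨a, ha⟩ := algebraMap_witt_surjective (p := p) (R.res x)
  obtain ⟨b, hb⟩ := algebraMap_witt_surjective (p := p) (R.res y)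
  have hs : ∀ (w : WittVector p k) (z : R), algebraMap _ k w • Ideal.Quotient.mk J z =
      Ideal.Quotient.mk J (algebraMap _ R w * z) := fun w z => by
    rw [algebraMap_smul, Algebra.smul_def, map_mul]; rfl
  have h1 : (1 : R ⧸ J) = Ideal.Quotient.mk J 1 := rfl
  rw [← ha, ← hb, ← map_mul, h1, hs, hs, hs, ← map_add, ← map_sub,
    Ideal.Quotient.mk_eq_mk_iff_sub_mem]
  have : x * y - (algebraMap _ R a * y + algebraMap _ R b * x - algebraMap _ R (a * b) * 1) =
      (x - algebraMap _ R a) * (y - algebraMap _ R b) := by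
    rw [map_mul]; ring
  rw [this]
  refine hJ ?_
  rw [pow_two]
  refine Ideal.mul_mem_mul ?_ ?_
  · rw [← res_eq_zero_iff, map_sub, res_algebraMap, ha, sub_self]
  · rw [← res_eq_zero_iff, map_sub, res_algebraMap, hb, sub_self]

/-- Morphisms to the dual numbers separate `R / (𝔪² + pR)`. -/
theorem exists_hom_dual_ne [CharP k p] [PerfectRing k p] (R : CoeffRing p k) (x y : R)
    (hxy : R.res x = R.res y)
    (h : x - y ∉ IsLocalRing.maximalIdeal R ^ 2 ⊔ Ideal.span {(p : R)}) :
    ∃ f : Hom R (dual p k), f.toAlgHom x ≠ f.toAlgHom y := by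
  set J := IsLocalRing.maximalIdeal R ^ 2 ⊔ Ideal.span {(p : R)}
  have hp : (p : R ⧸ J) = 0 := by
    rw [← map_natCast (Ideal.Quotient.mk J), Ideal.Quotient.eq_zero_iff_mem]
    exact Ideal.mem_sup_right (Ideal.mem_span_singleton_self _)
  let _ : Algebra k (R ⧸ J) := algebraOfSurjective (WittVector p k) k (R ⧸ J)
    algebraMap_witt_surjective (ker_algebraMap_witt_le _ hp)
  have _ : IsScalarTower (WittVector p k) k (R ⧸ J) :=
    isScalarTower_algebraOfSurjective _ _ _ _ _
  have hJres : ∀ z ∈ J, R.res z = 0 := fun z hz => by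
    rw [res_eq_zero_iff]
    have hle : J ≤ IsLocalRing.maximalIdeal R := sup_le (Ideal.pow_le_self two_ne_zero) (by
      rw [Ideal.span_singleton_le_iff_mem]
      exact R.natCast_p_mem)
    exact hle hz
  have hmk : ∀ w : WittVector p k, Ideal.Quotient.mk J (algebraMap _ R w) =
      algebraMap _ k w • (1 : R ⧸ J) := fun w => by
    rw [algebraMap_smul, Algebra.smul_def, mul_one]; rfl
  -- The morphism will be z ↦ res z + δ(z)ε, with δ a k-linear form that vanishes at 1 and not at x
  -- - y. It exists because x - y has residue 0: a multiple of 1 congruent to it modulo J would be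
  -- 0, putting x - y in J.
  obtain ⟨δ, hδ, hδ1⟩ := Submodule.exists_le_ker_of_notMem (p := Submodule.span k {(1 : R ⧸ J)})
    (v := Ideal.Quotient.mk J (x - y)) (fun hv => by
      obtain ⟨c, hc⟩ := Submodule.mem_span_singleton.mp hv
      obtain ⟨w, rfl⟩ := algebraMap_witt_surjective (p := p) c
      rw [← hmk, Ideal.Quotient.mk_eq_mk_iff_sub_mem] at hc
      have := hJres _ hc
      rw [map_sub, map_sub, hxy, sub_self, sub_zero, res_algebraMap] at this
      have hw : (algebraMap (WittVector p k) R w) ∈ J := by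
        rw [← Ideal.Quotient.eq_zero_iff_mem, hmk, this, zero_smul]
      exact h ((Submodule.sub_mem_iff_right J hw).mp hc))
  have hδ1 : δ 1 = 0 := hδ1 (Submodule.mem_span_singleton_self _)
  refine ⟨{
    toAlgHom :=
      { toFun := fun z => (R.res z, δ (Ideal.Quotient.mk J z))
        map_one' := TrivSqZeroExt.ext (map_one R.res) hδ1
        map_zero' := TrivSqZeroExt.ext (map_zero R.res)
          ((congrArg δ (map_zero _)).trans (map_zero δ))
        map_add' := fun a b => TrivSqZeroExt.ext (map_add R.res a b)
          ((congrArg δ (map_add _ a b)).trans (map_add δ _ _))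
        map_mul' := fun a b => TrivSqZeroExt.ext (map_mul R.res a b) (by
          change δ (Ideal.Quotient.mk J (a * b)) = R.res a • δ (Ideal.Quotient.mk J b) +
            op (R.res b) • δ (Ideal.Quotient.mk J a)
          rw [Hom.map_mul_snd R J le_sup_left, map_sub, map_add, map_smul, map_smul, map_smul, hδ1,
            smul_zero, sub_zero, op_smul_eq_smul])
        commutes' := fun w => TrivSqZeroExt.ext (res_algebraMap R w) (by
          change δ (Ideal.Quotient.mk J (algebraMap _ R w)) = 0
          rw [hmk, map_smul, hδ1, smul_zero]) }
    res_comp := fun z => rfl }, fun he => hδ ?_⟩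
  have : δ (Ideal.Quotient.mk J x) = δ (Ideal.Quotient.mk J y) := congrArg TrivSqZeroExt.snd he
  rw [map_sub, map_sub, this, sub_self]

/-- An endomorphism that acts trivially on tangent vectors is bijective. -/
theorem Hom.bijective_of_comp_dual [CharP k p] [PerfectRing k p] (φ : Hom R R)
    (hφ : ∀ f : Hom R (dual p k), f.comp φ = f) : Function.Bijective φ.toAlgHom := by
  set m := IsLocalRing.maximalIdeal R
  have hsub : ∀ x, φ.toAlgHom x - x ∈ m ^ 2 ⊔ Ideal.span {(p : R)} := fun x => by
    by_contra h
    obtain ⟨f, hf⟩ := exists_hom_dual_ne R _ _ (φ.res_comp x) h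
    exact hf (congrArg (fun g : Hom R (dual p k) => g.toAlgHom x) (hφ f))
  -- Each x ∈ 𝔪 agrees with φ(x) modulo 𝔪² + (p), and p = φ(p) already lies in φ(𝔪)R; Nakayama's
  -- lemma removes 𝔪².
  have hm : m ≤ m.map φ.toAlgHom := by
    refine Submodule.le_of_le_smul_of_le_jacobson_bot (I := m)
      (IsNoetherian.noetherian m) (IsLocalRing.maximalIdeal_le_jacobson _) fun x hx => ?_
    have h1 : m ^ 2 ⊔ Ideal.span {(p : R)} ≤ m.map φ.toAlgHom ⊔ m • m := by
      refine sup_le ?_ ?_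
      · rw [pow_two]; exact le_sup_right
      · rw [Ideal.span_singleton_le_iff_mem]
        refine Ideal.mem_sup_left ?_
        rw [← map_natCast φ.toAlgHom]
        exact Ideal.mem_map_of_mem _ R.natCast_p_mem
    have h2 : φ.toAlgHom x ∈ m.map φ.toAlgHom ⊔ m • m :=
      Ideal.mem_sup_left (Ideal.mem_map_of_mem _ hx)
    have := sub_mem h2 (h1 (hsub x))
    rwa [sub_sub_cancel] at this
  have hH : IsHausdorff (m.map φ.toAlgHom.toRingHom) R :=
    IsHausdorff.of_le_jacobson _ _ (φ.map_maximalIdeal.trans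
      (IsLocalRing.maximalIdeal_le_jacobson _))
  have hs : Function.Surjective φ.toAlgHom.toRingHom := by
    -- By completeness it suffices to be surjective modulo φ(𝔪)R, which contains 𝔪; there the image
    -- of W(k) is everything.
    refine surjective_of_mk_map_comp_surjective (I := m) _ fun y => ?_
    obtain ⟨y, rfl⟩ := Ideal.Quotient.mk_surjective y
    obtain ⟨w, hw⟩ := algebraMap_witt_surjective (p := p) (R.res y)
    refine ⟨algebraMap _ R w, ?_⟩
    rw [RingHom.comp_apply, Ideal.Quotient.mk_eq_mk_iff_sub_mem]
    refine hm ?_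
    rw [← res_eq_zero_iff, map_sub, sub_eq_zero]
    change R.res (φ.toAlgHom _) = _
    rw [φ.res_comp, res_algebraMap, hw]
  exact ⟨RingHom.injective_of_surjective_of_isNoetherianRing φ.toAlgHom.toRingHom hs, hs⟩

section ModP

variable [CharP k p] (R)

theorem map_mk_maximalIdeal {R : Type*} [CommRing R] [IsLocalRing R] (J : Ideal R)
    [IsLocalRing (R ⧸ J)] (hJ : J ≤ IsLocalRing.maximalIdeal R) :
    (IsLocalRing.maximalIdeal R).map (algebraMap R (R ⧸ J)) =
      IsLocalRing.maximalIdeal (R ⧸ J) := by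
  refine IsLocalRing.eq_maximalIdeal ?_
  refine (Ideal.map_eq_top_or_isMaximal_of_surjective _ Ideal.Quotient.mk_surjective
    (IsLocalRing.maximalIdeal.isMaximal R)).resolve_left fun h => ?_
  have h1 := congrArg (Ideal.comap (Ideal.Quotient.mk J)) h
  rw [Ideal.comap_map_of_surjective _ Ideal.Quotient.mk_surjective,
    Ideal.comap_top, ← RingHom.ker_eq_comap_bot, Ideal.mk_ker, sup_eq_left.mpr hJ] at h1
  exact Ideal.IsPrime.ne_top' h1

theorem span_p_le : Ideal.span {(p : R)} ≤ IsLocalRing.maximalIdeal R := by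
  rw [Ideal.span_singleton_le_iff_mem]
  exact R.natCast_p_mem

/-- The reduction `R / pR`. -/
noncomputable def modP : CoeffRing p k :=
  haveI : Nontrivial (R ⧸ Ideal.span {(p : R)}) := Ideal.Quotient.nontrivial_iff.mpr
    (ne_top_of_le_ne_top (Ideal.IsPrime.ne_top inferInstance) R.span_p_le)
  haveI : IsLocalRing (R ⧸ Ideal.span {(p : R)}) :=
    IsLocalRing.of_surjective' _ Ideal.Quotient.mk_surjective
  { carrier := R ⧸ Ideal.span {(p : R)}
    isAdicComplete := by
      rw [← map_mk_maximalIdeal _ R.span_p_le]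
      exact (IsAdicComplete.map_algebraMap_iff _ _).mpr (IsAdicComplete.of_finite _)
    res := Ideal.Quotient.liftₐ _ R.res fun x hx => by
      rw [res_eq_zero_iff]
      exact R.span_p_le hx }

/-- The projection `R → R / pR`. -/
noncomputable def toModP : Hom R R.modP where
  toAlgHom := Ideal.Quotient.mkₐ _ _
  res_comp _ := rfl

theorem natCast_p_modP : (p : R.modP) = 0 := by
  change (p : R ⧸ Ideal.span {(p : R)}) = 0
  rw [← map_natCast (Ideal.Quotient.mk _), Ideal.Quotient.eq_zero_iff_mem]
  exact Ideal.mem_span_singleton_self _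

theorem toModP_surjective : Function.Surjective R.toModP.toAlgHom :=
  Ideal.Quotient.mk_surjective

variable {R} in
/-- Morphisms to rings with `p = 0` factor through `R / pR`. -/
theorem Hom.exists_comp_toModP (f : Hom R R') (h : (p : R') = 0) :
    ∃ g : Hom R.modP R', g.comp R.toModP = f := by
  refine ⟨{ toAlgHom := Ideal.Quotient.liftₐ _ f.toAlgHom fun x hx => ?_, res_comp := ?_ },
    Hom.ext fun x => rfl⟩
  · obtain ⟨a, rfl⟩ := Ideal.mem_span_singleton'.mp hx
    rw [map_mul, map_natCast, h, mul_zero]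
  · intro x
    obtain ⟨x, rfl⟩ := R.toModP_surjective x
    exact f.res_comp x

theorem natCast_p_dual : (p : dual p k) = 0 := by
  change (p : DualNumber k) = 0
  refine TrivSqZeroExt.ext ?_ ?_ <;> simp

end ModP

end CoeffRing

/-! ### Lifts, their reductions and their base change -/

/-- The structure of a module over a coefficient ring on a vector space over the residue field. -/
@[reducible] noncomputable def CoeffRing.residueModule {p : ℕ} [Fact p.Prime] {k : Type u} [Field k]
    (R : CoeffRing p k) (V : Type*) [AddCommGroup V] [Module k V] : Module R V :=
  Module.compHom V (algebraMap R k)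

theorem CoeffRing.isScalarTower_residueModule {p : ℕ} [Fact p.Prime] {k : Type u} [Field k]
    (R : CoeffRing p k) (V : Type*) [AddCommGroup V] [Module k V] :
    letI := R.residueModule V
    IsScalarTower R k V :=
  letI := R.residueModule V
  ⟨fun r c v => by
    change (algebraMap R k r * c) • v = algebraMap R k r • c • v
    rw [mul_smul]⟩

namespace Lift

variable {p : ℕ} [Fact p.Prime] {k : Type u} [Field k] {G V : Type*} [Group G]
  [AddCommGroup V] [Module k V] {ρ : Representation k G V} {R R' R'' : CoeffRing p k}

/-- The reduction map of a lift. -/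
noncomputable def red (L : Lift ρ R) (x : L.carrier) : V := L.φ (1 ⊗ₜ[R] x)

theorem red_add (L : Lift ρ R) (x y : L.carrier) : L.red (x + y) = L.red x + L.red y := by
  rw [red, TensorProduct.tmul_add, map_add]; rfl

theorem red_smul (L : Lift ρ R) (r : R) (x : L.carrier) : L.red (r • x) = R.res r • L.red x := by
  rw [red, red, ← map_smul, ← TensorProduct.smul_tmul, TensorProduct.smul_tmul', Algebra.smul_def,
    smul_eq_mul]
  rfl

theorem φ_tmul (L : Lift ρ R) (c : k) (x : L.carrier) : L.φ (c ⊗ₜ[R] x) = c • L.red x := by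
  rw [red, ← map_smul, TensorProduct.smul_tmul', smul_eq_mul, mul_one]

theorem red_act (L : Lift ρ R) (g : G) (x : L.carrier) : L.red (L.act g x) = ρ g (L.red x) := by
  rw [red, red, ← L.φ_equivariant, LinearMap.baseChange_tmul]

theorem one_tmul_surjective (R : CoeffRing p k) (X : Type*) [AddCommGroup X] [Module R X]
    (z : k ⊗[R] X) : ∃ x : X, (1 : k) ⊗ₜ[R] x = z :=
  TensorProduct.mk_surjective R X k R.res_surjective z

theorem red_surjective (L : Lift ρ R) : Function.Surjective L.red := fun v => by
  obtain ⟨x, hx⟩ := one_tmul_surjective R L.carrier (L.φ.symm v)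
  exact ⟨x, by rw [red, hx, LinearEquiv.apply_symm_apply]⟩

/-- This is the identification of k ⊗ X with X/𝔪X, through k ≅ R/𝔪. -/
theorem mem_of_one_tmul_eq_zero (R : CoeffRing p k) {X : Type*} [AddCommGroup X] [Module R X]
    {x : X} (hx : (1 : k) ⊗ₜ[R] x = 0) :
    x ∈ (IsLocalRing.maximalIdeal R • ⊤ : Submodule R X) := by
  have hs : Function.Surjective (Algebra.linearMap R k) := R.res_surjective
  let e := (Algebra.linearMap R k).quotKerEquivOfSurjective hs
  have hker : LinearMap.ker (Algebra.linearMap R k) = IsLocalRing.maximalIdeal R := R.ker_res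
  have h1 : e.symm.toLinearMap.rTensor X ((1 : k) ⊗ₜ[R] x) = 0 := by rw [hx, map_zero]
  have h2 : e.symm 1 = Submodule.Quotient.mk 1 := by
    rw [LinearEquiv.symm_apply_eq]
    exact (map_one (algebraMap R k)).symm
  rw [LinearMap.rTensor_tmul, LinearEquiv.coe_coe, h2] at h1
  have h3 := congrArg (TensorProduct.quotTensorEquivQuotSMul X
    (LinearMap.ker (Algebra.linearMap R k))) h1
  rw [map_zero] at h3
  have h4 := (TensorProduct.quotTensorEquivQuotSMul_mk_tmul
    (LinearMap.ker (Algebra.linearMap R k)) (1 : R) x).symm.trans h3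
  rw [one_smul, Submodule.Quotient.mk_eq_zero, hker] at h4
  exact h4

theorem red_eq_zero (L : Lift ρ R) {x : L.carrier} (hx : L.red x = 0) :
    x ∈ (IsLocalRing.maximalIdeal R • ⊤ : Submodule R L.carrier) :=
  mem_of_one_tmul_eq_zero R (L.φ.map_eq_zero_iff.mp hx)

section Hom

variable [Module R V] [IsScalarTower R k V]

theorem res_smul (r : R) (v : V) : R.res r • v = r • v := algebraMap_smul k r v

/-- The reduction map of a lift as a linear map. -/
noncomputable def redHom (L : Lift ρ R) : L.carrier →ₗ[R] V where
  toFun := L.red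
  map_add' := L.red_add
  map_smul' r x := by rw [red_smul, res_smul, RingHom.id_apply]

theorem isReduction_redHom (L : Lift ρ R) : IsReduction L.redHom where
  surjective := L.red_surjective
  ker_le _ hx := L.red_eq_zero hx

/-- Bijectivity is automatic by Nakayama's lemma, so isomorphisms of lifts can be built from
one-sided data. -/
theorem iso_of_hom {L L' : Lift ρ R} (α : L.carrier →ₗ[R] L'.carrier)
    (hα : ∀ g x, α (L.act g x) = L'.act g (α x)) (hr : ∀ x, L'.red (α x) = L.red x) :
    L.Iso L' := by
  refine ⟨LinearEquiv.ofBijective α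
    (L.isReduction_redHom.bijective L'.isReduction_redHom α hr), hα, fun z => ?_⟩
  obtain ⟨x, rfl⟩ := one_tmul_surjective R _ z
  exact (hr x).symm

/-- A lift in the small universe from one in any universe. -/
theorem exists_of_isReduction {X : Type*} [AddCommGroup X] [Module R X] [Module.Finite R X]
    [Module.Projective R X] (act : Representation R G X) {q : X →ₗ[R] V} (hq : IsReduction q)
    (hact : ∀ g x, q (act g x) = ρ g (q x)) :
    ∃ (L : Lift ρ R) (ε : L.carrier ≃ₗ[R] X), (∀ g x, ε (L.act g x) = act g (ε x)) ∧
      ∀ x, q (ε x) = L.red x := by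
  have : Module.Free R X := Module.free_of_flat_of_isLocalRing
  -- The structure is transported to Rⁿ, which lies in the universe of `R` whatever the universe of
  -- X.
  let ε : (Fin (Module.finrank R X) → R) ≃ₗ[R] X := (Module.finBasis R X).equivFun.symm
  let f : (Fin (Module.finrank R X) → R) →ₗ[R] V := q ∘ₗ ε.toLinearMap
  have hinj : Function.Injective (f.liftBaseChange k) := by
    rw [injective_iff_map_eq_zero]
    intro z hz
    obtain ⟨x, rfl⟩ := one_tmul_surjective R _ z
    rw [LinearMap.liftBaseChange_tmul, one_smul] at hz
    have hx := Submodule.mem_map_of_mem (f := ε.symm.toLinearMap) (hq.ker_le _ hz)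
    rw [Submodule.map_smul'', LinearEquiv.coe_coe, LinearEquiv.coe_coe,
      LinearEquiv.symm_apply_apply] at hx
    refine Submodule.smul_induction_on hx (fun r hr y _ => ?_) fun x y hx hy => ?_
    · rw [← TensorProduct.smul_tmul, Algebra.smul_def, mul_one]
      have : algebraMap R k r = 0 := (R.res_eq_zero_iff r).mpr hr
      rw [this, TensorProduct.zero_tmul]
    · rw [TensorProduct.tmul_add, hx, hy, add_zero]
  have hsurj : Function.Surjective (f.liftBaseChange k) := fun v => by
    obtain ⟨x, rfl⟩ := hq.surjective v
    refine ⟨1 ⊗ₜ ε.symm x, ?_⟩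
    rw [LinearMap.liftBaseChange_tmul, one_smul]
    simp [f]
  refine ⟨{
    carrier := Fin (Module.finrank R X) → R
    act :=
      { toFun := fun g => ε.symm.toLinearMap ∘ₗ act g ∘ₗ ε.toLinearMap
        map_one' := LinearMap.ext fun x => by simp
        map_mul' := fun g h => LinearMap.ext fun x => by simp }
    φ := LinearEquiv.ofBijective (f.liftBaseChange k) ⟨hinj, hsurj⟩
    φ_equivariant := fun g z => ?_ }, ε, fun g x => ?_, fun x => ?_⟩
  · obtain ⟨x, rfl⟩ := one_tmul_surjective R _ z
    change f.liftBaseChange k (1 ⊗ₜ (ε.symm (act g (ε x)))) = ρ g (f.liftBaseChange k (1 ⊗ₜ x))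
    rw [LinearMap.liftBaseChange_tmul, LinearMap.liftBaseChange_tmul, one_smul, one_smul]
    change q (ε (ε.symm (act g (ε x)))) = _
    rw [LinearEquiv.apply_symm_apply, hact]
    rfl
  · change ε (ε.symm (act g (ε x))) = _
    rw [LinearEquiv.apply_symm_apply]
  · have h : f.liftBaseChange k ((1 : k) ⊗ₜ x) = f x := by
      rw [LinearMap.liftBaseChange_tmul, one_smul]
    exact h.symm

end Hom

theorem Iso.exists_hom {L L' : Lift ρ R} (h : L.Iso L') : ∃ α : L.carrier ≃ₗ[R] L'.carrier,
    (∀ g x, α (L.act g x) = L'.act g (α x)) ∧ ∀ x, L'.red (α x) = L.red x := by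
  obtain ⟨α, hα, hφ⟩ := h
  exact ⟨α, hα, fun x => (hφ (1 ⊗ₜ x)).symm⟩

theorem iso_of_hom' {L L' : Lift ρ R} (α : L.carrier →ₗ[R] L'.carrier)
    (hα : ∀ g x, α (L.act g x) = L'.act g (α x)) (hr : ∀ x, L'.red (α x) = L.red x) :
    L.Iso L' :=
  letI := R.residueModule V
  haveI := R.isScalarTower_residueModule V
  iso_of_hom α hα hr

theorem Iso.symm {L L' : Lift ρ R} (h : L.Iso L') : L'.Iso L := by
  obtain ⟨α, hα, hr⟩ := h.exists_hom
  refine iso_of_hom' α.symm.toLinearMap (fun g x => ?_) fun x => ?_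
  · rw [LinearEquiv.coe_coe, LinearEquiv.symm_apply_eq, hα, LinearEquiv.apply_symm_apply]
  · rw [LinearEquiv.coe_coe, ← hr, LinearEquiv.apply_symm_apply]

theorem Iso.trans {L L' L'' : Lift ρ R} (h : L.Iso L') (h' : L'.Iso L'') : L.Iso L'' := by
  obtain ⟨α, hα, hr⟩ := h.exists_hom
  obtain ⟨β, hβ, hs⟩ := h'.exists_hom
  refine iso_of_hom' (β.toLinearMap ∘ₗ α.toLinearMap) (fun g x => ?_) fun x => ?_
  · simp only [LinearMap.comp_apply, LinearEquiv.coe_coe, hα, hβ]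
  · simp only [LinearMap.comp_apply, LinearEquiv.coe_coe, hr, hs]

/-- The pure tensors in the base change of a lift. -/
noncomputable def mapMk (f : CoeffRing.Hom R R') (L : Lift ρ R) (r : R') (x : L.carrier) :
    (L.map f).carrier :=
  letI : Algebra R R' := f.toAlgHom.toRingHom.toAlgebra
  r ⊗ₜ[R] x

section MapMk

variable (f : CoeffRing.Hom R R') (L : Lift ρ R)

theorem act_mapMk (g : G) (r : R') (x : L.carrier) :
    (L.map f).act g (L.mapMk f r x) = L.mapMk f r (L.act g x) := rfl

theorem smul_mapMk (s r : R') (x : L.carrier) : s • L.mapMk f r x = L.mapMk f (s * r) x := rfl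

theorem mapMk_smul (s : R) (r : R') (x : L.carrier) :
    L.mapMk f r (s • x) = L.mapMk f (f.toAlgHom s * r) x :=
  letI : Algebra R R' := f.toAlgHom.toRingHom.toAlgebra
  (TensorProduct.smul_tmul s r x).symm

theorem mapMk_add (r : R') (x y : L.carrier) :
    L.mapMk f r (x + y) = L.mapMk f r x + L.mapMk f r y :=
  letI : Algebra R R' := f.toAlgHom.toRingHom.toAlgebra
  TensorProduct.tmul_add r x y

theorem mapMk_zero (r : R') : L.mapMk f r 0 = 0 :=
  letI : Algebra R R' := f.toAlgHom.toRingHom.toAlgebra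
  TensorProduct.tmul_zero _ r

theorem map_induction {motive : (L.map f).carrier → Prop} (z : (L.map f).carrier) (zero : motive 0)
    (mk : ∀ r x, motive (L.mapMk f r x)) (add : ∀ z w, motive z → motive w → motive (z + w)) :
    motive z :=
  letI : Algebra R R' := f.toAlgHom.toRingHom.toAlgebra
  TensorProduct.induction_on (motive := motive) z zero mk add

theorem red_mapMk (r : R') (x : L.carrier) :
    (L.map f).red (L.mapMk f r x) = R'.res r • L.red x := by
  let _ : Algebra R R' := f.toAlgHom.toRingHom.toAlgebra
  have : IsScalarTower R R' k := IsScalarTower.of_algebraMap_eq fun x => (f.res_comp x).symm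
  change L.φ (TensorProduct.AlgebraTensorModule.cancelBaseChange R R' k k L.carrier
    ((1 : k) ⊗ₜ[R'] (r ⊗ₜ[R] x))) = _
  rw [TensorProduct.AlgebraTensorModule.cancelBaseChange_tmul, φ_tmul, Algebra.smul_def, mul_one]
  rfl

/-- Maps out of the base change of a lift. -/
theorem exists_mapLift {Y : Type*} [AddCommGroup Y] [Module R' Y] (h : L.carrier →+ Y)
    (hh : ∀ r x, h (r • x) = f.toAlgHom r • h x) :
    ∃ α : (L.map f).carrier →ₗ[R'] Y, ∀ r x, α (L.mapMk f r x) = r • h x := by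
  let _ : Algebra R R' := f.toAlgHom.toRingHom.toAlgebra
  let _ : Module R Y := Module.compHom Y f.toAlgHom.toRingHom
  have : IsScalarTower R R' Y := ⟨fun r s y => mul_smul (f.toAlgHom r) s y⟩
  let h' : L.carrier →ₗ[R] Y := { h with map_smul' := hh }
  exact ⟨h'.liftBaseChange R', fun r x => LinearMap.liftBaseChange_tmul R' h' r x⟩

end MapMk

theorem Iso.map {L L' : Lift ρ R} (h : L.Iso L') (f : CoeffRing.Hom R R') :
    (L.map f).Iso (L'.map f) := by
  obtain ⟨α, hα, hr⟩ := h.exists_hom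
  obtain ⟨β, hβ⟩ := L.exists_mapLift f (Y := (L'.map f).carrier)
    { toFun := fun x => L'.mapMk f 1 (α x)
      map_zero' := by rw [map_zero, mapMk_zero]
      map_add' := fun x y => by rw [map_add, mapMk_add] }
    (fun r x => by
      change L'.mapMk f 1 (α (r • x)) = _ • L'.mapMk f 1 (α x)
      rw [map_smul, mapMk_smul, smul_mapMk])
  have hβ : ∀ r x, β (L.mapMk f r x) = L'.mapMk f r (α x) := fun r x => by
    rw [hβ]
    exact (smul_mapMk f L' _ _ _).trans (by rw [mul_one])
  refine iso_of_hom' β (fun g z => ?_) fun z => ?_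
  · refine L.map_induction f (motive := fun z => β ((L.map f).act g z) = (L'.map f).act g (β z))
      z ?_ (fun r x => ?_) fun z w hz hw => ?_
    · simp only [map_zero]
    · rw [act_mapMk, hβ, hβ, act_mapMk, hα]
    · simp only [map_add, hz, hw]
  · refine L.map_induction f (motive := fun z => (L'.map f).red (β z) = (L.map f).red z)
      z ?_ (fun r x => ?_) fun z w hz hw => ?_
    · rw [map_zero, red, red, TensorProduct.tmul_zero, TensorProduct.tmul_zero, map_zero, map_zero]
    · rw [hβ, red_mapMk, red_mapMk, hr]
    · rw [map_add, red_add, red_add, hz, hw]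

theorem map_comp_iso (L : Lift ρ R) (f : CoeffRing.Hom R R') (g : CoeffRing.Hom R' R'') :
    (L.map (g.comp f)).Iso ((L.map f).map g) := by
  obtain ⟨β, hβ⟩ := L.exists_mapLift (g.comp f) (Y := ((L.map f).map g).carrier)
    { toFun := fun x => (L.map f).mapMk g 1 (L.mapMk f 1 x)
      map_zero' := by rw [mapMk_zero, mapMk_zero]
      map_add' := fun x y => by rw [mapMk_add, mapMk_add] }
    (fun r x => by
      change (L.map f).mapMk g 1 (L.mapMk f 1 (r • x)) = _ • (L.map f).mapMk g 1 (L.mapMk f 1 x)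
      rw [mapMk_smul, ← smul_mapMk, mapMk_smul, smul_mapMk]
      rfl)
  have hβ : ∀ r x, β (L.mapMk (g.comp f) r x) = (L.map f).mapMk g r (L.mapMk f 1 x) := fun r x => by
    rw [hβ]
    exact (smul_mapMk g (L.map f) _ _ _).trans (by rw [mul_one])
  refine iso_of_hom' β (fun σ z => ?_) fun z => ?_
  · refine L.map_induction (g.comp f) (motive := fun z => β ((L.map (g.comp f)).act σ z) =
      ((L.map f).map g).act σ (β z)) z ?_ (fun r x => ?_) fun z w hz hw => ?_
    · simp only [map_zero]
    · rw [act_mapMk, hβ, hβ, act_mapMk, act_mapMk]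
    · simp only [map_add, hz, hw]
  · refine L.map_induction (g.comp f) (motive := fun z => ((L.map f).map g).red (β z) =
      (L.map (g.comp f)).red z) z ?_ (fun r x => ?_) fun z w hz hw => ?_
    · rw [map_zero, red, red, TensorProduct.tmul_zero, TensorProduct.tmul_zero, map_zero, map_zero]
    · rw [hβ, red_mapMk, red_mapMk, red_mapMk, map_one, one_smul]
    · rw [map_add, red_add, red_add, hz, hw]

end Lift

/-- On a lift of a module over a symmetric quotient of the group algebra, the group acts through
this quotient. -/
theorem GroupFrobenius.exists_module_of_isReduction {S G A R X V : Type*} [CommRing S] [Group G]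
    [Fintype G] [Ring A] [Algebra S A] (F : GroupFrobenius S G A) [CommRing R] [IsLocalRing R]
    [Algebra S R] [AddCommGroup X] [Module R X] [Module S X] [IsScalarTower S R X]
    [Module.Finite R X] [AddCommGroup V] [Module R V] [Module S V] [IsScalarTower S R V]
    [Module A V] [IsScalarTower S A V] (act : Representation R G X) {q : X →ₗ[R] V}
    (hq : IsReduction q) (hact : ∀ g x, q (act g x) = F.γ g • q x) :
    ∃ (_ : Module A X), IsScalarTower S A X ∧ SMulCommClass A R X ∧
      (∀ g x, F.γ g • x = act g x) ∧ ∀ (a : A) x, q (a • x) = a • q x := by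
  -- The dual bases force the action: a = ∑ t(g⁻¹a) g must act by ∑ t(g⁻¹a) act(g).
  let T : A →ₗ[S] Module.End R X :=
    { toFun := fun a => ∑ g, F.t (F.γ g⁻¹ * a) • act g
      map_add' := fun a b => by
        simp only [mul_add, map_add, add_smul, Finset.sum_add_distrib]
      map_smul' := fun s a => by
        simp only [mul_smul_comm, map_smul, smul_assoc, Finset.smul_sum, RingHom.id_apply] }
  have hT : ∀ a, T a = ∑ g, F.t (F.γ g⁻¹ * a) • act g := fun a => rfl
  have hγ : ∀ h a, T (F.γ h * a) = act h * T a := fun h a => by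
    rw [hT, hT, Finset.mul_sum]
    refine Fintype.sum_equiv (Equiv.mulLeft h⁻¹) _ _ fun g => ?_
    change _ = act h * F.t (F.γ (h⁻¹ * g)⁻¹ * a) • act (h⁻¹ * g)
    rw [mul_smul_comm, ← map_mul act, mul_inv_cancel_left, mul_inv_rev, inv_inv, map_mul F.γ,
      mul_assoc]
  have hmul : ∀ a b, T (a * b) = T a * T b := fun a b => by
    conv_lhs => rw [← F.dual a, Finset.sum_mul, map_sum]
    rw [hT a, Finset.sum_mul]
    refine Finset.sum_congr rfl fun g _ => ?_
    rw [smul_mul_assoc, map_smul, hγ, smul_mul_assoc]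
  have hq' : ∀ a x, q (T a x) = a • q x := fun a x => by
    rw [← F.dual_smul a (q x), hT, LinearMap.sum_apply, map_sum]
    refine Finset.sum_congr rfl fun g _ => ?_
    rw [LinearMap.smul_apply, ← algebraMap_smul R, map_smul, algebraMap_smul, hact]
  -- T(1) is idempotent and reduces to the identity of V, so it is bijective by Nakayama's lemma and
  -- therefore equal to 1. This is why a lift of a module in the block stays in the block.
  have hone : T 1 = 1 := by
    have hb := LinearMap.bijective_of_reduction_eq_id hq (T 1) fun x => by rw [hq', one_smul]
    ext x
    refine hb.1 ?_
    rw [← Module.End.mul_apply, ← hmul, one_mul]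
    rfl
  let T' : A →+* Module.End R X :=
    { toFun := T, map_one' := hone, map_mul' := hmul, map_zero' := map_zero T,
      map_add' := map_add T }
  let _ : Module A X := Module.compHom X T'
  have hsmul : ∀ (a : A) (x : X), a • x = T a x := fun _ _ => rfl
  refine ⟨inferInstance, ⟨fun s a x => ?_⟩, ⟨fun a r x => ?_⟩, fun g x => ?_, fun a x => ?_⟩
  · rw [hsmul, hsmul, map_smul, LinearMap.smul_apply]
  · rw [hsmul, hsmul, map_smul]
  · rw [hsmul, ← mul_one (F.γ g), hγ, hone, mul_one]
  · rw [hsmul, hq']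

/-! ### Versality and its transport -/

section Versal

variable {p : ℕ} [Fact p.Prime] {k : Type u} [Field k] {G V : Type*} [Group G]
  [AddCommGroup V] [Module k V] {ρ : Representation k G V} {R R' : CoeffRing p k}

/-- Versality with respect to the coefficient rings that satisfy `P`. -/
structure IsVersalWithin (P : CoeffRing p k → Prop) (U : Lift ρ R) : Prop where
  mem : P R
  exists_hom : ∀ (R' : CoeffRing p k) (L : Lift ρ R'), P R' →
    ∃ f : CoeffRing.Hom R R', (U.map f).Iso L
  tangent_unique : ∀ f g : CoeffRing.Hom R (CoeffRing.dual p k), (U.map f).Iso (U.map g) → f = g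

theorem IsVersalDeformation.isVersalWithin {P : CoeffRing p k → Prop} {U : Lift ρ R} (hP : P R)
    (h : IsVersalDeformation ρ R U) : IsVersalWithin P U :=
  ⟨hP, fun R' L _ => h.exists_hom R' L, h.tangent_unique⟩

theorem IsVersalWithin.isVersalDeformation {P : CoeffRing p k → Prop} {U : Lift ρ R}
    (hP : ∀ R, P R) (h : IsVersalWithin P U) : IsVersalDeformation ρ R U :=
  ⟨fun R' L => h.exists_hom R' L (hP R'), h.tangent_unique⟩

/-- Base change along f ∘ φ and along f gives isomorphic lifts over k[ε], where the morphism is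
unique. -/
theorem IsVersalWithin.comp_eq {P : CoeffRing p k → Prop} {U : Lift ρ R}
    (h : IsVersalWithin P U) {φ : CoeffRing.Hom R R} (hφ : (U.map φ).Iso U)
    (f : CoeffRing.Hom R (CoeffRing.dual p k)) : f.comp φ = f :=
  h.tangent_unique _ _ ((U.map_comp_iso φ f).trans (hφ.map f))

/-- Versal deformation rings are unique up to isomorphism. -/
theorem IsVersalWithin.ring_iso [CharP k p] [PerfectRing k p] {P : CoeffRing p k → Prop}
    {U : Lift ρ R} {U' : Lift ρ R'} (h : IsVersalWithin P U) (h' : IsVersalWithin P U') :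
    R.Iso R' := by
  obtain ⟨f, hf⟩ := h.exists_hom R' U' h'.mem
  obtain ⟨g, hg⟩ := h'.exists_hom R U h.mem
  -- The composite g ∘ f sends U to a lift isomorphic to U, so it fixes all tangent vectors.
  have h1 := CoeffRing.Hom.bijective_of_comp_dual (g.comp f)
    (h.comp_eq ((U.map_comp_iso f g).trans ((hf.map g).trans hg)))
  have h2 := CoeffRing.Hom.bijective_of_comp_dual (f.comp g)
    (h'.comp_eq ((U'.map_comp_iso g f).trans ((hg.map f).trans hf)))
  have hb : Function.Bijective f.toAlgHom :=
    ⟨Function.Injective.of_comp (f := g.toAlgHom) h1.1,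
      Function.Surjective.of_comp (g := g.toAlgHom) h2.2⟩
  exact ⟨AlgEquiv.ofBijective f.toAlgHom hb, f.res_comp⟩

/-- A morphism to a ring with p = 0 factors through R/pR, and R → R/pR is surjective, so neither
existence nor uniqueness is lost. -/
theorem IsVersalDeformation.modP [CharP k p] {U : Lift ρ R} (h : IsVersalDeformation ρ R U) :
    IsVersalWithin (fun R => (p : R) = 0) (U.map R.toModP) where
  mem := R.natCast_p_modP
  exists_hom R' L hR' := by
    obtain ⟨f, hf⟩ := h.exists_hom R' L
    obtain ⟨g, rfl⟩ := f.exists_comp_toModP hR'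
    exact ⟨g, (U.map_comp_iso _ _).symm.trans hf⟩
  tangent_unique f g hfg := by
    have := h.tangent_unique (f.comp R.toModP) (g.comp R.toModP)
      ((U.map_comp_iso _ _).trans (hfg.trans (U.map_comp_iso _ _).symm))
    refine CoeffRing.Hom.ext fun x => ?_
    obtain ⟨x, rfl⟩ := R.toModP_surjective x
    exact congrArg (fun h : CoeffRing.Hom R (CoeffRing.dual p k) => h.toAlgHom x) this

/-- A natural bijection between the deformations of two modules, as a relation on lifts. -/
structure LiftCorrespondence (P : CoeffRing p k → Prop) {G' V' : Type*} [Group G']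
    [AddCommGroup V'] [Module k V'] (ρ : Representation k G V) (ρ' : Representation k G' V') where
  /-- the relation -/
  rel : ∀ {R : CoeffRing p k}, Lift ρ R → Lift ρ' R → Prop
  left_total : ∀ {R : CoeffRing p k} (L : Lift ρ R), P R → ∃ L', rel L L'
  right_total : ∀ {R : CoeffRing p k} (L' : Lift ρ' R), P R → ∃ L, rel L L'
  iso_iff : ∀ {R : CoeffRing p k} {L₁ L₂ : Lift ρ R} {L₁' L₂' : Lift ρ' R}, P R →
    rel L₁ L₁' → rel L₂ L₂' → (L₁.Iso L₂ ↔ L₁'.Iso L₂')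
  map : ∀ {R R' : CoeffRing p k} {L : Lift ρ R} {L' : Lift ρ' R} (f : CoeffRing.Hom R R'),
    rel L L' → rel (L.map f) (L'.map f)

namespace LiftCorrespondence

variable {P : CoeffRing p k → Prop} {G' V' : Type*} [Group G'] [AddCommGroup V'] [Module k V']
  {ρ' : Representation k G' V'}

/-- The inverse correspondence. -/
def symm (C : LiftCorrespondence P ρ ρ') : LiftCorrespondence P ρ' ρ where
  rel L' L := C.rel L L'
  left_total := C.right_total
  right_total := C.left_total
  iso_iff hP h h' := (C.iso_iff hP h h').symm
  map f h := C.map f h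

/-- The ring and the classifying morphisms stay the same. Uniqueness on tangent vectors needs k[ε]
to be among the admissible rings, hence `hd`. -/
theorem isVersalWithin (C : LiftCorrespondence P ρ ρ') (hd : P (CoeffRing.dual p k))
    {U : Lift ρ R} (h : IsVersalWithin P U) : ∃ U' : Lift ρ' R, IsVersalWithin P U' := by
  obtain ⟨U', hU⟩ := C.left_total U h.mem
  refine ⟨U', h.mem, fun R' L' hR' => ?_, fun f g hfg => ?_⟩
  · obtain ⟨L, hL⟩ := C.right_total L' hR'
    obtain ⟨f, hf⟩ := h.exists_hom R' L hR'
    exact ⟨f, (C.iso_iff hR' (C.map f hU) hL).mp hf⟩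
  · exact h.tangent_unique f g ((C.iso_iff hd (C.map f hU) (C.map g hU)).mpr hfg)

end LiftCorrespondence

end Versal

/-! ### The correspondence of lifts given by M ⊗_A - -/

/-- The action of a group on a module over a quotient of its group algebra. -/
def GroupFrobenius.rep {S G A : Type*} [CommRing S] [Group G] [Fintype G] [Ring A] [Algebra S A]
    (F : GroupFrobenius S G A) (R X : Type*) [CommRing R] [AddCommGroup X] [Module R X] [Module A X]
    [SMulCommClass A R X] : Representation R G X where
  toFun g :=
    { toFun := fun x => F.γ g • x
      map_add' := smul_add _
      map_smul' := fun r x => smul_comm _ r x }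
  map_one' := LinearMap.ext fun x => by
    change F.γ 1 • x = x
    rw [map_one, one_smul]
  map_mul' g h := LinearMap.ext fun x => by
    change F.γ (g * h) • x = F.γ g • F.γ h • x
    rw [map_mul, mul_smul]

/-- An identification of `V'` with `M ⊗_A V`. -/
structure TensorModel {k : Type*} [Field k] {S H B V' : Type*} [CommRing S] [Group H] [Fintype H]
    [Ring B] [Algebra S B] (A : Type*) [Ring A] (F' : GroupFrobenius S H B) (M V : Type*)
    [AddCommGroup M] [Module S M] [Module B M] [Module Aᵐᵒᵖ M] [IsScalarTower S B M]
    [SMulCommClass B Aᵐᵒᵖ M] [AddCommGroup V] [Module k V] [Module S V] [Module A V]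
    [AddCommGroup V'] [Module k V'] (ρ' : Representation k H V') where
  /-- the identification -/
  e : TensorOver S A M V ≃+ V'
  e_smul : ∀ (c : k) m v, e (TensorOver.mk S A m (c • v)) = c • e (TensorOver.mk S A m v)
  e_act : ∀ h z, e (F'.γ h • z) = ρ' h (e z)

section TensorRel

variable {p : ℕ} [Fact p.Prime] {k : Type u} [Field k]
  {S G A H B M V V' : Type*} [CommRing S] [Algebra (WittVector p k) S] [Algebra S k]
  [IsScalarTower (WittVector p k) S k]
  [Group G] [Fintype G] [Ring A] [Algebra S A] [Group H] [Fintype H] [Ring B] [Algebra S B]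
  {F : GroupFrobenius S G A} {F' : GroupFrobenius S H B}
  [AddCommGroup M] [Module S M] [Module B M] [Module Aᵐᵒᵖ M]
  [IsScalarTower S B M] [IsScalarTower S Aᵐᵒᵖ M] [SMulCommClass B Aᵐᵒᵖ M]
  [AddCommGroup V] [Module k V] [Module S V] [IsScalarTower S k V] [Module A V]
  [IsScalarTower S A V] [SMulCommClass A k V]
  [AddCommGroup V'] [Module k V']
  {ρ : Representation k G V} {ρ' : Representation k H V'} {R : CoeffRing p k}

/-- The equivalence of `V'` with `M ⊗_A V` is linear over coefficient rings. -/
noncomputable def TensorModel.equiv (E : TensorModel A F' M V ρ') (R : CoeffRing p k) [Algebra S R]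
    [Module R V] [IsScalarTower R k V] [IsScalarTower S R V] [SMulCommClass A R V]
    [Module R V'] [IsScalarTower R k V'] : TensorOver S A M V ≃ₗ[R] V' where
  __ := E.e
  map_smul' r z := by
    change E.e (r • z) = r • E.e z
    induction z using TensorOver.induction_on with
    | zero => simp only [smul_zero, map_zero]
    | add x y hx hy => simp only [smul_add, map_add, hx, hy]
    | mk m v =>
      rw [TensorOver.coeff_smul_mk, ← algebraMap_smul k r v, E.e_smul, algebraMap_smul]

variable (F) in
/-- The lift `L'` of `M ⊗_A V` is isomorphic to `M ⊗_A L`, expressed by a balanced pairing. -/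
def TensorRel (E : TensorModel A F' M V ρ') (L : Lift ρ R) (L' : Lift ρ' R) : Prop :=
  -- The conditions mention only group actions and Witt vector scalars. No `S`-algebra structure on
  -- R and no `A`-module structure on the lift has to be chosen, so base change is unconditional.
  ∃ β : M →+ (L.carrier →ₗ[R] L'.carrier),
    (∀ m g x, β (op (F.γ g) • m) x = β m (L.act g x)) ∧
    (∀ m h x, β (F'.γ h • m) x = L'.act h (β m x)) ∧
    (∀ (w : WittVector p k) m x,
      β (algebraMap _ S w • m) x = algebraMap _ R w • β m x) ∧
    ∀ m x, L'.red (β m x) = E.e (TensorOver.mk S A m (L.red x))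

theorem TensorRel.map {E : TensorModel A F' M V ρ'} {L : Lift ρ R} {L' : Lift ρ' R}
    (h : TensorRel F E L L') {R' : CoeffRing p k} (f : CoeffRing.Hom R R') :
    TensorRel F E (L.map f) (L'.map f) := by
  obtain ⟨β, h1, h2, h3, h4⟩ := h
  have hex : ∀ m : M, ∃ α : (L.map f).carrier →ₗ[R'] (L'.map f).carrier,
      ∀ r x, α (L.mapMk f r x) = L'.mapMk f r (β m x) := fun m => by
    obtain ⟨α, hα⟩ := L.exists_mapLift f (Y := (L'.map f).carrier)
      { toFun := fun x => L'.mapMk f 1 (β m x)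
        map_zero' := by rw [map_zero, Lift.mapMk_zero]
        map_add' := fun x y => by rw [map_add, Lift.mapMk_add] }
      (fun r x => by
        change L'.mapMk f 1 (β m (r • x)) = _ • L'.mapMk f 1 (β m x)
        rw [map_smul, Lift.mapMk_smul, Lift.smul_mapMk])
    refine ⟨α, fun r x => ?_⟩
    rw [hα]
    exact (Lift.smul_mapMk f L' _ _ _).trans (by rw [mul_one])
  choose α hα using hex
  have hext : ∀ {a b : (L.map f).carrier →+ (L'.map f).carrier},
      (∀ r x, a (L.mapMk f r x) = b (L.mapMk f r x)) → ∀ z, a z = b z := fun {a b} hab z =>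
    L.map_induction f (motive := fun z => a z = b z) z (by rw [map_zero, map_zero]) hab
      fun z w hz hw => by rw [map_add, map_add, hz, hw]
  refine ⟨{ toFun := α, map_zero' := ?_, map_add' := fun m m' => ?_ }, fun m g z => ?_,
    fun m h z => ?_, fun w m z => ?_, fun m z => ?_⟩
  · refine LinearMap.ext (hext (a := (α 0).toAddMonoidHom) (b := 0) fun r x => ?_)
    change α 0 _ = 0
    rw [hα, map_zero, LinearMap.zero_apply, Lift.mapMk_zero]
  · refine LinearMap.ext (hext (a := (α (m + m')).toAddMonoidHom)
      (b := (α m + α m').toAddMonoidHom) fun r x => ?_)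
    change α (m + m') _ = α m _ + α m' _
    rw [hα, hα, hα, map_add, LinearMap.add_apply, Lift.mapMk_add]
  · refine hext (a := (α (op (F.γ g) • m)).toAddMonoidHom)
      (b := (α m).toAddMonoidHom.comp ((L.map f).act g).toAddMonoidHom) (fun r x => ?_) z
    change α _ (L.mapMk f r x) = α m ((L.map f).act g (L.mapMk f r x))
    rw [Lift.act_mapMk, hα, hα, h1]
  · refine hext (a := (α (F'.γ h • m)).toAddMonoidHom)
      (b := ((L'.map f).act h).toAddMonoidHom.comp (α m).toAddMonoidHom) (fun r x => ?_) z
    change α _ (L.mapMk f r x) = (L'.map f).act h (α m (L.mapMk f r x))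
    rw [hα, hα, Lift.act_mapMk, h2]
  · refine hext (a := (α (algebraMap _ S w • m)).toAddMonoidHom)
      (b := (algebraMap _ R' w • α m).toAddMonoidHom) (fun r x => ?_) z
    change α _ (L.mapMk f r x) = algebraMap _ R' w • α m (L.mapMk f r x)
    rw [hα, hα, h3, Lift.mapMk_smul, AlgHom.commutes]
    rfl
  · refine L.map_induction f (motive := fun z => (L'.map f).red (α m z) =
      E.e (TensorOver.mk S A m ((L.map f).red z))) z ?_ (fun r x => ?_) fun z w hz hw => ?_
    · have hz : (L.map f).red 0 = 0 := by
        rw [Lift.red, TensorProduct.tmul_zero, map_zero]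
      rw [map_zero, hz, Lift.red, TensorProduct.tmul_zero, map_zero, ← zero_smul k (0 : V),
        E.e_smul, zero_smul]
    · rw [hα, Lift.red_mapMk, Lift.red_mapMk, h4, E.e_smul]
    · rw [map_add, Lift.red_add, hz, hw, Lift.red_add, TensorOver.mk_add, map_add]

section Instances

variable [Algebra S R] [IsScalarTower (WittVector p k) S R]
  [Module R V] [IsScalarTower R k V] [IsScalarTower S R V] [SMulCommClass A R V]

section

variable {L : Lift ρ R} {L' : Lift ρ' R} [Module S L.carrier] [IsScalarTower S R L.carrier]
  [Module A L.carrier] [IsScalarTower S A L.carrier] [SMulCommClass A R L.carrier]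

/-- The pairing factors through M ⊗_A L because group elements span A. The induced map is compatible
with the reductions, hence bijective by Nakayama's lemma. -/
theorem TensorRel.exists_equiv (hS : Function.Surjective (algebraMap (WittVector p k) S))
    [Module.Finite Aᵐᵒᵖ M] [Module.Projective Aᵐᵒᵖ M] {E : TensorModel A F' M V ρ'}
    (h : TensorRel F E L L') (hγ : ∀ g x, F.γ g • x = L.act g x)
    (hq : ∀ (a : A) x, L.redHom (a • x) = a • L.redHom x) :
    ∃ Φ : TensorOver S A M L.carrier ≃ₗ[R] L'.carrier,
      (∀ h z, Φ (F'.γ h • z) = L'.act h (Φ z)) ∧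
      ∀ z, L'.red (Φ z) = E.e (TensorOver.coeffMap M L.redHom hq z) := by
  obtain ⟨β, h1, h2, h3, h4⟩ := h
  let _ : Module S L'.carrier := Module.compHom L'.carrier (algebraMap S R)
  have : IsScalarTower S R L'.carrier := IsScalarTower.of_algebraMap_smul fun _ _ => rfl
  have hβS : ∀ (s : S) m x, β (s • m) x = s • β m x := fun s m x => by
    obtain ⟨w, rfl⟩ := hS s
    rw [h3, IsScalarTower.algebraMap_apply (WittVector p k) S R, algebraMap_smul]
  let β' : M →ₗ[S] L.carrier →ₗ[R] L'.carrier :=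
    { toFun := β, map_add' := map_add β, map_smul' := fun s m => LinearMap.ext fun x => hβS s m x }
  have hbal : ∀ m (a : A) x, β' (op a • m) x = β' m (a • x) := fun m a x => by
    induction a using F.induction_on with
    | zero => simp only [MulOpposite.op_zero, zero_smul, map_zero, LinearMap.zero_apply]
    | add a b ha hb =>
      simp only [MulOpposite.op_add, add_smul, map_add, LinearMap.add_apply, ha, hb]
    | smul s a ha =>
      rw [MulOpposite.op_smul, smul_assoc, map_smul, LinearMap.smul_apply, ha, smul_assoc,
        ← algebraMap_smul R s (a • x), map_smul (β' m), algebraMap_smul]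
    | gamma g =>
      rw [hγ]
      exact h1 m g x
  let Φ := TensorOver.coeffLift β' hbal
  have hΦr : ∀ z, L'.red (Φ z) = E.e (TensorOver.coeffMap M L.redHom hq z) := fun z => by
    induction z using TensorOver.induction_on with
    | zero => rw [map_zero, map_zero, map_zero, Lift.red, TensorProduct.tmul_zero, map_zero]
    | add x y hx hy => rw [map_add, Lift.red_add, hx, hy, map_add, map_add]
    | mk m x => exact h4 m x
  let _ : Module R V' := R.residueModule V'
  have : IsScalarTower R k V' := R.isScalarTower_residueModule V'
  have hbij : Function.Bijective Φ := by
    refine IsReduction.bijective (q := (E.equiv R).toLinearMap ∘ₗ TensorOver.coeffMap M L.redHom hq)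
      (q' := L'.redHom) ⟨(E.equiv R).surjective.comp
        (TensorOver.isReduction_coeffMap M L.isReduction_redHom hq).surjective, fun z hz =>
        (TensorOver.isReduction_coeffMap M L.isReduction_redHom hq).ker_le z
          ((E.equiv R).map_eq_zero_iff.mp hz)⟩ L'.isReduction_redHom Φ hΦr
  refine ⟨LinearEquiv.ofBijective Φ hbij, fun h z => ?_, hΦr⟩
  change Φ _ = L'.act h (Φ z)
  induction z using TensorOver.induction_on with
  | zero => simp only [smul_zero, map_zero]
  | add x y hx hy => simp only [smul_add, map_add, hx, hy]
  | mk m x => exact h2 m h x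

end

theorem Lift.exists_module (hρ : ∀ g v, ρ g v = F.γ g • v) (L : Lift ρ R) [Module S L.carrier]
    [IsScalarTower S R L.carrier] :
    ∃ (_ : Module A L.carrier), IsScalarTower S A L.carrier ∧ SMulCommClass A R L.carrier ∧
      (∀ g x, F.γ g • x = L.act g x) ∧ ∀ (a : A) x, L.redHom (a • x) = a • L.redHom x :=
  F.exists_module_of_isReduction L.act L.isReduction_redHom fun g x => by
    rw [← hρ]; exact L.red_act g x

end Instances

end TensorRel

section TensorCorrespondence

variable {p : ℕ} [Fact p.Prime] {k : Type u} [Field k]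
  {S G A H B M V V' : Type*} {N : Type v} [CommRing S] [Algebra (WittVector p k) S] [Algebra S k]
  [IsScalarTower (WittVector p k) S k]
  [Group G] [Fintype G] [Ring A] [Algebra S A] [Group H] [Fintype H] [Ring B] [Algebra S B]
  {F : GroupFrobenius S G A} {F' : GroupFrobenius S H B}
  [AddCommGroup M] [Module S M] [Module B M] [Module Aᵐᵒᵖ M]
  [IsScalarTower S B M] [IsScalarTower S Aᵐᵒᵖ M] [SMulCommClass B Aᵐᵒᵖ M]
  [AddCommGroup N] [Module S N] [Module A N] [Module Bᵐᵒᵖ N]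
  [IsScalarTower S A N] [IsScalarTower S Bᵐᵒᵖ N] [SMulCommClass A Bᵐᵒᵖ N]
  [AddCommGroup V] [Module k V] [Module S V] [IsScalarTower S k V] [Module A V]
  [IsScalarTower S A V] [SMulCommClass A k V]
  [AddCommGroup V'] [Module k V']
  {ρ : Representation k G V} {ρ' : Representation k H V'} {R : CoeffRing p k}

section Instances

variable [Algebra S R] [IsScalarTower (WittVector p k) S R]
  [Module R V] [IsScalarTower R k V] [IsScalarTower S R V] [SMulCommClass A R V]

theorem TensorRel.of_hom {E : TensorModel A F' M V ρ'} {L : Lift ρ R} {L' : Lift ρ' R}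
    [Module S L.carrier] [IsScalarTower S R L.carrier]
    [Module A L.carrier] [IsScalarTower S A L.carrier] [SMulCommClass A R L.carrier]
    (hγ : ∀ g x, F.γ g • x = L.act g x) (hq : ∀ (a : A) x, L.redHom (a • x) = a • L.redHom x)
    (f : TensorOver S A M L.carrier →ₗ[R] L'.carrier)
    (hf : ∀ h z, f (F'.γ h • z) = L'.act h (f z))
    (hr : ∀ z, L'.red (f z) = E.e (TensorOver.coeffMap M L.redHom hq z)) : TensorRel F E L L' := by
  refine ⟨{ toFun := fun m => f ∘ₗ TensorOver.mkHom R S A M L.carrier m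
            map_zero' := by rw [map_zero, LinearMap.comp_zero]
            map_add' := fun m m' => by rw [map_add, LinearMap.comp_add] },
    fun m g x => ?_, fun m h x => hf h (TensorOver.mk S A m x), fun w m x => ?_,
    fun m x => hr (TensorOver.mk S A m x)⟩
  · change f (TensorOver.mk S A _ x) = f (TensorOver.mk S A m _)
    rw [TensorOver.op_smul_tmul, hγ]
  · change f (TensorOver.mk S A _ x) = _ • f (TensorOver.mk S A m x)
    rw [← TensorOver.smul_mk_left, TensorOver.smul_mk_right,
      ← algebraMap_smul R (algebraMap (WittVector p k) S w) x, ← TensorOver.coeff_smul_mk, map_smul,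
      ← IsScalarTower.algebraMap_apply]

theorem TensorRel.exists_right (hρ : ∀ g v, ρ g v = F.γ g • v) [Module.Finite Aᵐᵒᵖ M]
    [Module.Projective Aᵐᵒᵖ M] (E : TensorModel A F' M V ρ') (L : Lift ρ R) :
    ∃ L', TensorRel F E L L' := by
  let _ : Module S L.carrier := Module.compHom L.carrier (algebraMap S R)
  have : IsScalarTower S R L.carrier := IsScalarTower.of_algebraMap_smul fun _ _ => rfl
  obtain ⟨_, _, _, hγ, hq⟩ := L.exists_module hρ
  let _ : Module R V' := R.residueModule V'
  have : IsScalarTower R k V' := R.isScalarTower_residueModule V'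
  have hred := TensorOver.isReduction_coeffMap (S := S) M L.isReduction_redHom hq
  obtain ⟨L', ε, hε, hεr⟩ := Lift.exists_of_isReduction (ρ := ρ')
    (F'.rep R (TensorOver S A M L.carrier))
    (q := (E.equiv R).toLinearMap ∘ₗ TensorOver.coeffMap M L.redHom hq)
    ⟨(E.equiv R).surjective.comp hred.surjective, fun z hz =>
      hred.ker_le z ((E.equiv R).map_eq_zero_iff.mp hz)⟩ fun h z => by
        change E.e (TensorOver.coeffMap M L.redHom hq (F'.γ h • z)) = _
        rw [TensorOver.coeffMap_smul, E.e_act]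
        rfl
  refine ⟨L', TensorRel.of_hom hγ hq ε.symm.toLinearMap (fun h z => ?_) fun z => ?_⟩
  · rw [LinearEquiv.coe_coe, LinearEquiv.symm_apply_eq, hε, LinearEquiv.apply_symm_apply]
    rfl
  · rw [← hεr, LinearEquiv.coe_coe, LinearEquiv.apply_symm_apply]
    rfl

/-- Essential surjectivity: the summand of N ⊗ L' that lifts V is the required lift, after transport
to a free module Rⁿ. -/
theorem TensorRel.exists_left (hρ : ∀ g v, ρ g v = F.γ g • v)
    (D : F.SplitTrace (TensorOver S B N M)) (D' : F'.SplitTrace (TensorOver S A M N))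
    [Module.Finite Aᵐᵒᵖ M] [Module.Projective Aᵐᵒᵖ M] [Module.Projective B M]
    [Module.Finite Bᵐᵒᵖ N] [Module.Projective Bᵐᵒᵖ N]
    (E : TensorModel A F' M V ρ') (L' : Lift ρ' R) :
    ∃ L : Lift ρ R, TensorRel F E L L' := by
  let _ : Module S L'.carrier := Module.compHom L'.carrier (algebraMap S R)
  have : IsScalarTower S R L'.carrier := IsScalarTower.of_algebraMap_smul fun _ _ => rfl
  let _ : Module R V' := R.residueModule V'
  have : IsScalarTower R k V' := R.isScalarTower_residueModule V'
  let q : L'.carrier →ₗ[R] TensorOver S A M V := (E.equiv R).symm.toLinearMap ∘ₗ L'.redHom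
  have hqE : ∀ x, E.e (q x) = L'.red x := fun x => (E.equiv R).apply_symm_apply _
  have hq : IsReduction q := ⟨(E.equiv R).symm.surjective.comp L'.red_surjective, fun z hz =>
    L'.red_eq_zero ((E.equiv R).symm.map_eq_zero_iff.mp hz)⟩
  obtain ⟨_, _, _, hγ', hqB⟩ := F'.exists_module_of_isReduction L'.act hq fun h x =>
    E.e.injective (by rw [E.e_act, hqE, hqE, L'.red_act])
  obtain ⟨X, _, _, _, _, _, _, _, _, _, j, π, hjA, hπ, hπA, hj⟩ := D.exists_summand
    (fun r hr v => by
      rw [← algebraMap_smul k r v]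
      have : algebraMap R k r = 0 := (R.res_eq_zero_iff r).mpr hr
      rw [this, zero_smul]) hq hqB
  obtain ⟨f, hfB, hfq⟩ := D.exists_map_of_summand D' hq hqB j π hjA hπA hj
  obtain ⟨L, ε, hε, hεr⟩ := Lift.exists_of_isReduction (ρ := ρ) (F.rep R X) hπ fun g x => by
    rw [hρ]
    exact hπA _ x
  let _ : Module S L.carrier := Module.compHom L.carrier (algebraMap S R)
  have : IsScalarTower S R L.carrier := IsScalarTower.of_algebraMap_smul fun _ _ => rfl
  obtain ⟨_, _, _, hγ, hqA⟩ := L.exists_module hρ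
  have hεA : ∀ (a : A) x, ε.toLinearMap (a • x) = a • ε.toLinearMap x :=
    F.map_smul_of_map_gamma_smul ε.toLinearMap.toAddMonoidHom
      (fun s x => (ε.toLinearMap.restrictScalars S).map_smul s x) fun g x => by
        rw [hγ]
        exact hε g x
  refine ⟨L, TensorRel.of_hom hγ hqA (f ∘ₗ TensorOver.coeffMap M ε.toLinearMap hεA)
    (fun h z => ?_) fun z => ?_⟩
  · rw [← hγ', LinearMap.comp_apply, LinearMap.comp_apply, TensorOver.coeffMap_smul, hfB]
  · rw [← hqE, LinearMap.comp_apply]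
    refine congrArg E.e ((hfq _).trans ?_)
    induction z using TensorOver.induction_on with
    | zero => simp only [map_zero]
    | add x y hx hy => simp only [map_add, hx, hy]
    | mk m x =>
      rw [TensorOver.coeffMap_mk, TensorOver.coeffMap_mk, TensorOver.coeffMap_mk]
      exact congrArg _ (hεr x)

/-- One direction is functoriality of M ⊗ -; the other pulls a map back through N ⊗ - and the
splitting of N ⊗ M. -/
theorem TensorRel.iso_iff (hS : Function.Surjective (algebraMap (WittVector p k) S))
    (hρ : ∀ g v, ρ g v = F.γ g • v) (D : F.SplitTrace (TensorOver S B N M))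
    [Module.Finite Aᵐᵒᵖ M] [Module.Projective Aᵐᵒᵖ M]
    {E : TensorModel A F' M V ρ'} {L₁ L₂ : Lift ρ R} {L₁' L₂' : Lift ρ' R}
    (h₁ : TensorRel F E L₁ L₁') (h₂ : TensorRel F E L₂ L₂') : L₁.Iso L₂ ↔ L₁'.Iso L₂' := by
  let _ : Module S L₁.carrier := Module.compHom L₁.carrier (algebraMap S R)
  have : IsScalarTower S R L₁.carrier := IsScalarTower.of_algebraMap_smul fun _ _ => rfl
  obtain ⟨_, _, _, hγ₁, hq₁⟩ := L₁.exists_module hρ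
  let _ : Module S L₂.carrier := Module.compHom L₂.carrier (algebraMap S R)
  have : IsScalarTower S R L₂.carrier := IsScalarTower.of_algebraMap_smul fun _ _ => rfl
  obtain ⟨_, _, _, hγ₂, hq₂⟩ := L₂.exists_module hρ
  obtain ⟨Φ₁, hΦ₁, hr₁⟩ := h₁.exists_equiv hS hγ₁ hq₁
  obtain ⟨Φ₂, hΦ₂, hr₂⟩ := h₂.exists_equiv hS hγ₂ hq₂
  refine ⟨fun h => ?_, fun h => ?_⟩
  · obtain ⟨α, hα, hr⟩ := h.exists_hom
    have hαA : ∀ (a : A) x, α.toLinearMap (a • x) = a • α.toLinearMap x :=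
      F.map_smul_of_map_gamma_smul α.toLinearMap.toAddMonoidHom
        (fun s x => (α.toLinearMap.restrictScalars S).map_smul s x) fun g x => by
          rw [hγ₁, hγ₂]
          exact hα g x
    refine Lift.iso_of_hom' (Φ₂.toLinearMap ∘ₗ TensorOver.coeffMap M α.toLinearMap hαA ∘ₗ
      Φ₁.symm.toLinearMap) (fun g x => ?_) fun x => ?_
    · obtain ⟨z, rfl⟩ := Φ₁.surjective x
      rw [← hΦ₁]
      simp only [LinearMap.comp_apply, LinearEquiv.coe_coe, LinearEquiv.symm_apply_apply,
        TensorOver.coeffMap_smul, hΦ₂]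
    · obtain ⟨z, rfl⟩ := Φ₁.surjective x
      simp only [LinearMap.comp_apply, LinearEquiv.coe_coe, LinearEquiv.symm_apply_apply, hr₁, hr₂]
      congr 1
      induction z using TensorOver.induction_on with
      | zero => simp only [map_zero]
      | add x y hx hy => simp only [map_add, hx, hy]
      | mk m x =>
        rw [TensorOver.coeffMap_mk, TensorOver.coeffMap_mk, TensorOver.coeffMap_mk]
        exact congrArg _ (hr x)
  · obtain ⟨α, hα, hr⟩ := h.exists_hom
    let β : TensorOver S A M L₁.carrier →ₗ[R] TensorOver S A M L₂.carrier :=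
      Φ₂.symm.toLinearMap ∘ₗ α.toLinearMap ∘ₗ Φ₁.toLinearMap
    have hΦβ : ∀ z, Φ₂ (β z) = α (Φ₁ z) := fun z => Φ₂.apply_symm_apply _
    have hβ : ∀ (b : B) z, β (b • z) = b • β z :=
      F'.map_smul_of_map_gamma_smul β.toAddMonoidHom
        (fun s x => (β.restrictScalars S).map_smul s x) fun g x => Φ₂.injective (by
          change Φ₂ (β _) = Φ₂ (F'.γ g • β x)
          rw [hΦβ, hΦ₁, hα, hΦ₂, hΦβ])
    obtain ⟨f, hfA, hf⟩ := D.exists_map_of_map_coeffMap hq₁ hq₂ β hβ fun z => E.e.injective (by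
      rw [← hr₁, ← hr₂, hΦβ, hr])
    exact Lift.iso_of_hom f (fun g x => by rw [← hγ₁, ← hγ₂, hfA]) hf

end Instances

/-- Tensoring with a bimodule that induces a stable equivalence of Morita type gives a
correspondence of lifts. -/
def tensorCorrespondence (hS : Function.Surjective (algebraMap (WittVector p k) S))
    (hρ : ∀ g v, ρ g v = F.γ g • v)
    (D : F.SplitTrace (TensorOver S B N M)) (D' : F'.SplitTrace (TensorOver S A M N))
    [Module.Finite Aᵐᵒᵖ M] [Module.Projective Aᵐᵒᵖ M] [Module.Projective B M]
    [Module.Finite Bᵐᵒᵖ N] [Module.Projective Bᵐᵒᵖ N]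
    (E : TensorModel A F' M V ρ') {P : CoeffRing p k → Prop}
    (hP : ∀ R, P R → RingHom.ker (algebraMap (WittVector p k) S) ≤
      RingHom.ker (algebraMap (WittVector p k) R)) : LiftCorrespondence P ρ ρ' :=
  -- The ring S is a quotient of W(k), so R is an S-algebra as soon as the kernel of W(k) → S acts
  -- on it by zero. This is where P enters.
  have key : ∀ R : CoeffRing p k, P R →
      ∃ (_ : Algebra S R) (_ : Module R V), IsScalarTower (WittVector p k) S R ∧
        IsScalarTower R k V ∧ IsScalarTower S R V ∧ SMulCommClass A R V := fun R hR => by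
    let _ := algebraOfSurjective (WittVector p k) S R hS (hP R hR)
    have hT : IsScalarTower (WittVector p k) S R :=
      isScalarTower_algebraOfSurjective (WittVector p k) S R hS (hP R hR)
    let _ := R.residueModule V
    have hk : IsScalarTower R k V := R.isScalarTower_residueModule V
    refine ⟨inferInstance, inferInstance, hT, hk, IsScalarTower.of_algebraMap_smul fun s v => ?_,
      ⟨fun a r v => smul_comm a (algebraMap R k r) v⟩⟩
    obtain ⟨w, rfl⟩ := hS s
    rw [← algebraMap_smul k (algebraMap _ S w) v, ← IsScalarTower.algebraMap_apply,
      ← IsScalarTower.algebraMap_apply, ← R.res_algebraMap w]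
    rfl
  { rel := TensorRel F E
    left_total := fun {R} L hR => by
      obtain ⟨_, _, _, _, _, _⟩ := key R hR
      exact TensorRel.exists_right hρ E L
    right_total := fun {R} L' hR => by
      obtain ⟨_, _, _, _, _, _⟩ := key R hR
      exact TensorRel.exists_left hρ D D' E L'
    iso_iff := fun {R} L₁ L₂ L₁' L₂' hR h₁ h₂ => by
      obtain ⟨_, _, _, _, _, _⟩ := key R hR
      exact TensorRel.iso_iff hS hρ D h₁ h₂
    map := fun f h => h.map f }

end TensorCorrespondence

/-! ### Block algebras and the two cases S = W(k) and S = k -/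

namespace GroupBlock

variable {S G : Type*} [CommRing S] [Group G] (b : GroupBlock S G)

theorem proj_val (x : b.Alg) : b.proj x.1 = x := by
  obtain ⟨h1, h2⟩ := (Subsemigroup.mem_corner_iff b.idem).mp x.2
  refine Subtype.ext ?_
  change b.e * x.1 * b.e = x.1
  rw [h1, h2]

theorem proj_mul_val (x : MonoidAlgebra S G) (y : b.Alg) : (b.proj x * y).1 = x * y.1 := by
  obtain ⟨h1, -⟩ := (Subsemigroup.mem_corner_iff b.idem).mp y.2
  change b.e * x * b.e * y.1 = x * y.1
  rw [mul_assoc, h1, (b.central.comm x).eq, mul_assoc, h1]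

theorem smul_val (s : S) (x : b.Alg) : (s • x).1 = s • x.1 := by
  rw [Algebra.smul_def, Algebra.smul_def, ← proj_mul_val]
  rfl

/-- Block algebras are symmetric, through the coefficient at `1`. -/
noncomputable def groupFrobenius [Fintype G] : GroupFrobenius S G b.Alg where
  γ := (b.proj : MonoidAlgebra S G →* b.Alg).comp (MonoidAlgebra.of S G)
  t :=
    { toFun := fun x => x.1.coeff 1
      map_add' := fun x y => rfl
      map_smul' := fun s x => by
        rw [smul_val]
        rfl }
  dual a := by
    have h : ∀ x : MonoidAlgebra S G, ∑ g, x.coeff g • MonoidAlgebra.of S G g = x := fun x => by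
      refine MonoidAlgebra.coeff_injective (Finsupp.ext fun h => ?_)
      simp
    conv_rhs => rw [← b.proj_val a, ← h a.1, map_sum]
    refine Finset.sum_congr rfl fun g _ => ?_
    rw [map_smul]
    -- The coefficient of a at g is the coefficient of g⁻¹a at 1.
    change (b.proj (MonoidAlgebra.of S G g⁻¹) * a).1.coeff 1 • b.proj (MonoidAlgebra.of S G g) = _
    rw [proj_mul_val, MonoidAlgebra.of_apply, MonoidAlgebra.coeff_single_mul_apply, inv_inv,
      mul_one, one_mul]

end GroupBlock

/-- Base change of symmetric quotients of group algebras. -/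
noncomputable def GroupFrobenius.baseChange {S G A : Type*} [CommRing S] [Group G] [Fintype G]
    [Ring A] [Algebra S A] (F : GroupFrobenius S G A) (T : Type*) [CommRing T] [Algebra S T] :
    GroupFrobenius T G (T ⊗[S] A) where
  γ := ((Algebra.TensorProduct.includeRight : A →ₐ[S] T ⊗[S] A) : A →* T ⊗[S] A).comp F.γ
  t := (TensorProduct.AlgebraTensorModule.rid S T T).toLinearMap ∘ₗ F.t.baseChange T
  dual a := by
    change ∑ g, TensorProduct.AlgebraTensorModule.rid S T T
      (F.t.baseChange T ((1 ⊗ₜ[S] F.γ g⁻¹) * a)) • (1 : T) ⊗ₜ[S] F.γ g = a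
    induction a using TensorProduct.induction_on with
    | zero => simp only [mul_zero, map_zero, zero_smul, Finset.sum_const_zero]
    | add a b ha hb => simp only [mul_add, map_add, add_smul, Finset.sum_add_distrib, ha, hb]
    | tmul c a =>
      conv_rhs => rw [← F.dual a, TensorProduct.tmul_sum]
      refine Finset.sum_congr rfl fun g _ => ?_
      rw [Algebra.TensorProduct.tmul_mul_tmul, one_mul, LinearMap.baseChange_tmul,
        TensorProduct.AlgebraTensorModule.rid_tmul, TensorProduct.smul_tmul', smul_eq_mul, mul_one,
        TensorProduct.smul_tmul]

/-- Compatibility of `M ⊗_A V` with base change, for modules `V` over the base change of `A`. -/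
theorem TensorOver.exists_baseChange_equiv {S T A M V : Type*} [CommRing S] [CommRing T]
    [Algebra S T] [Ring A] [Algebra S A] [AddCommGroup M] [Module S M] [Module Aᵐᵒᵖ M]
    [IsScalarTower S Aᵐᵒᵖ M] [AddCommGroup V] [Module T V] [Module S V] [IsScalarTower S T V]
    [Module A V] [IsScalarTower S A V] [SMulCommClass A T V] [Module (T ⊗[S] A) V]
    (hV : ∀ (t : T) (a : A) (v : V), (t ⊗ₜ[S] a) • v = t • a • v) :
    ∃ e : TensorOver S A M V ≃+ TensorOver T (T ⊗[S] A) (BaseChangeMod T S M) V, ∀ m v,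
      e (mk S A m v) = mk T (T ⊗[S] A) (BaseChangeMod.mk S 1 m) v := by
  let Z := TensorOver T (T ⊗[S] A) (BaseChangeMod T S M) V
  let _ : Module S Z := Module.compHom Z (algebraMap S T)
  have hS : ∀ (s : S) (z : Z), s • z = algebraMap S T s • z := fun _ _ => rfl
  let f₀ : M →ₗ[S] V →ₗ[S] Z :=
    { toFun := fun m =>
        { toFun := fun v => mk T (T ⊗[S] A) (BaseChangeMod.mk S 1 m) v
          map_add' := mk_add _
          map_smul' := fun s v => by
            rw [RingHom.id_apply, hS, smul_mk_right, algebraMap_smul] }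
      map_add' := fun m m' => LinearMap.ext fun v =>
        (congrArg (fun z : BaseChangeMod T S M => mk T (T ⊗[S] A) z v)
          (TensorProduct.tmul_add (1 : T) m m')).trans (add_mk _ _ _)
      map_smul' := fun s m => LinearMap.ext fun v => by
        refine (congrArg (fun z => mk T (T ⊗[S] A) z v)
          (?_ : BaseChangeMod.mk S (1 : T) (s • m) =
            algebraMap S T s • BaseChangeMod.mk S (1 : T) m)).trans rfl
        change (1 : T) ⊗ₜ[S] (s • m) = algebraMap S T s • ((1 : T) ⊗ₜ[S] m)
        rw [TensorProduct.tmul_smul, algebraMap_smul] }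
  have hone : ∀ (a : A) (v : V), ((1 : T) ⊗ₜ[S] a) • v = a • v := fun a v => by
    rw [hV, one_smul]
  let f : TensorOver S A M V →ₗ[S] Z := lift f₀ fun m a v => by
    change mk T (T ⊗[S] A) (BaseChangeMod.mk S 1 (op a • m)) v =
      mk T (T ⊗[S] A) (BaseChangeMod.mk S 1 m) (a • v)
    rw [← hone, ← op_smul_tmul, BaseChangeMod.op_tmul_smul_mk, one_mul]
  let g₀ : BaseChangeMod T S M →ₗ[T] V →ₗ[T] TensorOver S A M V :=
    (mkHom T S A M V).liftBaseChange T
  have hg₀ : ∀ t m v, g₀ (BaseChangeMod.mk S t m) v = t • mk S A m v := fun t m v =>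
    LinearMap.congr_fun (LinearMap.liftBaseChange_tmul T (mkHom T S A M V) t m) v
  let g : Z →ₗ[T] TensorOver S A M V := lift g₀ fun z a v => by
    induction z using BaseChangeMod.induction_on with
    | zero => simp only [smul_zero, map_zero, LinearMap.zero_apply]
    | add x y hx hy => simp only [smul_add, map_add, LinearMap.add_apply, hx, hy]
    | mk t m =>
      induction a using TensorProduct.induction_on with
      | zero => simp only [MulOpposite.op_zero, zero_smul, map_zero, LinearMap.zero_apply]
      | add a b ha hb =>
        simp only [MulOpposite.op_add, add_smul, map_add, LinearMap.add_apply, ha, hb]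
      | tmul c a =>
        rw [BaseChangeMod.op_tmul_smul_mk, hg₀, hg₀, hV, op_smul_tmul, ← coeff_smul_mk, smul_smul,
          mul_comm]
  have hg : ∀ t m v, g (mk T (T ⊗[S] A) (BaseChangeMod.mk S t m) v) = t • mk S A m v := hg₀
  refine ⟨{ f.toAddMonoidHom with
    invFun := g
    left_inv := fun z => ?_
    right_inv := fun z => ?_ }, fun m v => rfl⟩
  · change g (f z) = z
    induction z using induction_on with
    | zero => simp only [map_zero]
    | add x y hx hy => simp only [map_add, hx, hy]
    | mk m v =>
      change g (mk T (T ⊗[S] A) (BaseChangeMod.mk S 1 m) v) = _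
      rw [hg, one_smul]
  · change f (g z) = z
    induction z using induction_on with
    | zero => simp only [map_zero]
    | add x y hx hy => simp only [map_add, hx, hy]
    | mk z v =>
      induction z using BaseChangeMod.induction_on with
      | zero =>
        have h : mk T (T ⊗[S] A) (0 : BaseChangeMod T S M) v = 0 :=
          congrArg (tensorOverRel T (T ⊗[S] A) (BaseChangeMod T S M) V).mkQ
            (TensorProduct.zero_tmul _ v)
        rw [h, map_zero, map_zero]
      | add x y hx hy => rw [add_mk, map_add, map_add, hx, hy]
      | mk t m =>
        rw [hg, coeff_smul_mk]
        change mk T (T ⊗[S] A) (BaseChangeMod.mk S 1 m) (t • v) = _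
        rw [← smul_mk_right, smul_mk_left]
        congr 1
        change t • ((1 : T) ⊗ₜ[S] m) = t ⊗ₜ[S] m
        rw [TensorProduct.smul_tmul', smul_eq_mul, mul_one]

section Blocks

variable {p : ℕ} [Fact p.Prime] {k : Type u} [Field k] {G H : Type*} [Group G] [Finite G] [Group H]
  [Finite H] {A : GroupBlock (WittVector p k) G} {B : GroupBlock (WittVector p k) H}
  {V : Type*} [AddCommGroup V] [Module k V]
  [Module (k ⊗[WittVector p k] A.Alg) V] [IsScalarTower k (k ⊗[WittVector p k] A.Alg) V]

variable (V) in
-- The bimodules are used over W(k) itself, and `exists_baseChange_equiv` identifies M ⊗_A V with (k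
-- ⊗ M) ⊗_{kA} V.
theorem IsStableEquivOfMoritaType.nonempty_liftCorrespondence {M N : Type*}
    [AddCommGroup M] [Module (WittVector p k) M] [Module B.Alg M] [Module A.Algᵐᵒᵖ M]
    [IsScalarTower (WittVector p k) B.Alg M] [IsScalarTower (WittVector p k) A.Algᵐᵒᵖ M]
    [SMulCommClass B.Alg A.Algᵐᵒᵖ M]
    [AddCommGroup N] [Module (WittVector p k) N] [Module A.Alg N] [Module B.Algᵐᵒᵖ N]
    [IsScalarTower (WittVector p k) A.Alg N] [IsScalarTower (WittVector p k) B.Algᵐᵒᵖ N]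
    [SMulCommClass A.Alg B.Algᵐᵒᵖ N]
    (h : IsStableEquivOfMoritaType (WittVector p k) A.Alg B.Alg M N) :
    Nonempty (LiftCorrespondence (fun _ : CoeffRing p k => True) (A.rep k V)
      (B.rep k (TensorOver k (k ⊗[WittVector p k] A.Alg)
        (BaseChangeMod k (WittVector p k) M) V))) := by
  obtain ⟨_⟩ := nonempty_fintype G
  obtain ⟨_⟩ := nonempty_fintype H
  have := h.finite_right_M
  have := h.projective_right_M
  have := h.projective_left_M
  have := h.finite_right_N
  have := h.projective_right_N
  obtain ⟨D⟩ := A.groupFrobenius.nonempty_splitTrace h.iso_A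
  obtain ⟨D'⟩ := B.groupFrobenius.nonempty_splitTrace h.iso_B
  let _ : Module (WittVector p k) V := Module.compHom V (algebraMap (WittVector p k) k)
  have : IsScalarTower (WittVector p k) k V := IsScalarTower.of_algebraMap_smul fun _ _ => rfl
  let ι : A.Alg →ₐ[WittVector p k] k ⊗[WittVector p k] A.Alg :=
    Algebra.TensorProduct.includeRight
  let _ : Module A.Alg V := Module.compHom V ι.toRingHom
  have hι : ∀ (a : A.Alg) (v : V), a • v = ι a • v := fun _ _ => rfl
  have hk : ∀ (c : k) (a : A.Alg) (v : V), (c ⊗ₜ[WittVector p k] a) • v = c • a • v :=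
    fun c a v => by
      rw [hι, ← smul_assoc]
      change _ = (c • ((1 : k) ⊗ₜ[WittVector p k] a)) • v
      rw [TensorProduct.smul_tmul', smul_eq_mul, mul_one]
  have : IsScalarTower (WittVector p k) A.Alg V := ⟨fun w a v => by
    rw [hι, hι, map_smul, ← algebraMap_smul k w (ι a), smul_assoc, algebraMap_smul]⟩
  have : SMulCommClass A.Alg k V := ⟨fun a c v => smul_comm (ι a) c v⟩
  obtain ⟨e, he⟩ := TensorOver.exists_baseChange_equiv (M := M) hk
  let E : TensorModel A.Alg B.groupFrobenius M V (B.rep k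
      (TensorOver k (k ⊗[WittVector p k] A.Alg) (BaseChangeMod k (WittVector p k) M) V)) :=
    { e := e
      e_smul := fun c m v => by rw [he, he, TensorOver.smul_mk_right]
      e_act := fun σ z => by
        induction z using TensorOver.induction_on with
        | zero => simp only [smul_zero, map_zero]
        | add x y hx hy => simp only [smul_add, map_add, hx, hy]
        | mk m v =>
          rw [TensorOver.smul_mk, he, he]
          change _ = ((1 : k) ⊗ₜ[WittVector p k] B.groupFrobenius.γ σ) •
            TensorOver.mk k (k ⊗[WittVector p k] A.Alg)
              (BaseChangeMod.mk (WittVector p k) (1 : k) m) v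
          rw [TensorOver.smul_mk, BaseChangeMod.tmul_smul_mk, one_mul] }
  -- Here S = W(k), so the kernel condition is void and every coefficient ring is admissible.
  exact ⟨tensorCorrespondence Function.surjective_id (fun _ _ => rfl) D D' E
    fun R _ x (hx : x = 0) => by rw [hx]; exact zero_mem _⟩

variable (V) in
theorem IsStableEquivOfMoritaType.nonempty_liftCorrespondence_of_residue [CharP k p]
    [PerfectRing k p] {M N : Type*}
    [AddCommGroup M] [Module k M] [Module (k ⊗[WittVector p k] B.Alg) M]
    [Module (k ⊗[WittVector p k] A.Alg)ᵐᵒᵖ M]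
    [IsScalarTower k (k ⊗[WittVector p k] B.Alg) M]
    [IsScalarTower k (k ⊗[WittVector p k] A.Alg)ᵐᵒᵖ M]
    [SMulCommClass (k ⊗[WittVector p k] B.Alg) (k ⊗[WittVector p k] A.Alg)ᵐᵒᵖ M]
    [AddCommGroup N] [Module k N] [Module (k ⊗[WittVector p k] A.Alg) N]
    [Module (k ⊗[WittVector p k] B.Alg)ᵐᵒᵖ N]
    [IsScalarTower k (k ⊗[WittVector p k] A.Alg) N]
    [IsScalarTower k (k ⊗[WittVector p k] B.Alg)ᵐᵒᵖ N]
    [SMulCommClass (k ⊗[WittVector p k] A.Alg) (k ⊗[WittVector p k] B.Alg)ᵐᵒᵖ N]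
    (h : IsStableEquivOfMoritaType k (k ⊗[WittVector p k] A.Alg) (k ⊗[WittVector p k] B.Alg) M N) :
    Nonempty (LiftCorrespondence (fun R : CoeffRing p k => (p : R) = 0) (A.rep k V)
      (B.rep k (TensorOver k (k ⊗[WittVector p k] A.Alg) M V))) := by
  obtain ⟨_⟩ := nonempty_fintype G
  obtain ⟨_⟩ := nonempty_fintype H
  have := h.finite_right_M
  have := h.projective_right_M
  have := h.projective_left_M
  have := h.finite_right_N
  have := h.projective_right_N
  obtain ⟨D⟩ := (A.groupFrobenius.baseChange k).nonempty_splitTrace h.iso_A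
  obtain ⟨D'⟩ := (B.groupFrobenius.baseChange k).nonempty_splitTrace h.iso_B
  let E : TensorModel (k ⊗[WittVector p k] A.Alg) (B.groupFrobenius.baseChange k) M V (B.rep k
      (TensorOver k (k ⊗[WittVector p k] A.Alg) M V)) :=
    { e := AddEquiv.refl _
      e_smul := fun c m v => (TensorOver.smul_mk_right c m v).symm
      e_act := fun _ _ => rfl }
  -- Here S = k, and the kernel of W(k) → k is generated by p because k is perfect; only rings with
  -- p = 0 are admissible.
  exact ⟨tensorCorrespondence algebraMap_witt_surjective (fun _ _ => rfl) D D' E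
    fun R hR => ker_algebraMap_witt_le R hR⟩

end Blocks

theorem mainTheorem7 (p : ℕ) [Fact p.Prime] (k : Type u) [Field k] [CharP k p] [IsAlgClosed k]
    {G H : Type*} [Group G] [Finite G] [Group H] [Finite H]
    (A : GroupBlock (WittVector p k) G) (B : GroupBlock (WittVector p k) H)
    (V : Type*) [AddCommGroup V] [Module k V]
    [Module (k ⊗[WittVector p k] A.Alg) V] [IsScalarTower k (k ⊗[WittVector p k] A.Alg) V]
    [Module.Finite (k ⊗[WittVector p k] A.Alg) V] :
    (∀ (M N : Type*)
      [AddCommGroup M] [Module (WittVector p k) M] [Module B.Alg M] [Module A.Algᵐᵒᵖ M]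
      [IsScalarTower (WittVector p k) B.Alg M] [IsScalarTower (WittVector p k) A.Algᵐᵒᵖ M]
      [SMulCommClass B.Alg A.Algᵐᵒᵖ M]
      [AddCommGroup N] [Module (WittVector p k) N] [Module A.Alg N] [Module B.Algᵐᵒᵖ N]
      [IsScalarTower (WittVector p k) A.Alg N] [IsScalarTower (WittVector p k) B.Algᵐᵒᵖ N]
      [SMulCommClass A.Alg B.Algᵐᵒᵖ N],
      IsStableEquivOfMoritaType (WittVector p k) A.Alg B.Alg M N →
      ((∃ R : CoeffRing p k, IsVersalDeformationRing (A.rep k V) R) ↔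
        ∃ R' : CoeffRing p k, IsVersalDeformationRing
          (B.rep k (TensorOver k (k ⊗[WittVector p k] A.Alg)
            (BaseChangeMod k (WittVector p k) M) V)) R') ∧
      ∀ R R' : CoeffRing p k,
        IsVersalDeformationRing (A.rep k V) R →
        IsVersalDeformationRing
          (B.rep k (TensorOver k (k ⊗[WittVector p k] A.Alg)
            (BaseChangeMod k (WittVector p k) M) V)) R' →
        R.Iso R') ∧
    (∀ (Mk Nk : Type*)
      [AddCommGroup Mk] [Module k Mk] [Module (k ⊗[WittVector p k] B.Alg) Mk]
      [Module (k ⊗[WittVector p k] A.Alg)ᵐᵒᵖ Mk]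
      [IsScalarTower k (k ⊗[WittVector p k] B.Alg) Mk]
      [IsScalarTower k (k ⊗[WittVector p k] A.Alg)ᵐᵒᵖ Mk]
      [SMulCommClass (k ⊗[WittVector p k] B.Alg) (k ⊗[WittVector p k] A.Alg)ᵐᵒᵖ Mk]
      [AddCommGroup Nk] [Module k Nk] [Module (k ⊗[WittVector p k] A.Alg) Nk]
      [Module (k ⊗[WittVector p k] B.Alg)ᵐᵒᵖ Nk]
      [IsScalarTower k (k ⊗[WittVector p k] A.Alg) Nk]
      [IsScalarTower k (k ⊗[WittVector p k] B.Alg)ᵐᵒᵖ Nk]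
      [SMulCommClass (k ⊗[WittVector p k] A.Alg) (k ⊗[WittVector p k] B.Alg)ᵐᵒᵖ Nk],
      IsStableEquivOfMoritaType k (k ⊗[WittVector p k] A.Alg) (k ⊗[WittVector p k] B.Alg) Mk Nk →
      ∀ R R' : CoeffRing p k,
        IsVersalDeformationRing (A.rep k V) R →
        IsVersalDeformationRing
          (B.rep k (TensorOver k (k ⊗[WittVector p k] A.Alg) Mk V)) R' →
        Nonempty ((R ⧸ Ideal.span {(p : R)}) ≃ₐ[WittVector p k] (R' ⧸ Ideal.span {(p : R')}))) := by
  refine ⟨fun M N _ _ _ _ _ _ _ _ _ _ _ _ _ _ h => ?_,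
    fun M N _ _ _ _ _ _ _ _ _ _ _ _ _ _ h R R' ⟨U, hU⟩ ⟨U', hU'⟩ => ?_⟩
  · obtain ⟨C⟩ := h.nonempty_liftCorrespondence V
    refine ⟨⟨fun ⟨R, U, hU⟩ => ?_, fun ⟨R, U, hU⟩ => ?_⟩, fun R R' ⟨U, hU⟩ ⟨U', hU'⟩ => ?_⟩
    · obtain ⟨U', hU'⟩ := C.isVersalWithin trivial (hU.isVersalWithin trivial)
      exact ⟨R, U', hU'.isVersalDeformation fun _ => trivial⟩
    · obtain ⟨U', hU'⟩ := C.symm.isVersalWithin trivial (hU.isVersalWithin trivial)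
      exact ⟨R, U', hU'.isVersalDeformation fun _ => trivial⟩
    · obtain ⟨U'', hU''⟩ := C.isVersalWithin trivial (hU.isVersalWithin trivial)
      exact hU''.ring_iso (hU'.isVersalWithin trivial)
  · obtain ⟨C⟩ := h.nonempty_liftCorrespondence_of_residue V
    -- The versal deformation is first reduced to R/pR, where the correspondence is available, and
    -- the result is compared with the reduction of U' to R'/pR'.
    obtain ⟨U'', hU''⟩ := C.isVersalWithin CoeffRing.natCast_p_dual hU.modP
    obtain ⟨e, -⟩ := hU''.ring_iso hU'.modP
    exact ⟨e⟩
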